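/- **Setting.** Fix constants $k_1>k_2>0$. For $n\ge 1$ and $k_{3,1},k_{3,2}\ge 0$ let $\mathcal L$ be the symmetric tridiagonal $2n\times 2n$ matrix of the diatomic chain of $n$ unit cells: off-diagonal entries $k_1,k_2,k_1,\dots,k_2,k_1$, and diagonal $-k_1-k_{3,1},\,-k_1-k_2,\dots,-k_1-k_2,\,-k_1-k_{3,2}$ (for $n=1$: $-k_1-k_{3,1},-k_1-k_{3,2}$). An eigenstate is $u\ne0$ with $\mathcal L u=-\omega^2u$, $\omega\ge0$. The end stiffnesses $k_{3,1}=k_{3,1}(n)$ and $k_{3,2}=k_{3,2}(n)$ may depend on $n$ but are bounded. For sequences, $f\approx g$ means $f(n)-g(n)\to0$, and $f\not\approx g$ means $|f(n)-g(n)|\ge\delta$ for some $\delta>0$ and all large $n$; inequalities between sequences are meant for all large $n$. Say that an eigenstate has real decay factor $a\in\mathbb R$, $0<|a|\le1$, if $$a^2+a\,\frac{-\omega^4+2\omega^2(k_1+k_2)-2k_1k_2}{k_1k_2}+1=0 .$$ If $|a|<1$, then $\omega^2=k_1+k_2+s\sqrt{(k_1+k_2a)(k_1+k_2/a)}$ with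 $s=\pm1$, and $$(u_{2m+1},u_{2m+2})^T=c_1a^mv_1+c_2a^{-m}v_2\quad(0\le m<n),$$ $$v_1=\bigl(-s\sqrt{k_1+k_2/a},\ \sqrt{k_1+k_2a}\bigr)^T,\qquad v_2=\bigl(-s\sqrt{k_1+k_2a},\ \sqrt{k_1+k_2/a}\bigr)^T .$$ A family of eigenstates (one for each $n$ in an infinite set of chain lengths) consists of *edge states* if its decay factors are real with $|a|\le\rho$ for some $\rho<1$ and all large $n$; of *left edge states* if moreover $|c_2a^{2-2n}|=O(|c_1|)$; of *right edge states* if the mirror images $(u_{2n},\dots,u_1)$ are left edge states of the mirrored chain (equivalently: edge states with $|c_1|=O(|c_2|)$); and of *two-sided edge states* if it consists of edge states and is neither a family of left nor of right edge states. Numbers of eigenstates are counted up to scalar multiples and hold for all large $n$. **Theorem.** (1) Suppose $|k_{3,1}-k_2|\not\approx k_2$. - (a) If $k_{3,1}<2k_2$, there are no left edge states and no two-sided edge states. - (b) If $k_{3,1}>2k_2$ and $k_{3,1}\not\approx k_{3,2}$, there are exactly two left edge states. Their decay factors $a$ satisfy $|a-\tilde a|=O(|\tilde a|^{2n})$ with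 $\tilde a=\tilde a_1\in(-1,0)$ for one and $\tilde a=\tilde a_2\in(0,1)$ for the other, where $\tilde a_1,\tilde a_2$ are the roots of $$(k_{3,1}-k_2)^2k_1\tilde a^2+[k_2(k_{3,1}-k_2)^2-k_2^3]\tilde a-k_1k_2^2=0 .$$ - (c) If $k_{3,1}>2k_2$ and $k_{3,1}\approx k_{3,2}$, there are exactly four two-sided edge states. Normalized by $c_1=1$, they satisfy $|c_2a^{-2n}|\to\infty$ and $c_2\to0$. - (d) If $|k_{3,2}-k_2|\not\approx k_2$, there are no slow-decaying or non-localized eigenstates with real $a\approx\pm1$: for some $\eta>0$ and all large $n$, no eigenstate has a real decay factor $a$ with $1-\eta<|a|\le1$. - (e) If $|k_{3,2}-k_2|\approx k_2$, then for some $\eta>0$ and all large $n$ at most one eigenstate has a real decay factor with $|a-1|<\eta$ and at most one has a real decay factor with $|a+1|<\eta$. Moreover, for $\sigma=\pm1$: if $k_{3,2}-k_2\approx\mp\sigma k_2$, then each eigenstate with real $a\approx\pm1$ (if any) satisfies $\omega^2\approx k_1+k_2-\sigma(k_1\pm k_2)$ (upper signs together or lower signs together), that is, for each $\varepsilon>0$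 there is $\eta>0$ such that for all large $n$ each eigenstate with real $a$ and $|a\mp1|<\eta$ satisfies $|\omega^2-(k_1+k_2-\sigma(k_1\pm k_2))|<\varepsilon$. (2) Suppose $|k_{3,i}-k_2|\approx k_2$ for both $i=1,2$. Then for some $\eta>0$ and all large $n$ at most two eigenstates have a real decay factor with $|a-1|<\eta$ and at most two have a real decay factor with $|a+1|<\eta$. Moreover, for $\sigma=\pm1$: if $k_{3,i}-k_2\approx\mp\sigma k_2$ for $i=1,2$, then each eigenstate with real $a\approx\pm1$ (if any) satisfies $\omega^2\approx k_1+k_2-\sigma(k_1\pm k_2)$, in the same sense. -/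

import Mathlib

open Filter Topology Asymptotics

noncomputable section

namespace DiatomicChain

/-- The `2n × 2n` matrix `𝓛` of the chain of `n` unit cells: bonds `k₁` inside the cells, `k₂`
between neighbouring cells, and end springs `k₃₁` (left) and `k₃₂` (right) attached to fixed walls.
Site `j` of the chain (`1 ≤ j ≤ 2n`) has index `j - 1` here. -/
def chainMatrix (k₁ k₂ k₃₁ k₃₂ : ℝ) (n : ℕ) : Matrix (Fin (2 * n)) (Fin (2 * n)) ℝ :=
  Matrix.of fun i j =>
    if i = j then
      -(k₁ + (if (i : ℕ) = 0 then k₃₁ else if (i : ℕ) + 1 = 2 * n then k₃₂ else k₂))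
    else if (i : ℕ) + 1 = (j : ℕ) then (if (i : ℕ) % 2 = 0 then k₁ else k₂)
    else if (j : ℕ) + 1 = (i : ℕ) then (if (j : ℕ) % 2 = 0 then k₁ else k₂)
    else 0

/-- `u ≠ 0` and `-ω² u = 𝓛 u`, with eigenfrequency `ω ≥ 0`. -/
def IsMode (k₁ k₂ k₃₁ k₃₂ : ℝ) (n : ℕ) (ω : ℝ) (u : Fin (2 * n) → ℝ) : Prop :=
  0 ≤ ω ∧ u ≠ 0 ∧ (chainMatrix k₁ k₂ k₃₁ k₃₂ n).mulVec u = (-ω ^ 2) • u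

/-- `a` is a real number with `0 < |a| ≤ 1` that is an eigenvalue of the transfer matrix between
neighbouring unit cells at frequency `ω`, i.e.
`a² + a (-ω⁴ + 2 ω² (k₁ + k₂) - 2 k₁ k₂) / (k₁ k₂) + 1 = 0`. -/
def IsRealMultiplier (k₁ k₂ ω a : ℝ) : Prop :=
  0 < |a| ∧ |a| ≤ 1 ∧
    a ^ 2 + a * ((-ω ^ 4 + 2 * ω ^ 2 * (k₁ + k₂) - 2 * k₁ * k₂) / (k₁ * k₂)) + 1 = 0

/-- `ω` is an eigenfrequency of the chain of `n` cells whose eigenstate has the real decay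
factor `a` (`a = ±1` allowed). -/
def HasRealMode (k₁ k₂ k₃₁ k₃₂ : ℝ) (n : ℕ) (ω a : ℝ) : Prop :=
  (∃ u, IsMode k₁ k₂ k₃₁ k₃₂ n ω u) ∧ IsRealMultiplier k₁ k₂ ω a

/-- The data describing an eigenstate with real decay factor `a`, `0 < |a| < 1`. -/
structure WaveData where
  ω : ℝ
  a : ℝ
  σ : ℝ
  c₁ : ℝ
  c₂ : ℝ

/-- The transfer-matrix eigenvector `v₁` for the eigenvalue `a`, in the case `k₁ > k₂`
(where `k₁ + k₂ a > 0` and `k₁ + k₂ / a ≥ 0`). It has the same norm as `v₂`. -/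
def v₁ (k₁ k₂ : ℝ) (d : WaveData) : Fin 2 → ℝ :=
  ![-d.σ * √(k₁ + k₂ / d.a), √(k₁ + k₂ * d.a)]

/-- The transfer-matrix eigenvector `v₂` for the eigenvalue `1 / a`, in the case `k₁ > k₂`. -/
def v₂ (k₁ k₂ : ℝ) (d : WaveData) : Fin 2 → ℝ :=
  ![-d.σ * √(k₁ + k₂ * d.a), √(k₁ + k₂ / d.a)]

/-- `d` describes an eigenstate `u` of the chain of `n` cells: with `0 < |a| < 1`, `σ = ±1`,
`ω² = k₁ + k₂ + σ √((k₁ + k₂ a)(k₁ + k₂ / a))` and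
`(u_{2m+1}, u_{2m+2}) = c₁ aᵐ v₁ + c₂ a⁻ᵐ v₂` for `0 ≤ m < n`. -/
def IsEigenstate (k₁ k₂ k₃₁ k₃₂ : ℝ) (n : ℕ) (d : WaveData) : Prop :=
  ∃ u : Fin (2 * n) → ℝ, IsMode k₁ k₂ k₃₁ k₃₂ n d.ω u ∧
    0 < |d.a| ∧ |d.a| < 1 ∧ (d.σ = 1 ∨ d.σ = -1) ∧
    0 ≤ (k₁ + k₂ * d.a) * (k₁ + k₂ / d.a) ∧
    d.ω ^ 2 = k₁ + k₂ + d.σ * √((k₁ + k₂ * d.a) * (k₁ + k₂ / d.a)) ∧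
    ∀ (m : Fin n) (i : Fin 2),
      u ⟨2 * (m : ℕ) + (i : ℕ), by have := m.isLt; have := i.isLt; omega⟩ =
        d.c₁ * d.a ^ (m : ℕ) * v₁ k₁ k₂ d i + d.c₂ * (d.a⁻¹) ^ (m : ℕ) * v₂ k₁ k₂ d i

/-- The description of the mirror image `(u_{2n}, …, u_1)` of the state described by `d`, as a
state of the chain with `k₃₁` and `k₃₂` exchanged. -/
def WaveData.mirror (n : ℕ) (d : WaveData) : WaveData where
  ω := d.ω
  a := d.a
  σ := d.σ
  c₁ := -d.σ * d.c₂ * d.a ^ (1 - (n : ℤ))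
  c₂ := -d.σ * d.c₁ * d.a ^ ((n : ℤ) - 1)

/-! Asymptotic notions, for sequences indexed by the number `n` of cells. Families of states may
be given only for `n` in a set `S` of chain lengths. -/

/-- `f ≈ g`. -/
def Close (f g : ℕ → ℝ) : Prop := Tendsto (fun n => f n - g n) atTop (𝓝 0)

/-- `f ≉ g`: `f` stays away from `g`. -/
def Apart (f g : ℕ → ℝ) : Prop := ∃ δ > 0, ∀ᶠ n in atTop, δ ≤ |f n - g n|

/-- For all large `n ∈ S`, `s n` is an eigenstate of the chain of `n` cells. -/
def IsFamily (k₁ k₂ : ℝ) (k₃₁ k₃₂ : ℕ → ℝ) (S : Set ℕ) (s : ℕ → WaveData) : Prop :=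
  ∀ᶠ n in atTop, n ∈ S → IsEigenstate k₁ k₂ (k₃₁ n) (k₃₂ n) n (s n)

/-- Edge states: `|a| ≉ 1`. -/
def IsEdge (S : Set ℕ) (s : ℕ → WaveData) : Prop :=
  ∃ ρ < 1, ∀ᶠ n in atTop, n ∈ S → |(s n).a| ≤ ρ

/-- Left edge states: edge states with `|(c₂ / c₁) a^(2 - 2n)| = O(1)`. -/
def IsLeftEdge (S : Set ℕ) (s : ℕ → WaveData) : Prop :=
  IsEdge S s ∧ ∃ C : ℝ, ∀ᶠ n in atTop, n ∈ S →
    |(s n).c₂ * (s n).a ^ (2 - 2 * (n : ℤ))| ≤ C * |(s n).c₁|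

/-- Right edge states: the mirror images are left edge states. -/
def IsRightEdge (S : Set ℕ) (s : ℕ → WaveData) : Prop :=
  IsLeftEdge S fun n => (s n).mirror n

/-- Two-sided edge states: edge states that are neither left nor right edge states. -/
def IsTwoSidedEdge (S : Set ℕ) (s : ℕ → WaveData) : Prop :=
  IsEdge S s ∧ ¬ IsLeftEdge S s ∧ ¬ IsRightEdge S s

/-- The equation for the decay factor `ã` of an edge state of the semi-infinite chain. -/
def IsSemiInfiniteRoot (k₁ k₂ k₃₁ a : ℝ) : Prop :=
  (k₃₁ - k₂) ^ 2 * k₁ * a ^ 2 + (k₂ * (k₃₁ - k₂) ^ 2 - k₂ ^ 3) * a - k₁ * k₂ ^ 2 = 0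

/-- For large `n` there are no eigenstates with real decay factor `a ≈ a₀`. -/
def NoModeNear (k₁ k₂ : ℝ) (k₃₁ k₃₂ : ℕ → ℝ) (a₀ : ℝ) : Prop :=
  ∃ η > 0, ∀ᶠ n in atTop, ∀ ω a : ℝ,
    HasRealMode k₁ k₂ (k₃₁ n) (k₃₂ n) n ω a → η ≤ |a - a₀|

/-- For large `n` there are at most `N` eigenstates with real decay factor `a ≈ a₀`
(counted by their eigenfrequencies; each eigenspace is a line). -/
def AtMostModesNear (k₁ k₂ : ℝ) (k₃₁ k₃₂ : ℕ → ℝ) (a₀ : ℝ) (N : ℕ∞) : Prop :=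
  ∃ η > 0, ∀ᶠ n in atTop,
    {ω : ℝ | ∃ a, HasRealMode k₁ k₂ (k₃₁ n) (k₃₂ n) n ω a ∧ |a - a₀| < η}.encard ≤ N

/-- Each eigenstate with real decay factor `a ≈ a₀`, if any, satisfies `ω² ≈ W`. -/
def ModesNearHaveFreq (k₁ k₂ : ℝ) (k₃₁ k₃₂ : ℕ → ℝ) (a₀ W : ℝ) : Prop :=
  ∀ ε > 0, ∃ η > 0, ∀ᶠ n in atTop, ∀ ω a : ℝ,
    HasRealMode k₁ k₂ (k₃₁ n) (k₃₂ n) n ω a → |a - a₀| < η → |ω ^ 2 - W| < ε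

end DiatomicChain

end

/-! Put x_i = (k₃ᵢ − k₂)/k₂. A Bloch wave with real multiplier a = s·t (s = ±1, 0 < t ≤ 1) on the
branch σ = ±1 of ω² is determined by one more number ρ ∈ [0, 1], the ratio of its amplitudes on the
two sublattices. With θ_i = sσx_i and t < 1, the two boundary conditions combine into the secular
equation (1 − θ₁ρ)(1 − θ₂ρ) = t^(2n) (θ₁ − ρ)(θ₂ − ρ) (`HasState.secular`).

Edge states. If t stays below 1, the right side is exponentially small, so ρ must be close to some
1/θ_i. The matching condition at the left end shows that a left edge state has ρ ≈ 1/θ₁. This is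
impossible if |x₁| < 1. If x₁ > 1 it forces σ = s and ρ ≈ 1/x₁, with both signs s possible. For x₁,
x₂ apart, each s gives one root near 1/x₁ (`exists_left_edge_root`). For x₁ ≈ x₂ the left side is
almost a square, and the small positive right side splits the double root into two, one on each side
of 1/x₁ (`exists_two_sided_root`).

Band edges a = ±1. The secular equation is equivalent to (θ₁ − ρ)(θ₂ − ρ)(1 − t^(2n)) = −(1 − ρ²)(1
− θ₁θ₂). For bounded θ_i away from 1 the right side is O(1 − t²), while near t = 1 and for large n
the left side exceeds any fixed multiple of 1 − t². So there are no such states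
(`not_hasState_near_edge`).

Upper bounds for the number of states come from a rank argument instead of derivatives
(`exists_eigenvector_of_agree`, `encard_hasState_le`). Changing m diagonal entries of a symmetric
matrix cannot empty an interval that contains m + 1 eigenvalues. It therefore suffices to reset the
responsible end springs to x_i = 0 and to check that no state is left in the window. -/

open Asymptotics

namespace DiatomicChain

/-! ### Eigenvalues under a perturbation supported on few sites -/

/-- If two symmetric matrices agree on the vectors that vanish on `F`, and the first has more than
`F.card` distinct eigenvalues in a closed interval, then the second one has an eigenvalue there. -/
theorem exists_eigenvector_of_agree {ι κ : Type*} [Fintype ι] [DecidableEq ι] [Fintype κ]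
    {A B : Matrix ι ι ℝ} (hA : A.IsHermitian) (hB : B.IsHermitian) {c r : ℝ}
    (F : Finset ι) (hF : F.card < Fintype.card κ)
    (hAB : ∀ w : ι → ℝ, (∀ i ∈ F, w i = 0) → A.mulVec w = B.mulVec w)
    {μ : κ → ℝ} (hμ : Function.Injective μ) (hr : ∀ j, |μ j - c| ≤ r)
    {u : κ → ι → ℝ} (hu : ∀ j, u j ≠ 0) (hAu : ∀ j, A.mulVec (u j) = μ j • u j) :
    ∃ (ν : ℝ) (v : ι → ℝ), |ν - c| ≤ r ∧ v ≠ 0 ∧ B.mulVec v = ν • v := by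
  classical
  have horth : ∀ j k, j ≠ k → u j ⬝ᵥ u k = 0 := by
    intro j k hjk
    have h1 : u j ⬝ᵥ A.mulVec (u k) = A.mulVec (u j) ⬝ᵥ u k := by
      rw [Matrix.dotProduct_mulVec, ← Matrix.mulVec_transpose]
      have : A.transpose = A := Matrix.IsSymm.eq (by simpa using hA)
      rw [this]
    rw [hAu, hAu, dotProduct_smul, smul_dotProduct, smul_eq_mul, smul_eq_mul] at h1
    have h2 : (μ k - μ j) * (u j ⬝ᵥ u k) = 0 := by linarith
    rcases mul_eq_zero.1 h2 with h | h
    · exact absurd (hμ (sub_eq_zero.1 h)).symm hjk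
    · exact h
  have hsum : ∀ g : κ → ℝ, (∑ j, g j • u j) ⬝ᵥ (∑ j, g j • u j) =
      ∑ j, g j ^ 2 * (u j ⬝ᵥ u j) := by
    intro g
    rw [sum_dotProduct]
    refine Finset.sum_congr rfl fun j _ => ?_
    rw [dotProduct_sum, Finset.sum_eq_single j]
    · rw [dotProduct_smul, smul_dotProduct, smul_eq_mul, smul_eq_mul]; ring
    · intro k _ hk
      rw [dotProduct_smul, smul_dotProduct, horth j k hk.symm]; simp
    · simp
  -- Vanishing on `F` imposes fewer linear conditions than there are eigenvectors, so a nontrivial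
  -- combination satisfies them all.
  obtain ⟨g, hg0, hg⟩ : ∃ g : κ → ℝ, g ≠ 0 ∧ ∀ i ∈ F, (∑ j, g j • u j) i = 0 := by
    let f : (κ → ℝ) →ₗ[ℝ] (F → ℝ) :=
      Matrix.mulVecLin (Matrix.of fun (i : F) (j : κ) => u j i)
    have hker : LinearMap.ker f ≠ ⊥ := by
      apply LinearMap.ker_ne_bot_of_finrank_lt
      simpa using hF
    obtain ⟨g, hg, hg0⟩ := (Submodule.ne_bot_iff _).1 hker
    refine ⟨g, hg0, fun i hi => ?_⟩
    have := congrFun (LinearMap.mem_ker.1 hg) ⟨i, hi⟩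
    simp only [f, Matrix.mulVecLin_apply, Matrix.mulVec, dotProduct, Matrix.of_apply,
      Pi.zero_apply] at this
    simpa [Finset.sum_apply, mul_comm] using this
  set w : ι → ℝ := ∑ j, g j • u j with hw
  have hpos : ∀ j, 0 < u j ⬝ᵥ u j := fun j => by
    have := Matrix.dotProduct_star_self_pos_iff (v := u j)
    simpa using this.2 (hu j)
  have hww : 0 < w ⬝ᵥ w := by
    rw [hsum]
    obtain ⟨j, hj⟩ := Function.ne_iff.1 hg0
    refine Finset.sum_pos' (fun j _ => mul_nonneg (sq_nonneg _) (hpos j).le) ⟨j, Finset.mem_univ _, ?_⟩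
    exact mul_pos (by have : g j ≠ 0 := hj
                      positivity) (hpos j)
  have hAw : A.mulVec w - c • w = ∑ j, (g j * (μ j - c)) • u j := by
    rw [hw, Matrix.mulVec_sum, Finset.smul_sum, ← Finset.sum_sub_distrib]
    refine Finset.sum_congr rfl fun j _ => ?_
    rw [Matrix.mulVec_smul, hAu, smul_smul, smul_smul, ← sub_smul]
    congr 1; ring
  have hzz : (A.mulVec w - c • w) ⬝ᵥ (A.mulVec w - c • w) ≤ r ^ 2 * (w ⬝ᵥ w) := by
    rw [hAw, hsum, hsum, Finset.mul_sum]
    refine Finset.sum_le_sum fun j _ => ?_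
    have h1 : (μ j - c) ^ 2 ≤ r ^ 2 := sq_le_sq' (by linarith [(abs_le.1 (hr j)).1]) (abs_le.1 (hr j)).2
    have h2 : 0 ≤ g j ^ 2 * (u j ⬝ᵥ u j) := mul_nonneg (sq_nonneg _) (hpos j).le
    nlinarith
  have hr0 : 0 ≤ r := by
    have : 0 < Fintype.card κ := by omega
    obtain ⟨j⟩ := Fintype.card_pos_iff.1 this
    exact (abs_nonneg _).trans (hr j)
  by_contra! hno
  -- On w the two matrices agree, so ‖(B − c)w‖ ≤ r‖w‖. Expanding w in an eigenbasis of B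
  -- contradicts this if all eigenvalues of B are farther than r from c.
  rw [hAB w hg] at hzz
  let b := hB.eigenvectorBasis
  have hb : ∀ i, r < |hB.eigenvalues i - c| := by
    intro i
    by_contra! hi
    refine hno (hB.eigenvalues i) (b i).ofLp hi ?_ (hB.mulVec_eigenvectorBasis i)
    intro h0
    have := b.orthonormal.ne_zero i
    apply this
    ext k
    simpa using congrFun h0 k
  have hpars : ∀ v : ι → ℝ, v ⬝ᵥ v = ∑ i, ((b i).ofLp ⬝ᵥ v) ^ 2 := by
    intro v
    have := b.sum_sq_norm_inner_right (WithLp.toLp 2 v)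
    rw [EuclideanSpace.norm_sq_eq] at this
    simp only [EuclideanSpace.inner_eq_star_dotProduct, Real.norm_eq_abs, sq_abs] at this
    simp only [dotProduct, star_trivial] at this ⊢
    rw [← Finset.sum_congr rfl (fun i _ => sq (v i)), ← this]
    refine Finset.sum_congr rfl fun i _ => ?_
    congr 1
    exact Finset.sum_congr rfl fun _ _ => mul_comm _ _
  have hcoef : ∀ i, (b i).ofLp ⬝ᵥ (B.mulVec w - c • w) =
      (hB.eigenvalues i - c) * ((b i).ofLp ⬝ᵥ w) := by
    intro i
    have h1 : (b i).ofLp ⬝ᵥ B.mulVec w = B.mulVec (b i).ofLp ⬝ᵥ w := by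
      rw [Matrix.dotProduct_mulVec, ← Matrix.mulVec_transpose]
      have : B.transpose = B := Matrix.IsSymm.eq (by simpa using hB)
      rw [this]
    rw [dotProduct_sub, h1, hB.mulVec_eigenvectorBasis, smul_dotProduct, dotProduct_smul]
    simp only [smul_eq_mul]; ring
  rw [hpars, hpars w, Finset.mul_sum] at hzz
  rw [hpars] at hww
  refine absurd hzz (not_le.2 ?_)
  have hsq : ∀ i, r ^ 2 < (hB.eigenvalues i - c) ^ 2 := fun i => by
    rw [← sq_abs (hB.eigenvalues i - c)]
    exact pow_lt_pow_left₀ (hb i) hr0 two_ne_zero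
  obtain ⟨i, -, hi⟩ := Finset.exists_lt_of_sum_lt (s := Finset.univ)
    (f := fun _ : ι => (0 : ℝ)) (by simpa using hww)
  refine Finset.sum_lt_sum (fun i _ => ?_) ⟨i, Finset.mem_univ _, ?_⟩
  · rw [hcoef, mul_pow]
    exact mul_le_mul_of_nonneg_right (hsq i).le (sq_nonneg _)
  · rw [hcoef, mul_pow]
    exact mul_lt_mul_of_pos_right (hsq i) hi

/-! ### The chain in cell variables -/

/-- The equations of motion in cell variables, with the boundary conditions expressed by ghost
sites `Y 0` and `X n`; here `κᵢ = k₃ᵢ - k₂` and `E = ω² - k₁ - k₂`. -/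
structure IsChain (k₁ k₂ κ₁ κ₂ E : ℝ) (n : ℕ) (X Y : ℕ → ℝ) : Prop where
  odd : ∀ m < n, k₂ * Y m + k₁ * Y (m + 1) = -E * X m
  even : ∀ m < n, k₁ * X m + k₂ * X (m + 1) = -E * Y (m + 1)
  left : k₂ * Y 0 = -κ₁ * X 0
  right : k₂ * X n = -κ₂ * Y n

theorem chainMatrix_isHermitian (k₁ k₂ k₃₁ k₃₂ : ℝ) (n : ℕ) :
    (chainMatrix k₁ k₂ k₃₁ k₃₂ n).IsHermitian := by
  ext i j
  simp only [chainMatrix, Matrix.conjTranspose_apply, Matrix.of_apply, star_trivial]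
  by_cases hij : i = j
  · subst hij; rfl
  · rw [if_neg hij, if_neg (Ne.symm hij)]
    by_cases h1 : (i : ℕ) + 1 = j
    · rw [if_neg (show ¬ (j : ℕ) + 1 = i by omega), if_pos h1, if_pos h1]
    · by_cases h2 : (j : ℕ) + 1 = i
      · simp [h1]
      · simp [h1, h2]

theorem chainMatrix_mulVec {k₁ k₂ k₃₁ k₃₂ : ℝ} {n : ℕ} {u : Fin (2 * n) → ℝ} {w : ℕ → ℝ}
    (hw : ∀ i, u i = w i) (i : Fin (2 * n)) :
    (chainMatrix k₁ k₂ k₃₁ k₃₂ n).mulVec u i =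
      -(k₁ + (if (i : ℕ) = 0 then k₃₁ else if (i : ℕ) + 1 = 2 * n then k₃₂ else k₂)) * w i +
        (if (i : ℕ) + 1 < 2 * n then
          (if (i : ℕ) % 2 = 0 then k₁ else k₂) * w (i + 1) else 0) +
        (if 0 < (i : ℕ) then
          (if (i - 1 : ℕ) % 2 = 0 then k₁ else k₂) * w (i - 1) else 0) := by
  obtain ⟨i, hi⟩ := i
  simp only [Matrix.mulVec, dotProduct, chainMatrix, Matrix.of_apply, hw, Fin.ext_iff]
  rw [Fin.sum_univ_eq_sum_range (fun j => (if i = j then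
      -(k₁ + (if i = 0 then k₃₁ else if i + 1 = 2 * n then k₃₂ else k₂))
    else if i + 1 = j then (if i % 2 = 0 then k₁ else k₂)
    else if j + 1 = i then (if j % 2 = 0 then k₁ else k₂)
    else 0) * w j)]
  -- The row splits into diagonal, right and left neighbour. For i = 0 the truncated index i − 1 is
  -- 0, and the guard `0 < i` removes this spurious term.
  have key : ∀ j, (if i = j then
      -(k₁ + (if i = 0 then k₃₁ else if i + 1 = 2 * n then k₃₂ else k₂))
    else if i + 1 = j then (if i % 2 = 0 then k₁ else k₂)
    else if j + 1 = i then (if j % 2 = 0 then k₁ else k₂)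
    else 0) * w j =
    (if i = j then
      -(k₁ + (if i = 0 then k₃₁ else if i + 1 = 2 * n then k₃₂ else k₂)) * w j else 0) +
    (if i + 1 = j then (if i % 2 = 0 then k₁ else k₂) * w j else 0) +
    (if i - 1 = j then (if 0 < i then (if (i - 1) % 2 = 0 then k₁ else k₂) * w j else 0)
      else 0) := by
    intro j
    by_cases h1 : i = j
    · subst h1
      rw [if_pos rfl, if_pos rfl, if_neg (show ¬ i + 1 = i by omega)]
      by_cases h0 : 0 < i
      · rw [if_neg (show ¬ i - 1 = i by omega)]; ring
      · simp [h0]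
    · rw [if_neg h1, if_neg h1]
      by_cases h2 : i + 1 = j
      · rw [if_pos h2, if_pos h2, if_neg (show ¬ i - 1 = j by omega)]; ring
      · rw [if_neg h2, if_neg h2]
        by_cases h3 : j + 1 = i
        · rw [if_pos h3, if_pos (show i - 1 = j by omega), if_pos (show 0 < i by omega),
            show i - 1 = j by omega]; ring
        · rw [if_neg h3]
          by_cases h4 : i - 1 = j
          · have : ¬ 0 < i := by omega
            simp [this]
          · simp [h4]
  rw [Finset.sum_congr rfl (fun j _ => key j), Finset.sum_add_distrib, Finset.sum_add_distrib,
    Finset.sum_ite_eq, Finset.sum_ite_eq, Finset.sum_ite_eq]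
  simp only [Finset.mem_range, if_pos hi, if_pos (show i - 1 < 2 * n by omega)]

/-- The vector of a state given in cell variables. -/
def cellVec (n : ℕ) (X Y : ℕ → ℝ) (i : Fin (2 * n)) : ℝ :=
  if (i : ℕ) % 2 = 0 then X (i / 2) else Y (i / 2 + 1)

theorem cellVec_even {n : ℕ} (X Y : ℕ → ℝ) {m : ℕ} (h : 2 * m < 2 * n) :
    cellVec n X Y ⟨2 * m, h⟩ = X m := by
  simp [cellVec]

theorem cellVec_odd {n : ℕ} (X Y : ℕ → ℝ) {m : ℕ} (h : 2 * m + 1 < 2 * n) :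
    cellVec n X Y ⟨2 * m + 1, h⟩ = Y (m + 1) := by
  have h1 : (2 * m + 1) % 2 = 1 := by omega
  have h2 : (2 * m + 1) / 2 = m := by omega
  simp [cellVec, h1, h2]

/-- The ghost terms k₂ Y 0 = −κ₁ X 0 and k₂ X n = −κ₂ Y n supply exactly the excess of the end
stiffness over k₂, so the end rows take the form of bulk rows. -/
theorem IsChain.mulVec_eq {k₁ k₂ k₃₁ k₃₂ E : ℝ} {n : ℕ} {X Y : ℕ → ℝ}
    (h : IsChain k₁ k₂ (k₃₁ - k₂) (k₃₂ - k₂) E n X Y) :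
    (chainMatrix k₁ k₂ k₃₁ k₃₂ n).mulVec (cellVec n X Y) =
      (-(k₁ + k₂ + E)) • cellVec n X Y := by
  ext i
  rw [chainMatrix_mulVec (u := cellVec n X Y) (w := fun i => if i % 2 = 0 then X (i / 2) else Y (i / 2 + 1))
    (fun _ => rfl)]
  obtain ⟨i, hi⟩ := i
  simp only [Pi.smul_apply, smul_eq_mul]
  obtain ⟨m, rfl | rfl⟩ : ∃ m, i = 2 * m ∨ i = 2 * m + 1 := ⟨i / 2, by omega⟩
  · rw [cellVec_even]
    have h1 := h.odd m (by omega)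
    have e1 : (2 * m) % 2 = 0 := by omega
    have e2 : (2 * m + 1) % 2 = 1 := by omega
    have e3 : (2 * m + 1) / 2 = m := by omega
    simp only [e1, e2, e3, if_true, one_ne_zero, if_false, if_pos (show 2 * m + 1 < 2 * n by omega),
      show 2 * m / 2 = m by omega]
    rcases Nat.eq_zero_or_pos m with rfl | hm
    · have := h.left
      simp only [mul_zero, lt_irrefl, if_true, if_false]
      simp only [zero_add] at h1
      linear_combination h1 - this
    · obtain ⟨l, rfl⟩ := Nat.exists_eq_succ_of_ne_zero hm.ne'
      have e4 : (2 * (l + 1) - 1) % 2 = 1 := by omega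
      have e5 : (2 * (l + 1) - 1) / 2 = l := by omega
      simp only [Nat.succ_eq_add_one] at *
      simp only [e4, e5, one_ne_zero, if_false, if_neg (show ¬ 2 * (l + 1) = 0 by omega),
        if_neg (show ¬ 2 * (l + 1) + 1 = 2 * n by omega),
        if_pos (show 0 < 2 * (l + 1) by omega)]
      linear_combination h1
  · rw [cellVec_odd]
    have h1 := h.even m (by omega)
    have e2 : (2 * m + 1) % 2 = 1 := by omega
    have e3 : (2 * m + 1) / 2 = m := by omega
    have e4 : (2 * m + 1 + 1) % 2 = 0 := by omega
    have e5 : (2 * m + 1 + 1) / 2 = m + 1 := by omega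
    simp only [e2, e3, e4, e5, if_true, one_ne_zero, if_false, Nat.add_sub_cancel,
      show 2 * m % 2 = 0 by omega, show 2 * m / 2 = m by omega,
      if_neg (show ¬ 2 * m + 1 = 0 by omega), if_pos (show 0 < 2 * m + 1 by omega)]
    by_cases hm : m + 1 = n
    · have := h.right
      rw [← hm] at this
      rw [if_pos (by omega), if_neg (by omega)]
      linear_combination h1 - this
    · rw [if_neg (by omega), if_pos (by omega)]
      linear_combination h1

theorem exists_isChain_of_mulVec_eq {k₁ k₂ k₃₁ k₃₂ E : ℝ} (hk₂ : k₂ ≠ 0) {n : ℕ} (hn : 0 < n)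
    {u : Fin (2 * n) → ℝ} (hu : (chainMatrix k₁ k₂ k₃₁ k₃₂ n).mulVec u = (-(k₁ + k₂ + E)) • u) :
    ∃ X Y, IsChain k₁ k₂ (k₃₁ - k₂) (k₃₂ - k₂) E n X Y ∧ u = cellVec n X Y := by
  set w : ℕ → ℝ := fun i => if h : i < 2 * n then u ⟨i, h⟩ else 0 with hw
  have huw : ∀ i, u i = w i := fun i => by simp [hw]
  -- The two ghost values X n and Y 0 are defined by the boundary conditions; all other values are
  -- read off from u.
  set X : ℕ → ℝ := fun m => if m < n then w (2 * m) else -(k₃₂ - k₂) / k₂ * w (2 * n - 1) with hX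
  set Y : ℕ → ℝ := fun m => if m = 0 then -(k₃₁ - k₂) / k₂ * X 0 else w (2 * m - 1) with hY
  have hYs : ∀ m, Y (m + 1) = w (2 * m + 1) := fun m => by
    simp only [hY, Nat.succ_ne_zero, if_false]; rfl
  have hXm : ∀ m < n, X m = w (2 * m) := fun m hm => by simp only [hX, if_pos hm]
  have hleft : k₂ * Y 0 = -(k₃₁ - k₂) * X 0 := by
    simp only [hY, if_true]; field_simp
  have hright : ∀ m, m + 1 = n → k₂ * X n = -(k₃₂ - k₂) * w (2 * m + 1) := by
    rintro m rfl
    simp only [hX, lt_irrefl, if_false, show 2 * (m + 1) - 1 = 2 * m + 1 by omega]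
    field_simp
  have row : ∀ i (hi : i < 2 * n), _ := fun i hi =>
    (chainMatrix_mulVec (k₁ := k₁) (k₂ := k₂) (k₃₁ := k₃₁) (k₃₂ := k₃₂) huw ⟨i, hi⟩).symm.trans
      (congrFun hu ⟨i, hi⟩)
  simp only [Pi.smul_apply, smul_eq_mul, huw] at row
  refine ⟨X, Y, ⟨fun m hm => ?_, fun m hm => ?_, hleft, ?_⟩, ?_⟩
  · have h1 := row (2 * m) (by omega)
    rw [hYs, hXm m hm]
    rw [if_pos (show 2 * m + 1 < 2 * n by omega), if_pos (show 2 * m % 2 = 0 by omega)] at h1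
    rcases Nat.eq_zero_or_pos m with rfl | hm'
    · simp only [mul_zero, lt_irrefl, if_true, if_false] at h1
      rw [hXm 0 hm] at hleft
      linear_combination h1 + hleft
    · obtain ⟨l, rfl⟩ := Nat.exists_eq_succ_of_ne_zero hm'.ne'
      simp only [Nat.succ_eq_add_one] at *
      rw [if_neg (by omega), if_neg (by omega), if_pos (by omega), if_neg (by omega),
        show 2 * (l + 1) - 1 = 2 * l + 1 by omega] at h1
      rw [hYs]
      linear_combination h1
  · have h1 := row (2 * m + 1) (by omega)
    rw [hYs, hXm m hm]
    rw [if_neg (show ¬ 2 * m + 1 = 0 by omega), if_pos (show 0 < 2 * m + 1 by omega),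
      if_neg (show ¬ (2 * m + 1) % 2 = 0 by omega), Nat.add_sub_cancel,
      if_pos (show 2 * m % 2 = 0 by omega)] at h1
    by_cases hmn : m + 1 = n
    · rw [if_pos (by omega), if_neg (by omega)] at h1
      rw [hmn]
      linear_combination h1 + hright m hmn
    · rw [if_neg (by omega), if_pos (by omega)] at h1
      rw [hXm (m + 1) (by omega)]
      linear_combination h1
  · obtain ⟨l, rfl⟩ := Nat.exists_eq_succ_of_ne_zero hn.ne'
    rw [hright l rfl, hYs]
  · ext ⟨i, hi⟩
    obtain ⟨m, rfl | rfl⟩ : ∃ m, i = 2 * m ∨ i = 2 * m + 1 := ⟨i / 2, by omega⟩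
    · rw [cellVec_even, hXm m (by omega), huw]
    · rw [cellVec_odd, hYs, huw]

/-! ### Bloch waves and the secular equation -/

/-- A real transfer-matrix eigenvalue `a = s * t` in the gap (or at its edge), together with the
amplitude ratio `ρ` of the corresponding Bloch wave. -/
structure IsParam (k₁ k₂ s ρ t : ℝ) : Prop where
  sign : s = 1 ∨ s = -1
  ρ_nonneg : 0 ≤ ρ
  ρ_le_one : ρ ≤ 1
  t_pos : 0 < t
  t_le_one : t ≤ 1
  eq : k₁ * (1 - t ^ 2) = (1 - ρ ^ 2) * (k₁ + s * k₂ * t)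

/-- The shifted squared frequency `ω² - k₁ - k₂` of the Bloch wave. -/
noncomputable def energy (k₁ k₂ s σ ρ t : ℝ) : ℝ := σ * ρ * (k₁ + s * k₂ * t) / t

/-- The chain has a nonzero state with `ω² - k₁ - k₂ = E`. -/
def HasState (k₁ k₂ κ₁ κ₂ : ℝ) (n : ℕ) (E : ℝ) : Prop :=
  ∃ X Y, IsChain k₁ k₂ κ₁ κ₂ E n X Y ∧ cellVec n X Y ≠ 0

/-- The sublattice values of a superposition of the waves for a and 1/a. In terms of the amplitudes
of `WaveData`, d₁ = c₁q/t and d₂ = c₂q with q = √(k₁ + k₂a). With this normalisation the formulas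
extend to the ghost sites, and the two ends of the chain play symmetric roles. -/
noncomputable def waveX (s σ ρ t d₁ d₂ : ℝ) (m : ℕ) : ℝ :=
  -σ * (d₁ * ρ * (s * t) ^ m + d₂ * (s * t)⁻¹ ^ m)

noncomputable def waveY (s ρ t d₁ d₂ : ℝ) (m : ℕ) : ℝ :=
  s * (d₁ * (s * t) ^ m + d₂ * ρ * (s * t)⁻¹ ^ m)

theorem sq_of_sign {s : ℝ} (hs : s = 1 ∨ s = -1) : s ^ 2 = 1 := by
  rcases hs with rfl | rfl <;> norm_num

theorem abs_of_sign {s : ℝ} (hs : s = 1 ∨ s = -1) : |s| = 1 := by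
  rcases hs with rfl | rfl <;> norm_num

theorem ne_zero_of_sign {s : ℝ} (hs : s = 1 ∨ s = -1) : s ≠ 0 := by
  rcases hs with rfl | rfl <;> norm_num

section
variable {k₁ k₂ s σ ρ t : ℝ}

theorem IsParam.sub_le (hk₂ : 0 < k₂) (h : IsParam k₁ k₂ s ρ t) :
    k₁ - k₂ ≤ k₁ + s * k₂ * t := by
  have := h.t_le_one
  have := h.t_pos
  rcases h.sign with rfl | rfl <;> nlinarith

theorem IsParam.le_add (hk₂ : 0 < k₂) (h : IsParam k₁ k₂ s ρ t) :
    k₁ + s * k₂ * t ≤ k₁ + k₂ := by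
  have := h.t_le_one
  have := h.t_pos
  rcases h.sign with rfl | rfl <;> nlinarith

theorem IsParam.pos (hk₂ : 0 < k₂) (hk : k₂ < k₁) (h : IsParam k₁ k₂ s ρ t) :
    0 < k₁ + s * k₂ * t := (sub_pos.2 hk).trans_le (h.sub_le hk₂)

theorem IsParam.ρ_lt_one (hk₂ : 0 < k₂) (hk : k₂ < k₁) (h : IsParam k₁ k₂ s ρ t) (ht : t < 1) :
    ρ < 1 := by
  refine lt_of_le_of_ne h.ρ_le_one ?_
  rintro rfl
  have h1 := h.eq
  have h2 := h.t_pos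
  have : 0 < k₁ * (1 - t ^ 2) := mul_pos (by linarith) (by nlinarith)
  nlinarith

theorem IsParam.t_lt_one (hk₂ : 0 < k₂) (hk : k₂ < k₁) (h : IsParam k₁ k₂ s ρ t) (hρ : ρ < 1) :
    t < 1 := by
  refine lt_of_le_of_ne h.t_le_one ?_
  rintro rfl
  have h1 := h.eq
  have h2 := h.pos hk₂ hk
  have h3 := h.ρ_nonneg
  have : 0 < (1 - ρ ^ 2) * (k₁ + s * k₂ * 1) := mul_pos (by nlinarith) h2
  nlinarith

theorem wave_odd (h : IsParam k₁ k₂ s ρ t) (hσ : σ = 1 ∨ σ = -1) (d₁ d₂ : ℝ) (m : ℕ) :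
    k₂ * waveY s ρ t d₁ d₂ m + k₁ * waveY s ρ t d₁ d₂ (m + 1) =
      -energy k₁ k₂ s σ ρ t * waveX s σ ρ t d₁ d₂ m := by
  have hs := sq_of_sign h.sign
  have hσ2 := sq_of_sign hσ
  have hs0 := ne_zero_of_sign h.sign
  have ht := h.t_pos.ne'
  have heq := h.eq
  simp only [waveX, waveY, energy, pow_succ]
  generalize (s * t) ^ m = A
  generalize (s * t)⁻¹ ^ m = B
  have hinv : (s * t)⁻¹ = s / t := by
    field_simp; exact hs.symm
  rw [hinv]
  field_simp
  linear_combination (A * d₁ * k₁ * t ^ 2 + B * ρ * d₂ * k₁) * hs +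
    (- (ρ * (k₁ + s * k₂ * t) * (d₁ * ρ * A + d₂ * B))) * hσ2 - A * d₁ * heq

theorem wave_even (h : IsParam k₁ k₂ s ρ t) (d₁ d₂ : ℝ) (m : ℕ) :
    k₁ * waveX s σ ρ t d₁ d₂ m + k₂ * waveX s σ ρ t d₁ d₂ (m + 1) =
      -energy k₁ k₂ s σ ρ t * waveY s ρ t d₁ d₂ (m + 1) := by
  have hs := sq_of_sign h.sign
  have hs0 := ne_zero_of_sign h.sign
  have ht := h.t_pos.ne'
  have heq := h.eq
  simp only [waveX, waveY, energy, pow_succ]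
  generalize (s * t) ^ m = A
  generalize (s * t)⁻¹ ^ m = B
  have hinv : (s * t)⁻¹ = s / t := by
    field_simp; exact hs.symm
  rw [hinv]
  field_simp
  linear_combination (σ * (k₁ + s * k₂ * t) * ρ * (A * d₁ * t ^ 2 + B * d₂ * ρ)) * hs +
    σ * B * d₂ * heq

/-- Writing the spring as κ = sσθk₂ absorbs both signs, so that one condition in θ, ρ serves all
four combinations of s and σ. -/
theorem wave_left (hs : s = 1 ∨ s = -1) (hσ : σ = 1 ∨ σ = -1) (hk₂ : 0 < k₂) (θ d₁ d₂ : ℝ) :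
    k₂ * waveY s ρ t d₁ d₂ 0 = -(s * σ * θ * k₂) * waveX s σ ρ t d₁ d₂ 0 ↔
      d₁ * (1 - θ * ρ) = d₂ * (θ - ρ) := by
  have hσ2 := sq_of_sign hσ
  have hs2 := sq_of_sign hs
  simp only [waveX, waveY, pow_zero]
  constructor
  · intro h
    have h1 : (s * k₂) * (d₁ * (1 - θ * ρ)) = (s * k₂) * (d₂ * (θ - ρ)) := by
      linear_combination h + s * k₂ * θ * (d₁ * ρ + d₂) * hσ2
    exact mul_left_cancel₀ (mul_ne_zero (ne_zero_of_sign hs) hk₂.ne') h1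
  · intro h
    linear_combination s * k₂ * h - s * k₂ * θ * (d₁ * ρ + d₂) * hσ2

/-- The mirror image of `wave_left`: d₁ and d₂ change roles, and the weights a^n and a^(−n) leave
the factor a^(2n) = t^(2n). -/
theorem wave_right (hs : s = 1 ∨ s = -1) (hσ : σ = 1 ∨ σ = -1) (hk₂ : 0 < k₂) (ht : 0 < t)
    (θ d₁ d₂ : ℝ) (n : ℕ) :
    k₂ * waveX s σ ρ t d₁ d₂ n = -(s * σ * θ * k₂) * waveY s ρ t d₁ d₂ n ↔
      d₂ * (1 - θ * ρ) = t ^ (2 * n) * (d₁ * (θ - ρ)) := by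
  have hs2 := sq_of_sign hs
  have hst : s * t ≠ 0 := mul_ne_zero (ne_zero_of_sign hs) ht.ne'
  simp only [waveX, waveY]
  have hA : t ^ (2 * n) = ((s * t) ^ n) ^ 2 := by
    rw [← pow_mul, mul_comm n 2, mul_pow, pow_mul s, hs2, one_pow, one_mul]
  rw [hA, inv_pow]
  have hA0 : (s * t) ^ n ≠ 0 := pow_ne_zero _ hst
  generalize (s * t) ^ n = A at hA0
  have hσ0 := ne_zero_of_sign hσ
  have hm : σ * k₂ * A⁻¹ ≠ 0 := mul_ne_zero (mul_ne_zero hσ0 hk₂.ne') (inv_ne_zero hA0)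
  constructor
  · intro h
    have h1 : (σ * k₂ * A⁻¹) * (d₂ * (1 - θ * ρ)) = (σ * k₂ * A⁻¹) * (A ^ 2 * (d₁ * (θ - ρ))) := by
      have e : A⁻¹ * A = 1 := inv_mul_cancel₀ hA0
      linear_combination -h + σ * θ * k₂ * (d₁ * A + d₂ * ρ * A⁻¹) * hs2 -
        σ * k₂ * A * d₁ * (θ - ρ) * e
    exact mul_left_cancel₀ hm h1
  · intro h
    have e : A⁻¹ * A = 1 := inv_mul_cancel₀ hA0
    linear_combination -(σ * k₂ * A⁻¹) * h + σ * θ * k₂ * (d₁ * A + d₂ * ρ * A⁻¹) * hs2 -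
        σ * k₂ * A * d₁ * (θ - ρ) * e

/-- Inside the gap every solution of the bulk equations is a superposition of Bloch waves. -/
theorem exists_wave (hk₂ : 0 < k₂) (hk : k₂ < k₁) (h : IsParam k₁ k₂ s ρ t)
    (hσ : σ = 1 ∨ σ = -1) (ht : t < 1) {κ₁ κ₂ : ℝ} {n : ℕ} {X Y : ℕ → ℝ}
    (hc : IsChain k₁ k₂ κ₁ κ₂ (energy k₁ k₂ s σ ρ t) n X Y) :
    ∃ d₁ d₂, ∀ m ≤ n, X m = waveX s σ ρ t d₁ d₂ m ∧ Y m = waveY s ρ t d₁ d₂ m := by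
  have hρ := h.ρ_lt_one hk₂ hk ht
  have hρ0 := h.ρ_nonneg
  have hs2 := sq_of_sign h.sign
  have hσ2 := sq_of_sign hσ
  have hD : 1 - ρ ^ 2 ≠ 0 := by nlinarith
  -- The amplitudes are fitted to X 0 and Y 0; this 2 × 2 system has determinant ±(1 − ρ²), nonzero
  -- as ρ < 1. The recursion then propagates the agreement.
  refine ⟨(s * Y 0 + σ * ρ * X 0) / (1 - ρ ^ 2), (-σ * X 0 - s * ρ * Y 0) / (1 - ρ ^ 2), ?_⟩
  intro m
  induction m with
  | zero =>
    intro _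
    simp only [waveX, waveY, pow_zero]
    constructor
    · field_simp
      linear_combination -(1 - ρ ^ 2) * X 0 * hσ2
    · field_simp
      linear_combination -(1 - ρ ^ 2) * Y 0 * hs2
  | succ m ih =>
    intro hm
    obtain ⟨hx, hy⟩ := ih (by omega)
    have h1 := hc.odd m (by omega)
    have h2 := hc.even m (by omega)
    rw [hx, hy, ← wave_odd h hσ] at h1
    have hY : Y (m + 1) = waveY s ρ t ((s * Y 0 + σ * ρ * X 0) / (1 - ρ ^ 2))
        ((-σ * X 0 - s * ρ * Y 0) / (1 - ρ ^ 2)) (m + 1) :=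
      mul_left_cancel₀ (show k₁ ≠ 0 by linarith) (by linarith)
    rw [hx, hY, ← wave_even h] at h2
    exact ⟨mul_left_cancel₀ hk₂.ne' (by linarith), hY⟩

theorem isChain_wave (hk₂ : 0 < k₂) (h : IsParam k₁ k₂ s ρ t)
    (hσ : σ = 1 ∨ σ = -1) {θ₁ θ₂ d₁ d₂ : ℝ} {n : ℕ}
    (h1 : d₁ * (1 - θ₁ * ρ) = d₂ * (θ₁ - ρ))
    (h2 : d₂ * (1 - θ₂ * ρ) = t ^ (2 * n) * (d₁ * (θ₂ - ρ))) :
    IsChain k₁ k₂ (s * σ * θ₁ * k₂) (s * σ * θ₂ * k₂) (energy k₁ k₂ s σ ρ t) n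
      (waveX s σ ρ t d₁ d₂) (waveY s ρ t d₁ d₂) :=
  ⟨fun m _ => wave_odd h hσ _ _ m, fun m _ => wave_even h _ _ m,
    (wave_left h.sign hσ hk₂ _ _ _).2 h1, (wave_right h.sign hσ hk₂ h.t_pos _ _ _ _).2 h2⟩

/-- The secular equation of the chain inside the gap. -/
theorem HasState.secular (hk₂ : 0 < k₂) (hk : k₂ < k₁) (h : IsParam k₁ k₂ s ρ t)
    (hσ : σ = 1 ∨ σ = -1) (ht : t < 1) {θ₁ θ₂ : ℝ} {n : ℕ}
    (hc : HasState k₁ k₂ (s * σ * θ₁ * k₂) (s * σ * θ₂ * k₂) n (energy k₁ k₂ s σ ρ t)) :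
    (1 - θ₁ * ρ) * (1 - θ₂ * ρ) = t ^ (2 * n) * ((θ₁ - ρ) * (θ₂ - ρ)) := by
  obtain ⟨X, Y, hc, hne⟩ := hc
  obtain ⟨d₁, d₂, hw⟩ := exists_wave hk₂ hk h hσ ht hc
  have h1 := hc.left
  have h2 := hc.right
  rw [(hw 0 (Nat.zero_le _)).1, (hw 0 (Nat.zero_le _)).2, wave_left h.sign hσ hk₂] at h1
  rw [(hw n le_rfl).1, (hw n le_rfl).2, wave_right h.sign hσ hk₂ h.t_pos] at h2
  by_contra hP
  -- Cramer's rule for the two matching conditions: if the determinant is nonzero, both amplitudes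
  -- vanish and so does the state.
  have e1 : d₁ * ((1 - θ₁ * ρ) * (1 - θ₂ * ρ) - t ^ (2 * n) * ((θ₁ - ρ) * (θ₂ - ρ))) = 0 := by
    linear_combination (1 - θ₂ * ρ) * h1 + (θ₁ - ρ) * h2
  have e2 : d₂ * ((1 - θ₁ * ρ) * (1 - θ₂ * ρ) - t ^ (2 * n) * ((θ₁ - ρ) * (θ₂ - ρ))) = 0 := by
    linear_combination (1 - θ₁ * ρ) * h2 + t ^ (2 * n) * (θ₂ - ρ) * h1
  have hP' := sub_ne_zero.2 hP
  have d1 : d₁ = 0 := (mul_eq_zero.1 e1).resolve_right hP'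
  have d2 : d₂ = 0 := (mul_eq_zero.1 e2).resolve_right hP'
  subst d1 d2
  apply hne
  ext ⟨i, hi⟩
  simp only [cellVec, Pi.zero_apply]
  split_ifs
  · rw [(hw (i / 2) (by omega)).1]; simp [waveX]
  · rw [(hw (i / 2 + 1) (by omega)).2]; simp [waveY]

/-- At the band edge the solutions of the bulk equations are affine. -/
theorem HasState.secular_edge (hk₂ : 0 < k₂) (hk : k₂ < k₁) (hs : s = 1 ∨ s = -1)
    (hσ : σ = 1 ∨ σ = -1) {θ₁ θ₂ : ℝ} {n : ℕ}
    (hc : HasState k₁ k₂ (s * σ * θ₁ * k₂) (s * σ * θ₂ * k₂) n (energy k₁ k₂ s σ 1 1)) :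
    ∃ α j : ℝ, (α ≠ 0 ∨ j ≠ 0) ∧ (1 - θ₁) * α = j ∧
      (θ₂ - 1) * (α + n * (j * (1 + s * k₂ / k₁)) - j) = j := by
  obtain ⟨X, Y, hc, hne⟩ := hc
  have hs2 := sq_of_sign hs
  have hσ2 := sq_of_sign hσ
  have hs0 := ne_zero_of_sign hs
  have hσ0 := ne_zero_of_sign hσ
  have hk₁ : k₁ ≠ 0 := by linarith
  -- Up to the alternating signs, the state is linear in m: it starts at α = −σX 0 and grows by j(1
  -- + s k₂/k₁) per cell, where j = −σX 0 − sY 0.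
  have hw : ∀ m ≤ n,
      X m = -σ * s ^ m * (-σ * X 0 + m * ((-σ * X 0 - s * Y 0) * (1 + s * k₂ / k₁))) ∧
      Y m = s * s ^ m * (-σ * X 0 + m * ((-σ * X 0 - s * Y 0) * (1 + s * k₂ / k₁))
        - (-σ * X 0 - s * Y 0)) := by
    intro m
    induction m with
    | zero =>
      intro _
      simp only [pow_zero, Nat.cast_zero]
      constructor
      · linear_combination -X 0 * hσ2
      · linear_combination -Y 0 * hs2
    | succ m ih =>
      intro hm
      obtain ⟨hx, hy⟩ := ih (by omega)
      have h1 := hc.odd m (by omega)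
      have h2 := hc.even m (by omega)
      simp only [energy] at h1 h2
      simp only [pow_succ]
      generalize -σ * X 0 = α at *
      generalize hj : α - s * Y 0 = j at *
      generalize s ^ m = S at *
      have hY : Y (m + 1) = s * (S * s) * (α + ((m + 1 : ℕ) : ℝ) * (j * (1 + s * k₂ / k₁)) - j) := by
        apply mul_left_cancel₀ hk₁
        have e : k₁ * Y (m + 1) = -(σ * 1 * (k₁ + s * k₂ * 1) / 1) * X m - k₂ * Y m := by
          linear_combination h1
        rw [e, hx, hy]
        push_cast
        field_simp
        rcases hs with rfl | rfl <;> rcases hσ with rfl | rfl <;> ring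
      refine ⟨?_, hY⟩
      apply mul_left_cancel₀ hk₂.ne'
      have e : k₂ * X (m + 1) = -(σ * 1 * (k₁ + s * k₂ * 1) / 1) * Y (m + 1) - k₁ * X m := by
        linear_combination h2
      rw [e, hx, hY]
      push_cast
      field_simp
      rcases hs with rfl | rfl <;> rcases hσ with rfl | rfl <;> ring
  refine ⟨-σ * X 0, -σ * X 0 - s * Y 0, ?_, ?_, ?_⟩
  · by_contra! h0
    obtain ⟨h1, h2⟩ := h0
    apply hne
    ext ⟨i, hi⟩
    simp only [cellVec, Pi.zero_apply]
    split_ifs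
    · rw [(hw (i / 2) (by omega)).1, h2, h1]; simp
    · rw [(hw (i / 2 + 1) (by omega)).2, h2, h1]; simp
  · have h1 := hc.left
    apply mul_left_cancel₀ (mul_ne_zero hs0 hk₂.ne')
    linear_combination h1 + Y 0 * k₂ * hs2
  · have h2 := hc.right
    obtain ⟨hx, hy⟩ := hw n le_rfl
    rw [hx, hy] at h2
    have hS : σ * s ^ n * k₂ ≠ 0 := mul_ne_zero (mul_ne_zero hσ0 (pow_ne_zero _ hs0)) hk₂.ne'
    apply mul_left_cancel₀ hS
    linear_combination h2 - σ * s ^ n * k₂ * θ₂ * (-σ * X 0 +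
      n * ((-σ * X 0 - s * Y 0) * (1 + s * k₂ / k₁)) - (-σ * X 0 - s * Y 0)) * hs2

end

/-! ### The decay rate as a function of the amplitude ratio -/

/-- The decay rate `t` as a function of the amplitude ratio `ρ`. -/
noncomputable def decay (k₁ k₂ s ρ : ℝ) : ℝ :=
  (-(s * (k₂ * (1 - ρ ^ 2))) + √((k₂ * (1 - ρ ^ 2)) ^ 2 + 4 * k₁ ^ 2 * ρ ^ 2)) / (2 * k₁)

section
variable {k₁ k₂ s σ ρ t ρ' t' : ℝ}

/-- The relation `IsParam.eq` is the quadratic k₁t² + s k₂(1 − ρ²)t − k₁ρ² = 0, and `decay` is its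
positive root. Positivity of ρ is needed: for s = 1, ρ = 0 that root is 0. -/
theorem isParam_decay (hk₂ : 0 < k₂) (hk : k₂ < k₁) (hs : s = 1 ∨ s = -1) (hρ : 0 < ρ)
    (hρ1 : ρ ≤ 1) : IsParam k₁ k₂ s ρ (decay k₁ k₂ s ρ) := by
  have hk₁ : 0 < k₁ := hk₂.trans hk
  have hs2 := sq_of_sign hs
  have hD : 0 ≤ (k₂ * (1 - ρ ^ 2)) ^ 2 + 4 * k₁ ^ 2 * ρ ^ 2 := by positivity
  have hR : 0 ≤ 1 - ρ ^ 2 := by nlinarith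
  have hb : 0 ≤ k₂ * (1 - ρ ^ 2) := mul_nonneg hk₂.le hR
  have hbs : s * (k₂ * (1 - ρ ^ 2)) ≤ k₂ * (1 - ρ ^ 2) := by
    rcases hs with rfl | rfl <;> linarith
  have hbs' : -(k₂ * (1 - ρ ^ 2)) ≤ s * (k₂ * (1 - ρ ^ 2)) := by
    rcases hs with rfl | rfl <;> linarith
  refine ⟨hs, hρ.le, hρ1, ?_, ?_, ?_⟩
  · apply div_pos _ (by linarith)
    have : k₂ * (1 - ρ ^ 2) < √((k₂ * (1 - ρ ^ 2)) ^ 2 + 4 * k₁ ^ 2 * ρ ^ 2) := by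
      apply Real.lt_sqrt_of_sq_lt
      have : 0 < 4 * k₁ ^ 2 * ρ ^ 2 := by positivity
      linarith
    linarith
  · rw [decay, div_le_one (by linarith)]
    have : √((k₂ * (1 - ρ ^ 2)) ^ 2 + 4 * k₁ ^ 2 * ρ ^ 2) ≤ 2 * k₁ + s * (k₂ * (1 - ρ ^ 2)) := by
      apply Real.sqrt_le_iff.2
      constructor
      · nlinarith
      · have h1 : 0 ≤ k₁ * (1 - ρ ^ 2) + s * (k₂ * (1 - ρ ^ 2)) := by nlinarith
        have h2 := mul_nonneg hk₁.le h1
        have h3 : (s * (k₂ * (1 - ρ ^ 2))) ^ 2 = (k₂ * (1 - ρ ^ 2)) ^ 2 := by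
          rw [mul_pow s, hs2, one_mul]
        nlinarith
    linarith
  · have h1 := Real.sq_sqrt hD
    simp only [decay]
    generalize √((k₂ * (1 - ρ ^ 2)) ^ 2 + 4 * k₁ ^ 2 * ρ ^ 2) = R at h1
    field_simp
    linear_combination -h1 + (k₂ * (1 - ρ ^ 2)) ^ 2 * hs2

theorem continuous_decay (k₁ k₂ s : ℝ) : Continuous (decay k₁ k₂ s) := by
  unfold decay; fun_prop

theorem continuousOn_energy_decay (hk₂ : 0 < k₂) (hk : k₂ < k₁) (hs : s = 1 ∨ s = -1) (σ : ℝ)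
    {lo hi : ℝ} (hlo : 0 < lo) (hhi : hi ≤ 1) :
    ContinuousOn (fun ρ => energy k₁ k₂ s σ ρ (decay k₁ k₂ s ρ)) (Set.Icc lo hi) := by
  unfold energy
  have := continuous_decay k₁ k₂ s
  refine ContinuousOn.div (by fun_prop) (by fun_prop) fun ρ hρ => ?_
  exact (isParam_decay hk₂ hk hs (hlo.trans_le hρ.1) (hρ.2.trans hhi)).t_pos.ne'

theorem IsParam.le_mul_t (hk₂ : 0 < k₂) (hk : k₂ < k₁) (h : IsParam k₁ k₂ (-1) ρ t) :
    k₂ ≤ k₁ * t := by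
  have h1 := h.eq
  have h2 := h.pos hk₂ hk
  have h3 := h.t_pos
  have : 0 ≤ t * (k₁ * t - k₂) := by nlinarith [mul_nonneg (sq_nonneg ρ) h2.le]
  nlinarith [nonneg_of_mul_nonneg_right this h3]

/-- A lower bound, uniform in both parameters, for the factor of t − t′ in `IsParam.sub_mul`; it
makes t a Lipschitz function of ρ. For s = −1 it rests on k₂ ≤ k₁t, that is k₁ + k₂/a ≥ 0. -/
theorem IsParam.bracket (hk₂ : 0 < k₂) (hk : k₂ < k₁) (h : IsParam k₁ k₂ s ρ t)
    (h' : IsParam k₁ k₂ s ρ' t') :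
    (k₁ - k₂) * k₂ ≤ k₁ * (k₁ * (t + t') + s * k₂ * (t * t' + 1)) := by
  have a := h.t_pos
  have b := h'.t_pos
  have b1 := h'.t_le_one
  rcases h.sign with rfl | rfl
  · have : 0 ≤ k₁ * (k₁ * (t + t') + k₂ * (t * t')) := by
      have : 0 < k₁ := hk₂.trans hk
      positivity
    nlinarith
  · have e1 := h.le_mul_t hk₂ hk
    have e2 := h'.le_mul_t hk₂ hk
    have e3 : t * (k₁ - k₂) ≤ k₁ * (t + t') + -1 * k₂ * (t * t' + 1) := by
      nlinarith [mul_nonneg a.le (mul_nonneg hk₂.le (sub_nonneg.2 b1))]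
    calc (k₁ - k₂) * k₂ ≤ (k₁ - k₂) * (k₁ * t) := mul_le_mul_of_nonneg_left e1 (by linarith)
      _ = k₁ * (t * (k₁ - k₂)) := by ring
      _ ≤ _ := mul_le_mul_of_nonneg_left e3 (by linarith)

/-- Eliminating 1 − ρ² and 1 − ρ′² crosswise from the two defining relations makes t − t′ split off.
-/
theorem IsParam.sub_mul (h : IsParam k₁ k₂ s ρ t) (h' : IsParam k₁ k₂ s ρ' t') :
    (t - t') * (k₁ * (k₁ * (t + t') + s * k₂ * (t * t' + 1))) =
      (ρ ^ 2 - ρ' ^ 2) * ((k₁ + s * k₂ * t) * (k₁ + s * k₂ * t')) := by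
  linear_combination -(k₁ + s * k₂ * t') * h.eq + (k₁ + s * k₂ * t) * h'.eq

/-- The Lipschitz constant of `t` as a function of `ρ`. -/
noncomputable def decayLip (k₁ k₂ : ℝ) : ℝ := 2 * (k₁ + k₂) ^ 2 / ((k₁ - k₂) * k₂)

theorem decayLip_pos (hk₂ : 0 < k₂) (hk : k₂ < k₁) : 0 < decayLip k₁ k₂ := by
  have : 0 < k₁ - k₂ := sub_pos.2 hk
  have : 0 < k₁ := hk₂.trans hk
  unfold decayLip; positivity

theorem IsParam.abs_sub_le (hk₂ : 0 < k₂) (hk : k₂ < k₁) (h : IsParam k₁ k₂ s ρ t)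
    (h' : IsParam k₁ k₂ s ρ' t') : |t - t'| ≤ decayLip k₁ k₂ * |ρ - ρ'| := by
  have hk12 : 0 < (k₁ - k₂) * k₂ := mul_pos (sub_pos.2 hk) hk₂
  have h1 := congrArg abs (h.sub_mul h')
  have h2 := h.bracket hk₂ hk h'
  rw [abs_mul, abs_of_pos (hk12.trans_le h2), abs_mul (ρ ^ 2 - ρ' ^ 2),
    abs_of_pos (mul_pos (h.pos hk₂ hk) (h'.pos hk₂ hk))] at h1
  have h3 : |ρ ^ 2 - ρ' ^ 2| ≤ 2 * |ρ - ρ'| := by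
    rw [sq_sub_sq, abs_mul, abs_of_nonneg (add_nonneg h.ρ_nonneg h'.ρ_nonneg)]
    have := h.ρ_le_one
    have := h'.ρ_le_one
    exact mul_le_mul_of_nonneg_right (by linarith) (abs_nonneg _)
  have h4 : (k₁ + s * k₂ * t) * (k₁ + s * k₂ * t') ≤ (k₁ + k₂) ^ 2 := by
    rw [sq]
    exact mul_le_mul (h.le_add hk₂) (h'.le_add hk₂) (h'.pos hk₂ hk).le (by linarith)
  have h5 : |t - t'| * ((k₁ - k₂) * k₂) ≤ 2 * |ρ - ρ'| * (k₁ + k₂) ^ 2 :=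
    calc _ ≤ |t - t'| * (k₁ * (k₁ * (t + t') + s * k₂ * (t * t' + 1))) :=
          mul_le_mul_of_nonneg_left h2 (abs_nonneg _)
      _ = _ := h1
      _ ≤ _ := mul_le_mul h3 h4 (mul_pos (h.pos hk₂ hk) (h'.pos hk₂ hk)).le (by positivity)
  rw [decayLip, div_mul_eq_mul_div, le_div_iff₀ hk12]
  linarith

/-- The Lipschitz bound with ρ = ρ′ says that ρ determines t. -/
theorem IsParam.eq_decay (hk₂ : 0 < k₂) (hk : k₂ < k₁) (h : IsParam k₁ k₂ s ρ t) (hρ : 0 < ρ) :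
    t = decay k₁ k₂ s ρ := by
  have := h.abs_sub_le hk₂ hk (isParam_decay hk₂ hk h.sign hρ h.ρ_le_one)
  simp only [sub_self, abs_zero, mul_zero] at this
  exact sub_eq_zero.1 (abs_eq_zero.1 (le_antisymm this (abs_nonneg _)))

/-! ### States near the band edges -/

theorem not_hasState_edge (hk₂ : 0 < k₂) (hk : k₂ < k₁) {δ : ℝ} (hδ : 0 < δ)
    (hs : s = 1 ∨ s = -1) (hσ : σ = 1 ∨ σ = -1) {θ₁ θ₂ : ℝ} (hd₁ : δ ≤ |θ₁ - 1|)
    (hd₂ : δ ≤ |θ₂ - 1|) {n : ℕ} (hn : (1 + 2 / δ) / ((k₁ - k₂) / k₁) < n) :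
    ¬ HasState k₁ k₂ (s * σ * θ₁ * k₂) (s * σ * θ₂ * k₂) n (energy k₁ k₂ s σ 1 1) := by
  intro hst
  have hk12 : 0 < k₁ - k₂ := sub_pos.2 hk
  have hk₁ : 0 < k₁ := hk₂.trans hk
  obtain ⟨α, j, hne, h1, h2⟩ := hst.secular_edge hk₂ hk hs hσ
  have hθ₁' : 1 - θ₁ ≠ 0 := by
    intro h0; rw [show θ₁ - 1 = 0 by linarith, abs_zero] at hd₁; linarith
  have hθ₂' : 1 - θ₂ ≠ 0 := by
    intro h0; rw [show θ₂ - 1 = 0 by linarith, abs_zero] at hd₂; linarith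
  have hj : j ≠ 0 := by
    rintro rfl
    rcases hne with hα | hj
    · exact hα ((mul_eq_zero.1 h1).resolve_left hθ₁')
    · exact hj rfl
  have hα : α = j / (1 - θ₁) := by field_simp; linarith
  -- The affine solution meets both boundary conditions for one value of n only, and the right side
  -- is at most 1 + 2/δ.
  have hkey : (n : ℝ) * (1 + s * k₂ / k₁) = 1 - 1 / (1 - θ₁) - 1 / (1 - θ₂) := by
    rw [hα] at h2
    apply mul_left_cancel₀ hj
    field_simp at h2 ⊢
    linear_combination -h2
  have hinv : ∀ θ, δ ≤ |θ - 1| → -(1 / (1 - θ)) ≤ 1 / δ := by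
    intro θ hθ
    refine (neg_le_abs _).trans ?_
    rw [abs_div, abs_one, abs_sub_comm]
    exact one_div_le_one_div_of_le hδ hθ
  have hg : (k₁ - k₂) / k₁ ≤ 1 + s * k₂ / k₁ := by
    rw [sub_div, div_self hk₁.ne']
    rcases hs with rfl | rfl
    · have : 0 < k₂ / k₁ := by positivity
      rw [one_mul]; linarith
    · rw [neg_one_mul, neg_div]; linarith
  have hg0 : 0 < (k₁ - k₂) / k₁ := by positivity
  rw [div_lt_iff₀ hg0] at hn
  have : (n : ℝ) * ((k₁ - k₂) / k₁) ≤ n * (1 + s * k₂ / k₁) :=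
    mul_le_mul_of_nonneg_left hg (by positivity)
  have e2 : 2 / δ = 1 / δ + 1 / δ := by ring
  linarith [hinv _ hd₁, hinv _ hd₂]

/-- Both sides of the secular equation coincide at ρ = t = 1, so the rates at which they separate
are compared: 1 − t^(2n) is at least (N/2)(1 − t²), whereas 1 − ρ² is at most a constant times 1 −
t². -/
theorem not_hasState_of_large (hk₂ : 0 < k₂) (hk : k₂ < k₁) {K δ : ℝ} (hδ : 0 < δ)
    (h : IsParam k₁ k₂ s ρ t) (hσ : σ = 1 ∨ σ = -1) (ht : t < 1) {N n : ℕ}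
    (hρ1 : 1 - δ / 2 ≤ ρ) (hρ2 : 1 - ρ ≤ 1 / (8 * N)) {θ₁ θ₂ : ℝ} (hθ₁ : |θ₁| ≤ K)
    (hθ₂ : |θ₂| ≤ K) (hd₁ : δ ≤ |θ₁ - 1|) (hd₂ : δ ≤ |θ₂ - 1|)
    (hN1 : 8 / δ ^ 2 * (k₁ / (k₁ - k₂) * (1 + K ^ 2)) < N) (hn : N ≤ n) :
    ¬ HasState k₁ k₂ (s * σ * θ₁ * k₂) (s * σ * θ₂ * k₂) n (energy k₁ k₂ s σ ρ t) := by
  intro hst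
  have hk12 : 0 < k₁ - k₂ := sub_pos.2 hk
  have hk₁ : 0 < k₁ := hk₂.trans hk
  have hN0 : 0 < (N : ℝ) := lt_of_le_of_lt (by positivity) hN1
  have hsec := hst.secular hk₂ hk h hσ ht
  have hPQ : (θ₁ - ρ) * (θ₂ - ρ) * (1 - t ^ (2 * n)) = -((1 - ρ ^ 2) * (1 - θ₁ * θ₂)) := by
    linear_combination hsec
  have hlow : ∀ θ, δ ≤ |θ - 1| → δ / 2 ≤ |θ - ρ| := by
    intro θ hθ
    have h1 := abs_sub_abs_le_abs_sub (θ - 1) (ρ - 1)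
    rw [show θ - 1 - (ρ - 1) = θ - ρ by ring] at h1
    have h2 : |ρ - 1| ≤ δ / 2 := abs_le.2 ⟨by linarith, by linarith [h.ρ_le_one]⟩
    linarith
  have hQ : δ ^ 2 / 4 ≤ |(θ₁ - ρ) * (θ₂ - ρ)| := by
    rw [abs_mul]
    have := mul_le_mul (hlow _ hd₁) (hlow _ hd₂) (by positivity) (abs_nonneg _)
    linarith
  have hgeom : (1 - t ^ 2) * ∑ i ∈ Finset.range n, (t ^ 2) ^ i = 1 - t ^ (2 * n) := by
    rw [pow_mul, mul_neg_geom_sum]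
  have ht2 : 0 < 1 - t ^ 2 := by nlinarith [h.t_pos]
  have hρt : 1 - ρ ^ 2 ≤ k₁ / (k₁ - k₂) * (1 - t ^ 2) := by
    have h1 := h.eq
    have h2 := h.sub_le hk₂
    have h3 : 0 ≤ 1 - ρ ^ 2 := by nlinarith [h.ρ_nonneg, h.ρ_le_one]
    rw [div_mul_eq_mul_div, le_div_iff₀ hk12, h1]
    exact mul_le_mul_of_nonneg_left h2 h3
  have hρ0 : 0 ≤ 1 - ρ ^ 2 := by nlinarith [h.ρ_nonneg, h.ρ_le_one]
  have hθθ : |1 - θ₁ * θ₂| ≤ 1 + K ^ 2 := by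
    refine (abs_sub _ _).trans ?_
    rw [abs_one, abs_mul, sq]
    have := mul_le_mul hθ₁ hθ₂ (abs_nonneg _) ((abs_nonneg _).trans hθ₁)
    linarith
  -- The distance 1/(8N) of ρ from 1 gives 1 − t² ≤ 1/(2N), and Bernoulli's inequality then gives
  -- t^(2N) ≥ 1/2. So each of the first N terms is at least 1/2.
  have hsum_low : (N : ℝ) / 2 ≤ ∑ i ∈ Finset.range n, (t ^ 2) ^ i := by
    have ht4 : 1 - t ^ 2 ≤ 1 / (2 * N) := by
      have h1 := h.eq
      have h2 := h.le_add hk₂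
      have h3 : k₁ * (1 - t ^ 2) ≤ (1 - ρ ^ 2) * (2 * k₁) := by
        rw [h1]; exact mul_le_mul_of_nonneg_left (by linarith) hρ0
      have h4 : 1 - t ^ 2 ≤ (1 - ρ ^ 2) * 2 := by
        apply le_of_mul_le_mul_left _ hk₁; linarith
      have h5 : 1 - ρ ^ 2 ≤ 2 * (1 - ρ) := by nlinarith [h.ρ_nonneg, h.ρ_le_one]
      have h6 : 1 / (2 * (N : ℝ)) = 4 * (1 / (8 * N)) := by field_simp; norm_num
      linarith
    have hb : 1 / 2 ≤ (t ^ 2) ^ N := by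
      have := one_add_mul_le_pow (a := t ^ 2 - 1) (by nlinarith [h.t_pos]) N
      rw [show 1 + (t ^ 2 - 1) = t ^ 2 by ring] at this
      have h7 : (N : ℝ) * (1 - t ^ 2) ≤ 1 / 2 := by
        calc (N : ℝ) * (1 - t ^ 2) ≤ N * (1 / (2 * N)) := mul_le_mul_of_nonneg_left ht4 hN0.le
          _ = 1 / 2 := by field_simp
      linarith
    calc (N : ℝ) / 2 = ∑ i ∈ Finset.range N, (1 / 2 : ℝ) := by simp; ring
      _ ≤ ∑ i ∈ Finset.range N, (t ^ 2) ^ i := Finset.sum_le_sum fun i hi =>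
          hb.trans (pow_le_pow_of_le_one (sq_nonneg t) (by linarith)
            (Finset.mem_range.1 hi).le)
      _ ≤ _ := Finset.sum_le_sum_of_subset_of_nonneg
          (Finset.range_mono hn) fun _ _ _ => by positivity
  have habs := congrArg abs hPQ
  rw [abs_mul ((θ₁ - ρ) * (θ₂ - ρ)), abs_neg, abs_mul (1 - ρ ^ 2), abs_of_nonneg hρ0, ← hgeom,
    abs_of_nonneg (mul_nonneg ht2.le (by positivity : (0 : ℝ) ≤ ∑ i ∈ Finset.range n, (t ^ 2) ^ i))]
    at habs
  have hA : δ ^ 2 / 4 * ((1 - t ^ 2) * (N / 2)) ≤ k₁ / (k₁ - k₂) * (1 - t ^ 2) * (1 + K ^ 2) :=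
    calc _ ≤ |(θ₁ - ρ) * (θ₂ - ρ)| * ((1 - t ^ 2) * ∑ i ∈ Finset.range n, (t ^ 2) ^ i) :=
          mul_le_mul hQ (mul_le_mul_of_nonneg_left hsum_low ht2.le) (by positivity)
            (abs_nonneg _)
      _ = _ := habs
      _ ≤ _ := mul_le_mul hρt hθθ (abs_nonneg _) (mul_nonneg (by positivity) ht2.le)
  have hB : δ ^ 2 / 8 * N ≤ k₁ / (k₁ - k₂) * (1 + K ^ 2) := by
    apply le_of_mul_le_mul_left _ ht2; linarith
  have hC : 8 / δ ^ 2 * (δ ^ 2 / 8 * N) ≤ 8 / δ ^ 2 * (k₁ / (k₁ - k₂) * (1 + K ^ 2)) :=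
    mul_le_mul_of_nonneg_left hB (by positivity)
  have hD : 8 / δ ^ 2 * (δ ^ 2 / 8 * N) = N := by field_simp
  linarith

/-- Inside the gap, states have no frequencies close to the band edge unless an end spring is close
to its special value. -/
theorem not_hasState_near_edge (hk₂ : 0 < k₂) (hk : k₂ < k₁) {K δ : ℝ} (hδ : 0 < δ) :
    ∃ η > 0, η < 1 ∧ ∃ N : ℕ, ∀ n ≥ N, ∀ s σ ρ t θ₁ θ₂ : ℝ, IsParam k₁ k₂ s ρ t →
      (σ = 1 ∨ σ = -1) → 1 - η ≤ ρ → |θ₁| ≤ K → |θ₂| ≤ K → δ ≤ |θ₁ - 1| → δ ≤ |θ₂ - 1| →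
      ¬ HasState k₁ k₂ (s * σ * θ₁ * k₂) (s * σ * θ₂ * k₂) n (energy k₁ k₂ s σ ρ t) := by
  have hk12 : 0 < k₁ - k₂ := sub_pos.2 hk
  have hk₁ : 0 < k₁ := hk₂.trans hk
  obtain ⟨N, hN⟩ := exists_nat_gt
    (max (8 / δ ^ 2 * (k₁ / (k₁ - k₂) * (1 + K ^ 2))) ((1 + 2 / δ) / ((k₁ - k₂) / k₁)))
  rw [max_lt_iff] at hN
  obtain ⟨hN1, hN2⟩ := hN
  have hN0 : 0 < (N : ℝ) := lt_of_le_of_lt (by positivity) hN1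
  have hη : 0 < min (δ / 2) (min (1 / 2) (1 / (8 * N))) := by positivity
  refine ⟨_, hη, lt_of_le_of_lt ((min_le_right _ _).trans (min_le_left _ _)) (by norm_num), N, ?_⟩
  intro n hn s σ ρ t θ₁ θ₂ h hσ hρ hθ₁ hθ₂ hd₁ hd₂ hst
  have hρ1 : 1 - δ / 2 ≤ ρ := by linarith [min_le_left (δ / 2) (min (1 / 2) (1 / (8 * (N : ℝ))))]
  have hρ2 : 1 - ρ ≤ 1 / (8 * N) := by
    linarith [(min_le_right (δ / 2) (min (1 / 2) (1 / (8 * (N : ℝ))))).trans (min_le_right _ _)]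
  rcases h.t_le_one.lt_or_eq with ht | ht
  · exact not_hasState_of_large hk₂ hk hδ h hσ ht hρ1 hρ2 hθ₁ hθ₂ hd₁ hd₂ hN1 hn hst
  · subst ht
    have hρeq : ρ = 1 := by
      by_contra hne
      exact absurd (h.t_lt_one hk₂ hk (lt_of_le_of_ne h.ρ_le_one hne)) (lt_irrefl _)
    subst hρeq
    have hNn : (N : ℝ) ≤ n := by exact_mod_cast hn
    exact absurd hst (not_hasState_edge hk₂ hk hδ h.sign hσ hd₁ hd₂ (hN2.trans_le hNn))

theorem hasState_iff (hk₂ : k₂ ≠ 0) {κ₁ κ₂ E : ℝ} {n : ℕ} :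
    HasState k₁ k₂ κ₁ κ₂ n E ↔ ∃ u : Fin (2 * n) → ℝ, u ≠ 0 ∧
      (chainMatrix k₁ k₂ (k₂ + κ₁) (k₂ + κ₂) n).mulVec u = (-(k₁ + k₂ + E)) • u := by
  constructor
  · rintro ⟨X, Y, h, hne⟩
    refine ⟨cellVec n X Y, hne, IsChain.mulVec_eq ?_⟩
    simpa using h
  · rintro ⟨u, hne, hu⟩
    have hn : 0 < n := by
      rcases Nat.eq_zero_or_pos n with rfl | hn
      · exact absurd (funext fun i => i.elim0) hne
      · exact hn
    obtain ⟨X, Y, h, rfl⟩ := exists_isChain_of_mulVec_eq hk₂ hn hu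
    exact ⟨X, Y, by simpa using h, hne⟩

open Classical in
/-- Changing `N` end springs changes the number of eigenvalues in an interval by at most `N`. -/
theorem encard_hasState_le (hk₂ : 0 < k₂) (hk : k₂ < k₁) (hs : s = 1 ∨ s = -1)
    {lo hi : ℝ} (hlo : 0 < lo) (hlohi : lo ≤ hi) (hhi : hi ≤ 1) {κ₁ κ₂ κ₁' κ₂' : ℝ} {n : ℕ}
    (hno : ∀ ρ ∈ Set.Icc lo hi,
      ¬ HasState k₁ k₂ κ₁' κ₂' n (energy k₁ k₂ s σ ρ (decay k₁ k₂ s ρ))) :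
    {E | HasState k₁ k₂ κ₁ κ₂ n E ∧
      ∃ ρ ∈ Set.Icc lo hi, E = energy k₁ k₂ s σ ρ (decay k₁ k₂ s ρ)}.encard ≤
      ((if κ₁ = κ₁' then 0 else 1) + (if κ₂ = κ₂' then 0 else 1) : ℕ) := by
  by_contra! hcard
  -- Exactly one eigenvalue more than the claimed bound is retained.
  obtain ⟨T, hT, hTcard⟩ := Set.exists_subset_encard_eq (Order.add_one_le_of_lt hcard)
  have hTfin : T.Finite := Set.finite_of_encard_eq_coe (k := _ + 1) (by exact_mod_cast hTcard)
  let := hTfin.fintype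
  have hTc : Fintype.card T =
      (if κ₁ = κ₁' then 0 else 1) + (if κ₂ = κ₂' then 0 else 1) + 1 := by
    have h1 : T.encard = Fintype.card T := by
      rw [← Set.coe_fintypeCard]
    rw [h1] at hTcard
    exact_mod_cast hTcard
  -- The energies of the window fill a whole interval [e₁, e₂]. Hence any eigenvalue of the modified
  -- chain in this interval comes from some ρ of the window, which `hno` forbids.
  have himg := ContinuousOn.image_Icc hlohi (continuousOn_energy_decay hk₂ hk hs σ hlo hhi)
  set e₁ := sInf ((fun ρ => energy k₁ k₂ s σ ρ (decay k₁ k₂ s ρ)) '' Set.Icc lo hi)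
  set e₂ := sSup ((fun ρ => energy k₁ k₂ s σ ρ (decay k₁ k₂ s ρ)) '' Set.Icc lo hi)
  have hstate := fun E : T => (hasState_iff hk₂.ne').1 (hT E.2).1
  choose u hu0 hu using hstate
  have hn : 0 < n := by
    have : 0 < Fintype.card T := by omega
    obtain ⟨E⟩ := Fintype.card_pos_iff.1 this
    rcases Nat.eq_zero_or_pos n with rfl | hn
    · exact absurd (funext fun i => i.elim0) (hu0 E)
    · exact hn
  obtain ⟨ν, v, hν, hv0, hv⟩ := exists_eigenvector_of_agree (κ := T)
    (chainMatrix_isHermitian k₁ k₂ (k₂ + κ₁) (k₂ + κ₂) n)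
    (chainMatrix_isHermitian k₁ k₂ (k₂ + κ₁') (k₂ + κ₂') n)
    (c := -(k₁ + k₂ + (e₁ + e₂) / 2)) (r := (e₂ - e₁) / 2)
    -- `F` consists of the end sites whose springs differ; a vector vanishing there does not see the
    -- change.
    ((if κ₁ = κ₁' then ∅ else {⟨0, by omega⟩}) ∪
      (if κ₂ = κ₂' then ∅ else {⟨2 * n - 1, by omega⟩}))
    (by
      rw [hTc]
      refine lt_of_le_of_lt (Finset.card_union_le _ _) ?_
      split_ifs <;> simp)
    (by
      intro w hw
      ext i
      obtain ⟨w', hext⟩ : ∃ w' : ℕ → ℝ, ∀ i : Fin (2 * n), w i = w' i :=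
        ⟨fun j => if h : j < 2 * n then w ⟨j, h⟩ else 0, fun i => by simp⟩
      rw [chainMatrix_mulVec hext, chainMatrix_mulVec hext]
      congr 2
      simp only [← hext]
      by_cases h0 : (i : ℕ) = 0
      · simp only [if_pos h0]
        by_cases hκ : κ₁ = κ₁'
        · rw [hκ]
        · have : w i = 0 := hw i (by
            rw [if_neg hκ]
            exact Finset.mem_union_left _ (Finset.mem_singleton.2 (Fin.ext h0)))
          rw [this, mul_zero, mul_zero]
      · simp only [if_neg h0]
        by_cases h1 : (i : ℕ) + 1 = 2 * n
        · simp only [if_pos h1]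
          by_cases hκ : κ₂ = κ₂'
          · rw [hκ]
          · have : w i = 0 := hw i (by
              rw [if_neg hκ]
              exact Finset.mem_union_right _ (Finset.mem_singleton.2
                (Fin.ext (show (i : ℕ) = 2 * n - 1 by omega))))
            rw [this, mul_zero, mul_zero]
        · simp only [if_neg h1])
    (μ := fun E : T => -(k₁ + k₂ + E))
    (fun E E' h => Subtype.ext (by simpa using h))
    (fun E => by
      obtain ⟨ρ, hρ, hE⟩ := (hT E.2).2
      have : (E : ℝ) ∈ Set.Icc e₁ e₂ := himg ▸ ⟨ρ, hρ, hE.symm⟩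
      rw [abs_le]; constructor <;> linarith [this.1, this.2])
    hu0 hu
  rw [abs_le] at hν
  have : -ν - k₁ - k₂ ∈ Set.Icc e₁ e₂ := ⟨by linarith, by linarith⟩
  rw [← himg] at this
  obtain ⟨ρ, hρ, hE⟩ := this
  simp only at hE
  refine hno ρ hρ ((hasState_iff hk₂.ne').2 ⟨v, hv0, ?_⟩)
  rw [hE, hv]
  congr 1; ring

open Classical in
-- Every θ_i within δ of the special value 1 is reset to 0, whose distance from 1 is at least δ
-- because δ ≤ 1. The modified chain has no states near the edge, and each reset accounts for at
-- most one state.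
theorem encard_hasState_near_edge (hk₂ : 0 < k₂) (hk : k₂ < k₁) {K δ : ℝ} (hδ : 0 < δ)
    (hδ1 : δ ≤ 1) :
    ∃ η > 0, η < 1 ∧ ∃ N : ℕ, ∀ n ≥ N, ∀ s σ θ₁ θ₂ : ℝ, (s = 1 ∨ s = -1) →
      (σ = 1 ∨ σ = -1) → |θ₁| ≤ K → |θ₂| ≤ K →
      {E | HasState k₁ k₂ (s * σ * θ₁ * k₂) (s * σ * θ₂ * k₂) n E ∧
        ∃ ρ ∈ Set.Icc (1 - η) 1, E = energy k₁ k₂ s σ ρ (decay k₁ k₂ s ρ)}.encard ≤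
      ((if |θ₁ - 1| < δ then 1 else 0) + (if |θ₂ - 1| < δ then 1 else 0) : ℕ) := by
  obtain ⟨η, hη, hη1, N, hN⟩ := not_hasState_near_edge (K := K) hk₂ hk hδ
  refine ⟨η, hη, hη1, N, fun n hn s σ θ₁ θ₂ hs hσ hθ₁ hθ₂ => ?_⟩
  have hK : 0 ≤ K := (abs_nonneg _).trans hθ₁
  have hrep : ∀ θ, |θ| ≤ K → |if |θ - 1| < δ then 0 else θ| ≤ K ∧
      δ ≤ |(if |θ - 1| < δ then 0 else θ) - 1| := by
    intro θ hθ
    split_ifs with h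
    · simpa using ⟨hK, hδ1⟩
    · exact ⟨hθ, not_lt.1 h⟩
  refine (encard_hasState_le hk₂ hk hs (by linarith) (by linarith) le_rfl
    (κ₁' := s * σ * (if |θ₁ - 1| < δ then 0 else θ₁) * k₂)
    (κ₂' := s * σ * (if |θ₂ - 1| < δ then 0 else θ₂) * k₂) fun ρ hρ => ?_).trans ?_
  · exact hN n hn s σ ρ _ _ _ (isParam_decay hk₂ hk hs (by linarith [hρ.1]) hρ.2) hσ hρ.1
      (hrep _ hθ₁).1 (hrep _ hθ₂).1 (hrep _ hθ₁).2 (hrep _ hθ₂).2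
  · norm_cast
    apply add_le_add <;> split_ifs <;> simp_all

end

/-! ### From eigenstates to Bloch parameters and back -/

section
variable {k₁ k₂ s σ ρ t ρ' t' : ℝ}

theorem IsMode.exists_isChain {k₃₁ k₃₂ ω : ℝ} {n : ℕ} {u : Fin (2 * n) → ℝ} (hk₂ : k₂ ≠ 0)
    (h : IsMode k₁ k₂ k₃₁ k₃₂ n ω u) :
    0 < n ∧ ∃ X Y, IsChain k₁ k₂ (k₃₁ - k₂) (k₃₂ - k₂) (ω ^ 2 - k₁ - k₂) n X Y ∧
      u = cellVec n X Y := by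
  obtain ⟨_, hne, hu⟩ := h
  have hn : 0 < n := by
    rcases Nat.eq_zero_or_pos n with rfl | hn
    · exact absurd (funext fun i => i.elim0) hne
    · exact hn
  refine ⟨hn, exists_isChain_of_mulVec_eq hk₂ hn ?_⟩
  rw [hu]; congr 1; ring

/-- The signs s and σ are those of a and E = ω² − k₁ − k₂, and ρ = |E|t/(k₁ + s k₂t) is dictated by
the form of `energy`. The multiplier equation becomes the defining relation between ρ and t. -/
theorem HasRealMode.exists_param (hk₂ : 0 < k₂) (hk : k₂ < k₁) {k₃₁ k₃₂ ω a : ℝ} {n : ℕ}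
    (h : HasRealMode k₁ k₂ k₃₁ k₃₂ n ω a) :
    0 ≤ ω ∧ ∃ s σ ρ t, IsParam k₁ k₂ s ρ t ∧ (σ = 1 ∨ σ = -1) ∧ a = s * t ∧
      ω ^ 2 - k₁ - k₂ = energy k₁ k₂ s σ ρ t ∧
      HasState k₁ k₂ (k₃₁ - k₂) (k₃₂ - k₂) n (energy k₁ k₂ s σ ρ t) := by
  obtain ⟨⟨u, hu⟩, ha0, ha1, haeq⟩ := h
  have hk₁ : 0 < k₁ := hk₂.trans hk
  obtain ⟨-, X, Y, hc, hcu⟩ := hu.exists_isChain hk₂.ne'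
  obtain ⟨s, hs, has⟩ : ∃ s : ℝ, (s = 1 ∨ s = -1) ∧ a = s * |a| := by
    rcases le_total 0 a with h | h
    · exact ⟨1, Or.inl rfl, by rw [abs_of_nonneg h, one_mul]⟩
    · exact ⟨-1, Or.inr rfl, by rw [abs_of_nonpos h]; ring⟩
  obtain ⟨σ, hσ, hE⟩ : ∃ σ : ℝ, (σ = 1 ∨ σ = -1) ∧
      ω ^ 2 - k₁ - k₂ = σ * |ω ^ 2 - k₁ - k₂| := by
    rcases le_total 0 (ω ^ 2 - k₁ - k₂) with h | h
    · exact ⟨1, Or.inl rfl, by rw [abs_of_nonneg h, one_mul]⟩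
    · exact ⟨-1, Or.inr rfl, by rw [abs_of_nonpos h]; ring⟩
  have hs2 := sq_of_sign hs
  set t := |a| with ht
  have hq : 0 < k₁ + s * k₂ * t := by
    rcases hs with rfl | rfl <;> nlinarith
  set e := |ω ^ 2 - k₁ - k₂| with he
  have he2 : t * e ^ 2 = (k₁ + s * k₂ * t) * (k₁ * t + s * k₂) := by
    rw [he, sq_abs]
    rw [has] at haeq
    have hst : s * t ≠ 0 := mul_ne_zero (ne_zero_of_sign hs) ha0.ne'
    field_simp at haeq
    have h1 : t * (ω ^ 2 - k₁ - k₂) ^ 2 * s =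
        (k₁ + s * k₂ * t) * (k₁ * t + s * k₂) * s := by
      linear_combination -haeq - (k₁ * k₂ + t * k₂ ^ 2 * s) * hs2
    exact mul_right_cancel₀ (ne_zero_of_sign hs) h1
  have hen : energy k₁ k₂ s σ (e * t / (k₁ + s * k₂ * t)) t = ω ^ 2 - k₁ - k₂ := by
    have : ∀ Q : ℝ, Q ≠ 0 → σ * (e * t / Q) * Q / t = σ * e := fun Q hQ => by field_simp
    rw [hE, energy, this _ hq.ne']
  have heq : k₁ * (1 - t ^ 2) = (1 - (e * t / (k₁ + s * k₂ * t)) ^ 2) * (k₁ + s * k₂ * t) := by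
    have : ∀ Q R : ℝ, Q ≠ 0 → t * e ^ 2 = Q * R → (e * t / Q) ^ 2 * Q = t * R := by
      intro Q R hQ hR
      field_simp
      linear_combination hR
    linear_combination this _ _ hq.ne' he2
  have hρ0 : 0 ≤ e * t / (k₁ + s * k₂ * t) := by positivity
  refine ⟨hu.1, s, σ, e * t / (k₁ + s * k₂ * t), t, ⟨hs, hρ0, ?_, ha0, ha1, heq⟩, hσ, has,
    hen.symm, X, Y, by rw [hen]; exact hc, hcu ▸ hu.2.1⟩
  by_contra! hlt
  have h1 : 0 ≤ k₁ * (1 - t ^ 2) := mul_nonneg hk₁.le (by nlinarith)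
  rw [heq] at h1
  have h2 : 1 - (e * t / (k₁ + s * k₂ * t)) ^ 2 < 0 := by nlinarith
  nlinarith

theorem IsEigenstate.exists_param (hk₂ : 0 < k₂) (hk : k₂ < k₁) {k₃₁ k₃₂ : ℝ} {n : ℕ}
    {d : WaveData} (h : IsEigenstate k₁ k₂ k₃₁ k₃₂ n d) :
    0 ≤ d.ω ∧ (d.σ = 1 ∨ d.σ = -1) ∧ (d.c₁ ≠ 0 ∨ d.c₂ ≠ 0) ∧
    ∃ s ρ t, IsParam k₁ k₂ s ρ t ∧ t < 1 ∧ d.a = s * t ∧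
      d.ω ^ 2 - k₁ - k₂ = energy k₁ k₂ s d.σ ρ t ∧
      HasState k₁ k₂ (k₃₁ - k₂) (k₃₂ - k₂) n (energy k₁ k₂ s d.σ ρ t) ∧
      ∀ θ₁ θ₂, k₃₁ - k₂ = s * d.σ * θ₁ * k₂ → k₃₂ - k₂ = s * d.σ * θ₂ * k₂ →
        d.c₁ * (1 - θ₁ * ρ) = d.c₂ * t * (θ₁ - ρ) ∧
        d.c₂ * t * (1 - θ₂ * ρ) = t ^ (2 * n) * (d.c₁ * (θ₂ - ρ)) := by
  obtain ⟨u, hu, ha0, ha1, hσ, hpq, hω, hform⟩ := h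
  have hk₁ : 0 < k₁ := hk₂.trans hk
  obtain ⟨hn, X, Y, hc, hcu⟩ := hu.exists_isChain hk₂.ne'
  obtain ⟨ω, a, σ, c₁, c₂⟩ := d
  simp only at *
  obtain ⟨s, hs, has⟩ : ∃ s : ℝ, (s = 1 ∨ s = -1) ∧ a = s * |a| := by
    rcases le_total 0 a with h | h
    · exact ⟨1, Or.inl rfl, by rw [abs_of_nonneg h, one_mul]⟩
    · exact ⟨-1, Or.inr rfl, by rw [abs_of_nonpos h]; ring⟩
  have hs2 := sq_of_sign hs
  set t := |a| with ht
  have hq : 0 < k₁ + k₂ * a := by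
    rw [has]; rcases hs with rfl | rfl <;> nlinarith
  have hp : 0 ≤ k₁ + k₂ / a := nonneg_of_mul_nonneg_right hpq hq
  have ha : a ≠ 0 := abs_pos.1 ha0
  have hform0 : ∀ m < n, X m = c₁ * a ^ m * (-σ * √(k₁ + k₂ / a)) +
      c₂ * a⁻¹ ^ m * (-σ * √(k₁ + k₂ * a)) := by
    intro m hm
    have := hform ⟨m, hm⟩ 0
    simp only [hcu, v₁, v₂] at this
    rw [← cellVec_even (n := n) X Y (by omega)]
    simpa using this
  have hform1 : ∀ m < n, Y (m + 1) = c₁ * a ^ m * √(k₁ + k₂ * a) +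
      c₂ * a⁻¹ ^ m * √(k₁ + k₂ / a) := by
    intro m hm
    have := hform ⟨m, hm⟩ 1
    simp only [hcu, v₁, v₂] at this
    rw [← cellVec_odd (n := n) X Y (by omega)]
    simpa using this
  rw [Real.sqrt_mul hq.le] at hω
  have hq2 := Real.sq_sqrt hq.le
  have hp2 := Real.sq_sqrt hp
  have hq0 : 0 < √(k₁ + k₂ * a) := Real.sqrt_pos.2 hq
  have hp0 : 0 ≤ √(k₁ + k₂ / a) := Real.sqrt_nonneg _
  generalize √(k₁ + k₂ * a) = q at *
  generalize √(k₁ + k₂ / a) = p at *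
  have hqst : q ^ 2 = k₁ + s * k₂ * t := by rw [hq2]; linear_combination k₂ * has
  have hpst : p ^ 2 * t = k₁ * t + s * k₂ := by
    rw [hp2, add_mul]
    have : t / a = s := by
      rw [div_eq_iff ha, has]; linear_combination -t * hs2
    rw [div_mul_eq_mul_div, mul_div_assoc, this]; ring
  have heq : k₁ * (1 - t ^ 2) = (1 - (p * t / q) ^ 2) * (k₁ + s * k₂ * t) := by
    rw [← hqst]; field_simp
    linear_combination -hqst + t * hpst
  have hρ0 : 0 ≤ p * t / q := by positivity
  have hpar : IsParam k₁ k₂ s (p * t / q) t := by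
    refine ⟨hs, hρ0, ?_, ha0, ha1.le, heq⟩
    by_contra! hlt
    have h1 : 0 ≤ k₁ * (1 - t ^ 2) := mul_nonneg hk₁.le (by nlinarith)
    rw [heq, ← hqst] at h1
    have h2 : 1 - (p * t / q) ^ 2 < 0 := by nlinarith
    nlinarith
  have hen : ω ^ 2 - k₁ - k₂ = energy k₁ k₂ s σ (p * t / q) t := by
    rw [hω, energy, ← hqst]; field_simp; ring
  have hX : ∀ m < n, X m = waveX s σ (p * t / q) t (c₁ * q / t) (c₂ * q) m := by
    intro m hm
    rw [hform0 m hm, waveX, ← has]; field_simp; ring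
  have hY : ∀ m < n, Y (m + 1) = waveY s (p * t / q) t (c₁ * q / t) (c₂ * q) (m + 1) := by
    intro m hm
    rw [hform1 m hm, waveY, ← has, pow_succ, pow_succ]
    have e1 : s * a / t = 1 := by
      rw [div_eq_one_iff_eq ha0.ne', has]; linear_combination t * hs2
    have e2 : s * t * a⁻¹ = 1 := by rw [← has, mul_inv_cancel₀ ha]
    have e3 : p * t / q * q = p * t := by field_simp
    linear_combination (-(c₁ * a ^ m * q)) * e1 - (c₂ * a⁻¹ ^ m * p) * e2 -
      (s * c₂ * a⁻¹ ^ m * a⁻¹) * e3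
  rw [hen] at hc
  refine ⟨hu.1, hσ, ?_, s, p * t / q, t, hpar, ha1, has, hen, ⟨X, Y, hc, hcu ▸ hu.2.1⟩, ?_⟩
  · by_contra! h0
    obtain ⟨rfl, rfl⟩ := h0
    apply hu.2.1
    rw [hcu]
    ext ⟨i, hi⟩
    simp only [cellVec, Pi.zero_apply]
    split_ifs
    · rw [hform0 _ (by omega)]; ring
    · rw [hform1 _ (by omega)]; ring
  · intro θ₁ θ₂ hθ₁ hθ₂
    have hl := hc.left
    have hr := hc.right
    -- The Bloch form is given on actual sites only; the equations of motion carry it to the ghost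
    -- sites, where the boundary conditions are posed.
    have hY0 : Y 0 = waveY s (p * t / q) t (c₁ * q / t) (c₂ * q) 0 := by
      have h1 := hc.odd 0 hn
      rw [hX 0 hn, hY 0 hn, ← wave_odd hpar hσ] at h1
      exact mul_left_cancel₀ hk₂.ne' (by linarith)
    obtain ⟨l, rfl⟩ := Nat.exists_eq_succ_of_ne_zero hn.ne'
    simp only [Nat.succ_eq_add_one] at *
    have hXn : X (l + 1) = waveX s σ (p * t / q) t (c₁ * q / t) (c₂ * q) (l + 1) := by
      have h1 := hc.even l (by omega)
      rw [hX l (by omega), hY l (by omega), ← wave_even hpar] at h1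
      exact mul_left_cancel₀ hk₂.ne' (by linarith)
    rw [hY0, hX 0 hn, hθ₁, wave_left hs hσ hk₂] at hl
    rw [hY l (by omega), hXn, hθ₂, wave_right hs hσ hk₂ ha0] at hr
    generalize p * t / q = ρ at *
    have hqt : q / t ≠ 0 := (div_pos hq0 ha0).ne'
    have e3 : q / t * t = q := by field_simp
    constructor
    · apply mul_left_cancel₀ hqt
      linear_combination hl - c₂ * (θ₁ - ρ) * e3
    · apply mul_left_cancel₀ hqt
      linear_combination hr + c₂ * (1 - θ₂ * ρ) * e3

theorem IsParam.ρ_le_t (hk₂ : 0 < k₂) (hk : k₂ < k₁) (h : IsParam k₁ k₂ (-1) ρ t) : ρ ≤ t := by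
  have h1 := h.eq
  have h2 := h.t_pos
  have h3 : 0 ≤ k₂ * t * (1 - ρ ^ 2) :=
    mul_nonneg (by positivity) (by nlinarith [h.ρ_nonneg, h.ρ_le_one])
  have h4 : k₁ * ρ ^ 2 ≤ k₁ * t ^ 2 := by nlinarith
  exact le_of_sq_le_sq (le_of_mul_le_mul_left h4 (hk₂.trans hk)) h2.le

/-- The edge state of the chain described by a solution of the secular equation. -/
noncomputable def edgeState (k₁ k₂ s ρ t θ₁ : ℝ) : WaveData where
  ω := √(k₁ + k₂ + energy k₁ k₂ s s ρ t)
  a := s * t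
  σ := s
  c₁ := 1
  c₂ := (1 - θ₁ * ρ) / (t * (θ₁ - ρ))

theorem energy_nonneg (hk₂ : 0 < k₂) (hk : k₂ < k₁) (h : IsParam k₁ k₂ s ρ t) :
    0 ≤ k₁ + k₂ + energy k₁ k₂ s s ρ t := by
  have hk₁ := hk₂.trans hk
  have hq := h.pos hk₂ hk
  have hρ := h.ρ_nonneg
  have ht := h.t_pos
  rcases h.sign with rfl | rfl
  · unfold energy; positivity
  · have h1 := h.ρ_le_t hk₂ hk
    have : ρ * (k₁ + -1 * k₂ * t) / t ≤ k₁ := by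
      rw [div_le_iff₀ ht]
      calc ρ * (k₁ + -1 * k₂ * t) ≤ t * (k₁ + -1 * k₂ * t) :=
            mul_le_mul_of_nonneg_right h1 hq.le
        _ ≤ k₁ * t := by nlinarith [mul_pos hk₂ (mul_pos ht ht)]
    have e : energy k₁ k₂ (-1) (-1) ρ t = -(ρ * (k₁ + -1 * k₂ * t) / t) := by
      unfold energy; ring
    rw [e]; linarith

theorem sq_edgeState_ω (hk₂ : 0 < k₂) (hk : k₂ < k₁) (h : IsParam k₁ k₂ s ρ t) (θ₁ : ℝ) :
    (edgeState k₁ k₂ s ρ t θ₁).ω ^ 2 - k₁ - k₂ = energy k₁ k₂ s s ρ t := by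
  rw [edgeState, Real.sq_sqrt (energy_nonneg hk₂ hk h)]; ring

theorem isEigenstate_edgeState (hk₂ : 0 < k₂) (hk : k₂ < k₁) (h : IsParam k₁ k₂ s ρ t)
    (ht : t < 1) {k₃₁ k₃₂ θ₁ θ₂ : ℝ} {n : ℕ} (hn : 0 < n) (hθ₁ : 1 < θ₁)
    (h₁ : k₃₁ - k₂ = θ₁ * k₂) (h₂ : k₃₂ - k₂ = θ₂ * k₂)
    (hsec : (1 - θ₁ * ρ) * (1 - θ₂ * ρ) = t ^ (2 * n) * ((θ₁ - ρ) * (θ₂ - ρ))) :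
    IsEigenstate k₁ k₂ k₃₁ k₃₂ n (edgeState k₁ k₂ s ρ t θ₁) := by
  have hk₁ := hk₂.trans hk
  have hs2 := sq_of_sign h.sign
  have ht0 := h.t_pos
  have hρ1 := h.ρ_lt_one hk₂ hk ht
  have hθρ : 0 < θ₁ - ρ := by linarith
  have hq : 0 < k₁ + k₂ * (s * t) := by have := h.pos hk₂ hk; linarith
  have hst : s * t ≠ 0 := mul_ne_zero (ne_zero_of_sign h.sign) ht0.ne'
  have hpρ : k₁ + k₂ / (s * t) = (ρ / t) ^ 2 * (k₁ + k₂ * (s * t)) := by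
    have : k₂ / (s * t) = s * k₂ / t := by
      rw [div_eq_div_iff hst ht0.ne']; linear_combination -k₂ * t * hs2
    rw [this]
    field_simp
    linear_combination -h.eq
  have hp : 0 ≤ k₁ + k₂ / (s * t) := by rw [hpρ]; positivity
  have hsqp : √(k₁ + k₂ / (s * t)) = ρ / t * √(k₁ + k₂ * (s * t)) := by
    rw [hpρ, Real.sqrt_mul (by positivity), Real.sqrt_sq (div_nonneg h.ρ_nonneg ht0.le)]
  have hq2 := Real.sq_sqrt hq.le
  have hq0 : 0 < √(k₁ + k₂ * (s * t)) := Real.sqrt_pos.2 hq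
  set q := √(k₁ + k₂ * (s * t)) with hqdef
  clear_value q
  obtain ⟨c₂, hc₂⟩ : ∃ c, c = (1 - θ₁ * ρ) / (t * (θ₁ - ρ)) := ⟨_, rfl⟩
  have hc₂' : c₂ * t * (θ₁ - ρ) = 1 - θ₁ * ρ := by rw [hc₂]; field_simp
  have hchain := isChain_wave (σ := s) hk₂ h h.sign (θ₁ := θ₁) (θ₂ := θ₂) (d₁ := q / t)
    (d₂ := c₂ * q) (n := n)
    (by field_simp; linear_combination -hc₂') (by
      -- The choice of c₂ solves the left matching condition; the right one is then the secular
      -- equation divided by θ₁ − ρ > 0.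
      have e : c₂ * t * (1 - θ₂ * ρ) = t ^ (2 * n) * (θ₂ - ρ) :=
        mul_right_cancel₀ hθρ.ne' (by linear_combination (1 - θ₂ * ρ) * hc₂' + hsec)
      field_simp
      linear_combination e)
  have hsinv : s⁻¹ = s := by rcases h.sign with rfl | rfl <;> norm_num
  have hss : s * s = 1 := by rw [← sq, hs2]
  rw [hss, one_mul, one_mul, ← h₁, ← h₂] at hchain
  refine ⟨cellVec n (waveX s s ρ t (q / t) (c₂ * q)) (waveY s ρ t (q / t) (c₂ * q)), ⟨Real.sqrt_nonneg _, ?_, ?_⟩, ?_, ?_, h.sign, ?_, ?_, ?_⟩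
  rotate_left
  · rw [hchain.mulVec_eq, ← sq_edgeState_ω hk₂ hk h θ₁]; congr 1; ring
  · exact abs_pos.2 hst
  · simp only [edgeState, abs_mul, abs_of_sign h.sign, one_mul, abs_of_pos ht0]; exact ht
  · simp only [edgeState]; positivity
  · have := sq_edgeState_ω hk₂ hk h θ₁
    simp only [edgeState] at this ⊢
    rw [Real.sqrt_mul hq.le, hsqp, ← hqdef]
    have e : q * (ρ / t * q) = ρ / t * (k₁ + k₂ * (s * t)) := by rw [← hq2]; ring
    rw [e]
    have e2 : energy k₁ k₂ s s ρ t = s * (ρ / t * (k₁ + k₂ * (s * t))) := by unfold energy; ring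
    linarith
  · intro m i
    have hm := m.2
    fin_cases i
    · simp only [Fin.zero_eta, Fin.isValue, add_zero, cellVec_even]
      simp only [edgeState, v₁, v₂, waveX, Matrix.cons_val_zero, hsqp, ← hqdef, ← hc₂]
      ring
    · simp only [Fin.mk_one, Fin.isValue, cellVec_odd]
      simp only [edgeState, v₁, v₂, waveY, Matrix.cons_val_one, hsqp, ← hqdef,
        ← hc₂, pow_succ]
      have e1 : (s * t)⁻¹ = s / t := by rw [mul_inv, hsinv, div_eq_mul_inv]
      simp only [e1]
      simp only [Matrix.cons_val_fin_one]
      field_simp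
      linear_combination ((s ^ (m : ℕ) * (t * t ^ (m : ℕ) + c₂ * ρ * t⁻¹ ^ (m : ℕ)))) * hs2
  · intro h0
    have hX := cellVec_even (n := n) (waveX s s ρ t (q / t) (c₂ * q)) (waveY s ρ t (q / t) (c₂ * q))
      (m := 0) (by omega)
    have hY := cellVec_odd (n := n) (waveX s s ρ t (q / t) (c₂ * q)) (waveY s ρ t (q / t) (c₂ * q))
      (m := 0) (by omega)
    rw [h0] at hX hY
    simp only [Pi.zero_apply, waveX, waveY, pow_zero, zero_add, pow_one, mul_one] at hX hY
    have e1 : (s * t)⁻¹ = s / t := by rw [mul_inv, hsinv, div_eq_mul_inv]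
    rw [e1] at hY
    have hs0 := ne_zero_of_sign h.sign
    have hX' : ρ / t + c₂ = 0 := by
      have : s * q * (ρ / t + c₂) = 0 := by linear_combination hX
      exact (mul_eq_zero.1 this).resolve_left (mul_ne_zero hs0 hq0.ne')
    have hY' : t + c₂ * ρ = 0 := by
      have : q * (t + c₂ * ρ) = 0 := by
        field_simp at hY
        have hY2 : q * (t + c₂ * ρ) * s ^ 2 = 0 := by linear_combination -hY
        rwa [hs2, mul_one] at hY2
      exact (mul_eq_zero.1 this).resolve_left hq0.ne'
    -- If the first cell were at rest, t = ρ would follow, and the defining relation would reduce to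
    -- (1 − ρ²)s k₂t = 0.
    have h3 : t ^ 2 = ρ ^ 2 := by
      field_simp at hX'
      linear_combination t * hY' - ρ * hX'
    have h4 := h.eq
    rw [h3] at h4
    have h5 : (1 - ρ ^ 2) * (s * k₂ * t) = 0 := by linear_combination -h4
    have h6 : 0 < 1 - ρ ^ 2 := by nlinarith [h.ρ_nonneg]
    exact mul_ne_zero h6.ne' (mul_ne_zero (mul_ne_zero hs0 hk₂.ne') ht0.ne') h5

theorem IsParam.sq_energy (h : IsParam k₁ k₂ s ρ t) (hσ : σ = 1 ∨ σ = -1) :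
    energy k₁ k₂ s σ ρ t ^ 2 * t = (k₁ + s * k₂ * t) * (k₁ * t + s * k₂) := by
  have ht := h.t_pos.ne'
  have hσ2 := sq_of_sign hσ
  unfold energy
  field_simp
  linear_combination (ρ ^ 2 * (k₁ + s * k₂ * t) ^ 2) * hσ2 + (k₁ + s * k₂ * t) * h.eq

/-- The squared energy is k₁² + k₂² + s k₁k₂(t + 1/t), and t + 1/t is injective on (0, 1]. -/
theorem IsParam.energy_inj (hk₂ : 0 < k₂) (hk : k₂ < k₁) (h : IsParam k₁ k₂ s ρ t)
    (h' : IsParam k₁ k₂ s ρ' t') (ht : t < 1) (hσ : σ = 1 ∨ σ = -1)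
    (hE : energy k₁ k₂ s σ ρ t = energy k₁ k₂ s σ ρ' t') : t = t' ∧ ρ = ρ' := by
  have hk₁ := hk₂.trans hk
  have h1 := h.sq_energy hσ
  have h2 := h'.sq_energy hσ
  have t0 := h.t_pos
  have t0' := h'.t_pos
  rw [hE] at h1
  have hs2 := sq_of_sign h.sign
  have hs0 := ne_zero_of_sign h.sign
  have h3 : (s * k₁ * k₂ * (1 - t * t')) * (t - t') = 0 := by
    linear_combination t' * h1 - t * h2
  have h4 : 0 < 1 - t * t' := by nlinarith [h'.t_le_one]
  have htt : t = t' := sub_eq_zero.1 ((mul_eq_zero.1 h3).resolve_left (by positivity))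
  subst htt
  refine ⟨rfl, ?_⟩
  have hq := h.pos hk₂ hk
  have hσ0 := ne_zero_of_sign hσ
  unfold energy at hE
  field_simp at hE
  exact hE

end

/-! ### Modes with decay factor close to 1 or −1 -/

section
variable {k₁ k₂ : ℝ}

theorem exists_near_edge (hk₂ : 0 < k₂) (hk : k₂ < k₁) {s₀ : ℝ} (hs₀ : s₀ = 1 ∨ s₀ = -1)
    {η : ℝ} (hη : 0 < η) :
    ∃ η' > 0, ∀ s ρ t, IsParam k₁ k₂ s ρ t → |s * t - s₀| < η' →
      s = s₀ ∧ 1 - η ≤ ρ ∧ 1 - η ≤ t := by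
  have hk12 : 0 < k₁ - k₂ := sub_pos.2 hk
  have hk₁ := hk₂.trans hk
  -- The bound 1 fixes the sign s, η controls t, and the third bound controls ρ through (1 − ρ²)(k₁
  -- − k₂) ≤ 2k₁(1 − t).
  refine ⟨min 1 (min η (η * (k₁ - k₂) / (2 * k₁))), by positivity, fun s ρ t h hst => ?_⟩
  rw [lt_min_iff, lt_min_iff] at hst
  obtain ⟨h1, h2, h3⟩ := hst
  have t0 := h.t_pos
  have t1 := h.t_le_one
  have hss : s = s₀ := by
    rcases h.sign with rfl | rfl <;> rcases hs₀ with rfl | rfl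
    · rfl
    · rw [abs_lt] at h1; linarith
    · rw [abs_lt] at h1; linarith
    · rfl
  subst hss
  have habs : |s * t - s| = 1 - t := by
    rw [show s * t - s = s * (t - 1) by ring, abs_mul, abs_of_sign h.sign, one_mul, abs_sub_comm,
      abs_of_nonneg (by linarith)]
  rw [habs] at h2 h3
  refine ⟨rfl, ?_, by linarith⟩
  rw [lt_div_iff₀ (by positivity)] at h3
  have hρ0 := h.ρ_nonneg
  have hρ1 := h.ρ_le_one
  have hR : 0 ≤ 1 - ρ ^ 2 := by nlinarith
  have h5 : (1 - ρ ^ 2) * (k₁ - k₂) ≤ k₁ * (1 - t ^ 2) := by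
    rw [h.eq]; exact mul_le_mul_of_nonneg_left (h.sub_le hk₂) hR
  have h6 : k₁ * (1 - t ^ 2) ≤ (1 - t) * (2 * k₁) := by
    nlinarith [mul_nonneg hk₁.le (sq_nonneg (1 - t))]
  have h7 : (1 - ρ ^ 2) * (k₁ - k₂) < η * (k₁ - k₂) := by linarith
  have h8 := lt_of_mul_lt_mul_right h7 hk12.le
  nlinarith

theorem sign_mul_scaled {s σ : ℝ} (hs : s = 1 ∨ s = -1) (hσ : σ = 1 ∨ σ = -1) (x : ℝ) :
    k₂ + x * k₂ - k₂ = s * σ * (s * σ * x) * k₂ := by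
  linear_combination (-(σ ^ 2 * x * k₂)) * sq_of_sign hs - x * k₂ * sq_of_sign hσ

theorem abs_sign_mul {s σ : ℝ} (hs : s = 1 ∨ s = -1) (hσ : σ = 1 ∨ σ = -1) (x : ℝ) :
    |s * σ * x| = |x| := by
  rw [abs_mul, abs_mul, abs_of_sign hs, abs_of_sign hσ, one_mul, one_mul]

theorem encard_modes_near (hk₂ : 0 < k₂) (hk : k₂ < k₁) {s₀ : ℝ} (hs₀ : s₀ = 1 ∨ s₀ = -1)
    {K δ : ℝ} (hδ : 0 < δ) (hδ1 : δ ≤ 1) :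
    ∃ η > 0, ∃ N : ℕ, ∀ n ≥ N, ∀ x₁ x₂ : ℝ, |x₁| ≤ K → |x₂| ≤ K →
      {ω | ∃ a, HasRealMode k₁ k₂ (k₂ + x₁ * k₂) (k₂ + x₂ * k₂) n ω a ∧ |a - s₀| < η}.encard ≤
        ((if |(|x₁| - 1)| < δ then 1 else 0) + (if |(|x₂| - 1)| < δ then 1 else 0) : ℕ) := by
  classical
  obtain ⟨η, hη, hη1, N, hN⟩ := encard_hasState_near_edge (K := K) hk₂ hk hδ hδ1
  obtain ⟨η', hη', hnear⟩ := exists_near_edge hk₂ hk hs₀ hη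
  refine ⟨η', hη', N, fun n hn x₁ x₂ hx₁ hx₂ => ?_⟩
  have hb : ∀ σ : ℝ, (σ = 1 ∨ σ = -1) →
      {ω : ℝ | 0 ≤ ω ∧ HasState k₁ k₂ (k₂ + x₁ * k₂ - k₂) (k₂ + x₂ * k₂ - k₂) n
        (ω ^ 2 - k₁ - k₂) ∧ ∃ ρ ∈ Set.Icc (1 - η) 1,
          ω ^ 2 - k₁ - k₂ = energy k₁ k₂ s₀ σ ρ (decay k₁ k₂ s₀ ρ)}.encard ≤
      ((if |s₀ * σ * x₁ - 1| < δ then 1 else 0) +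
        (if |s₀ * σ * x₂ - 1| < δ then 1 else 0) : ℕ) := by
    intro σ hσ
    refine le_trans ?_ (hN n hn s₀ σ (s₀ * σ * x₁) (s₀ * σ * x₂) hs₀ hσ
      ((abs_sign_mul hs₀ hσ _).trans_le hx₁) ((abs_sign_mul hs₀ hσ _).trans_le hx₂))
    refine Set.encard_le_encard_of_injOn (f := fun ω => ω ^ 2 - k₁ - k₂) ?_ ?_
    · rintro ω ⟨-, h1, h2⟩
      rw [sign_mul_scaled hs₀ hσ x₁, sign_mul_scaled hs₀ hσ x₂] at h1
      exact ⟨h1, h2⟩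
    · rintro ω ⟨h0, -⟩ ω' ⟨h0', -⟩ h
      have : ω ^ 2 = ω' ^ 2 := by simpa using h
      exact (sq_eq_sq₀ h0 h0').1 this
  have hsub : {ω | ∃ a, HasRealMode k₁ k₂ (k₂ + x₁ * k₂) (k₂ + x₂ * k₂) n ω a ∧ |a - s₀| < η'} ⊆
      {ω : ℝ | 0 ≤ ω ∧ HasState k₁ k₂ (k₂ + x₁ * k₂ - k₂) (k₂ + x₂ * k₂ - k₂) n
        (ω ^ 2 - k₁ - k₂) ∧ ∃ ρ ∈ Set.Icc (1 - η) 1,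
          ω ^ 2 - k₁ - k₂ = energy k₁ k₂ s₀ 1 ρ (decay k₁ k₂ s₀ ρ)} ∪
      {ω : ℝ | 0 ≤ ω ∧ HasState k₁ k₂ (k₂ + x₁ * k₂ - k₂) (k₂ + x₂ * k₂ - k₂) n
        (ω ^ 2 - k₁ - k₂) ∧ ∃ ρ ∈ Set.Icc (1 - η) 1,
          ω ^ 2 - k₁ - k₂ = energy k₁ k₂ s₀ (-1) ρ (decay k₁ k₂ s₀ ρ)} := by
    rintro ω ⟨a, ha, has⟩
    obtain ⟨h0, s, σ, ρ, t, hp, hσ, rfl, hE, hst⟩ := ha.exists_param hk₂ hk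
    obtain ⟨rfl, hρ, -⟩ := hnear s ρ t hp has
    rw [hp.eq_decay hk₂ hk (by linarith)] at hE hst
    rw [← hE] at hst
    rcases hσ with rfl | rfl
    · exact Or.inl ⟨h0, hst, ρ, ⟨hρ, hp.ρ_le_one⟩, hE⟩
    · exact Or.inr ⟨h0, hst, ρ, ⟨hρ, hp.ρ_le_one⟩, hE⟩
  refine (Set.encard_le_encard hsub).trans ((Set.encard_union_le _ _).trans
    ((add_le_add (hb 1 (Or.inl rfl)) (hb (-1) (Or.inr rfl))).trans ?_))
  norm_cast
  -- The two branches σ = ±1 require x and −x, up to s₀, to be within δ ≤ 1 of 1. At most one of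
  -- them can hold, so each end contributes to one branch only.
  have key : ∀ x : ℝ, (if |s₀ * (1 : ℝ) * x - 1| < δ then 1 else 0) +
      (if |s₀ * (-1 : ℝ) * x - 1| < δ then 1 else 0) ≤
      (if |(|x| - 1)| < δ then 1 else 0) := by
    intro x
    have h1 : ∀ y : ℝ, |y| = |x| → |y - 1| < δ → |(|x| - 1)| < δ := by
      intro y hy h
      have := abs_abs_sub_abs_le y 1
      rw [abs_one, hy] at this
      linarith
    by_cases hA : |s₀ * (1 : ℝ) * x - 1| < δ
    · have hB : ¬ |s₀ * (-1 : ℝ) * x - 1| < δ := by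
        intro hB
        rw [abs_lt] at hA hB
        linarith
      rw [if_pos hA, if_neg hB, if_pos (h1 _ (abs_sign_mul hs₀ (Or.inl rfl) x) hA)]
    · rw [if_neg hA]
      by_cases hB : |s₀ * (-1 : ℝ) * x - 1| < δ
      · rw [if_pos hB, if_pos (h1 _ (abs_sign_mul hs₀ (Or.inr rfl) x) hB)]
      · rw [if_neg hB]; positivity
  have := key x₁
  have := key x₂
  push_cast at *
  omega

/-- On the branch σ₀ both springs are away from their special value, so states near the edge lie on
the branch −σ₀, where the energy tends to −σ₀(k₁ + s₀k₂) as ρ, t → 1. -/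
theorem freq_near (hk₂ : 0 < k₂) (hk : k₂ < k₁) {s₀ : ℝ} (hs₀ : s₀ = 1 ∨ s₀ = -1)
    {K δ ε : ℝ} (hδ : 0 < δ) (hε : 0 < ε) :
    ∃ η > 0, ∃ N : ℕ, ∀ n ≥ N, ∀ σ₀ x₁ x₂ : ℝ, (σ₀ = 1 ∨ σ₀ = -1) → |x₁| ≤ K → |x₂| ≤ K →
      δ ≤ |s₀ * σ₀ * x₁ - 1| → δ ≤ |s₀ * σ₀ * x₂ - 1| →
      ∀ ω a, HasRealMode k₁ k₂ (k₂ + x₁ * k₂) (k₂ + x₂ * k₂) n ω a → |a - s₀| < η →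
        |ω ^ 2 - (k₁ + k₂ - σ₀ * (k₁ + s₀ * k₂))| < ε := by
  have hk₁ := hk₂.trans hk
  obtain ⟨η, hη, hη1, N, hN⟩ := not_hasState_near_edge (K := K) hk₂ hk hδ
  obtain ⟨η', hη', hnear⟩ := exists_near_edge hk₂ hk hs₀
    (η := min η (min (1 / 2) (ε / (8 * k₁)))) (by positivity)
  refine ⟨η', hη', N, fun n hn σ₀ x₁ x₂ hσ₀ hx₁ hx₂ hd₁ hd₂ ω a ha has => ?_⟩
  obtain ⟨h0, s, σ, ρ, t, hp, hσ, rfl, hE, hst⟩ := ha.exists_param hk₂ hk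
  obtain ⟨rfl, hρ, ht⟩ := hnear s ρ t hp has
  have m1 := min_le_left η (min (1 / 2) (ε / (8 * k₁)))
  have m2 := (min_le_right η (min (1 / 2) (ε / (8 * k₁)))).trans (min_le_left _ _)
  have m3 := (min_le_right η (min (1 / 2) (ε / (8 * k₁)))).trans (min_le_right _ _)
  have hne : σ ≠ σ₀ := by
    rintro rfl
    rw [sign_mul_scaled hs₀ hσ x₁, sign_mul_scaled hs₀ hσ x₂] at hst
    exact hN n hn s σ ρ t _ _ hp hσ (by linarith) ((abs_sign_mul hs₀ hσ _).trans_le hx₁)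
      ((abs_sign_mul hs₀ hσ _).trans_le hx₂) hd₁ hd₂ hst
  have hσσ : σ₀ = -σ := by
    rcases hσ with h | h <;> rcases hσ₀ with h' | h'
    · exact absurd (h.trans h'.symm) hne
    · rw [h, h']
    · rw [h, h', neg_neg]
    · exact absurd (h.trans h'.symm) hne
  subst hσσ
  have ht0 := hp.t_pos
  have hρ1 := hp.ρ_le_one
  have ht1 := hp.t_le_one
  have e1 : ω ^ 2 - (k₁ + k₂ - -σ * (k₁ + s * k₂)) =
      σ * (k₁ * ((ρ - t) / t) - s * k₂ * (1 - ρ)) := by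
    have : energy k₁ k₂ s σ ρ t = σ * (k₁ * ((ρ - t) / t) + k₁ + s * k₂ * ρ) := by
      unfold energy; field_simp; ring
    linear_combination hE + this
  have hm4 : ε / (8 * k₁) * (8 * k₁) = ε := by field_simp
  have e2 : |(ρ - t) / t| ≤ 2 * (ε / (8 * k₁)) := by
    rw [abs_div, abs_of_pos ht0, div_le_iff₀ ht0]
    have : |ρ - t| ≤ ε / (8 * k₁) := abs_le.2 ⟨by linarith, by linarith⟩
    have h3 : 0 ≤ ε / (8 * k₁) := by positivity
    nlinarith
  have e3 : |s * k₂ * (1 - ρ)| ≤ k₁ * (ε / (8 * k₁)) := by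
    rw [abs_mul, abs_mul, abs_of_sign hs₀, one_mul, abs_of_pos hk₂, abs_of_nonneg (by linarith)]
    exact mul_le_mul hk.le (by linarith) (by linarith) hk₁.le
  rw [e1, abs_mul, abs_of_sign hσ, one_mul]
  refine (abs_sub _ _).trans_lt ?_
  rw [abs_mul, abs_of_pos hk₁]
  have := mul_le_mul_of_nonneg_left e2 hk₁.le
  nlinarith

end

/-! ### Roots of the secular equation near the semi-infinite edge state -/

section
variable {k₁ k₂ s σ ρ t : ℝ}

/-- A bound for the decay rate in terms of the distance of `ρ` from `1`. -/
theorem exists_t_le (hk₂ : 0 < k₂) (hk : k₂ < k₁) {c : ℝ} (hc : 0 < c) :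
    ∃ r, 0 < r ∧ r < 1 ∧ ∀ s ρ t, IsParam k₁ k₂ s ρ t → ρ ≤ 1 - c → t ≤ r := by
  have hk12 : 0 < k₁ - k₂ := sub_pos.2 hk
  have hk₁ := hk₂.trans hk
  have h0 : 0 < c * (k₁ - k₂) / (2 * k₁) := by positivity
  refine ⟨max (1 / 2) (1 - c * (k₁ - k₂) / (2 * k₁)), by positivity,
    max_lt (by norm_num) (by linarith), fun s ρ t h hρ => ?_⟩
  refine le_trans ?_ (le_max_right _ _)
  have h1 := h.sub_le hk₂
  have h2 := h.ρ_nonneg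
  have h3 : c ≤ 1 - ρ ^ 2 := by nlinarith
  have h4 : c * (k₁ - k₂) ≤ k₁ * (1 - t ^ 2) := by
    rw [h.eq]; exact mul_le_mul h3 h1 hk12.le (by linarith)
  have h5 : c * (k₁ - k₂) / (2 * k₁) ≤ 1 - t := by
    rw [div_le_iff₀ (by positivity)]
    nlinarith [mul_nonneg hk₁.le (sq_nonneg (1 - t))]
  linarith

/-- Keeps t away from 0 once ρ is, as needed for relative errors of t and for divisions by t. -/
theorem IsParam.mul_sq_le_t (hk₂ : 0 < k₂) (hk : k₂ < k₁) (h : IsParam k₁ k₂ s ρ t) :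
    k₁ / (k₁ + k₂) * ρ ^ 2 ≤ t := by
  have hk₁ := hk₂.trans hk
  have t0 := h.t_pos
  have t1 := h.t_le_one
  have h0 := h.ρ_nonneg
  have h1 := h.ρ_le_one
  have heq := h.eq
  rw [div_mul_eq_mul_div, div_le_iff₀ (by positivity)]
  rcases h.sign with rfl | rfl
  · have a1 : k₁ * t ^ 2 ≤ k₁ * t := by
      nlinarith [mul_nonneg hk₁.le (mul_nonneg t0.le (sub_nonneg.2 t1))]
    have a2 : 0 ≤ ρ ^ 2 * (k₂ * t) := by positivity
    nlinarith
  · have := h.ρ_le_t hk₂ hk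
    have a1 : ρ ^ 2 ≤ ρ := by nlinarith
    nlinarith

/-- For σ = s the semi-infinite condition is 1 − xρ = 0; inserting ρ = 1/x in the relation between ρ
and t gives the quadratic for ã. -/
theorem isSemiInfiniteRoot_decay (hk₂ : 0 < k₂) (hk : k₂ < k₁) (hs : s = 1 ∨ s = -1) {x : ℝ}
    (hx : 1 < x) : IsSemiInfiniteRoot k₁ k₂ (k₂ + x * k₂) (s * decay k₁ k₂ s (1 / x)) := by
  have hx0 : 0 < x := by linarith
  have h := isParam_decay hk₂ hk hs (ρ := 1 / x) (by positivity)
    (by rw [div_le_one hx0]; exact hx.le)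
  have heq := h.eq
  have hs2 := sq_of_sign hs
  have h1 : (1 - (1 / x) ^ 2) * x ^ 2 = x ^ 2 - 1 := by field_simp
  unfold IsSemiInfiniteRoot
  linear_combination (-(x ^ 2 * k₂ ^ 2)) * heq +
    (-(k₂ ^ 2 * (k₁ + s * k₂ * decay k₁ k₂ s (1 / x)))) * h1 +
    (x ^ 2 * k₂ ^ 2 * k₁ * decay k₁ k₂ s (1 / x) ^ 2) * hs2

theorem eventually_pow_mul_lt {r : ℝ} (hr0 : 0 < r) (hr1 : r < 1) (M : ℝ) {ε : ℝ} (hε : 0 < ε) :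
    ∀ᶠ n : ℕ in atTop, r ^ (2 * n) * M < ε := by
  have h1 : Tendsto (fun n : ℕ => r ^ (2 * n) * M) atTop (𝓝 (0 * M)) := by
    refine Tendsto.mul_const M ?_
    simp only [pow_mul]
    exact tendsto_pow_atTop_nhds_zero_of_lt_one (by positivity) (by nlinarith)
  rw [zero_mul] at h1
  exact h1.eventually_lt_const hε

/-- The relative error of t against t′ is at most (C/b)r^(2n). Raised to the power 2n it costs a
factor at most exp(2n(C/b)r^(2n)), which is eventually below e since n r^(2n) → 0. -/
theorem eventually_pow_le_mul_pow {r : ℝ} (hr0 : 0 < r) (hr1 : r < 1) {C b : ℝ} (hC : 0 ≤ C)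
    (hb : 0 < b) :
    ∀ᶠ n : ℕ in atTop, ∀ t t' : ℝ, 0 < t → t ≤ r → b ≤ t' → |t - t'| ≤ C * t ^ (2 * n) →
      t ^ (2 * n) ≤ Real.exp 1 * t' ^ (2 * n) := by
  have h1 : Tendsto (fun n : ℕ => (n : ℝ) * (r ^ 2) ^ n * (2 * (C / b))) atTop
      (𝓝 (0 * (2 * (C / b)))) :=
    Tendsto.mul_const _ (tendsto_self_mul_const_pow_of_lt_one (by positivity) (by nlinarith))
  rw [zero_mul] at h1
  filter_upwards [h1.eventually_lt_const zero_lt_one] with n hn t t' ht htr hbt hle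
  have ht' : 0 < t' := hb.trans_le hbt
  have htn : t ^ (2 * n) ≤ (r ^ 2) ^ n := by
    rw [← pow_mul]; exact pow_le_pow_left₀ ht.le htr _
  have hstep : t ≤ t' * (1 + C / b * (r ^ 2) ^ n) := by
    have h2 := (abs_le.1 hle).2
    have h3 : C * t ^ (2 * n) ≤ t' * (C / b * (r ^ 2) ^ n) := by
      calc C * t ^ (2 * n) ≤ C * (r ^ 2) ^ n := mul_le_mul_of_nonneg_left htn hC
        _ = b * (C / b * (r ^ 2) ^ n) := by field_simp
        _ ≤ _ := mul_le_mul_of_nonneg_right hbt (by positivity)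
    linarith
  calc t ^ (2 * n) ≤ (t' * (1 + C / b * (r ^ 2) ^ n)) ^ (2 * n) := pow_le_pow_left₀ ht.le hstep _
    _ = (1 + C / b * (r ^ 2) ^ n) ^ (2 * n) * t' ^ (2 * n) := by rw [mul_pow, mul_comm]
    _ ≤ Real.exp 1 * t' ^ (2 * n) := by
        refine mul_le_mul_of_nonneg_right ?_ (by positivity)
        have h4 : 1 + C / b * (r ^ 2) ^ n ≤ Real.exp (C / b * (r ^ 2) ^ n) := by
          have := Real.add_one_le_exp (C / b * (r ^ 2) ^ n)
          linarith
        refine (pow_le_pow_left₀ (by positivity) h4 _).trans ?_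
        rw [← Real.exp_nat_mul, Real.exp_le_exp]
        push_cast
        linarith

/-- The window of amplitude ratios around that of the edge state of the semi-infinite chain. -/
theorem exists_window (hk₂ : 0 < k₂) (hk : k₂ < k₁) {K δ ε₀ : ℝ} (hδ : 0 < δ) (hK : 0 < K)
    (hε₀ : 0 < ε₀) :
    ∃ ε r, 0 < ε ∧ ε * K < 1 ∧ ε ≤ ε₀ ∧ 0 < r ∧ r < 1 ∧ ∀ x, 1 + δ ≤ x → x ≤ K →
      0 < 1 / x - ε ∧ 1 / x + ε ≤ 1 ∧
      ∀ s ρ t, IsParam k₁ k₂ s ρ t → |ρ - 1 / x| ≤ ε → t ≤ r := by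
  obtain ⟨r, hr0, hr1, hr⟩ := exists_t_le hk₂ hk (c := δ / (2 * (1 + δ))) (by positivity)
  -- The term 1/(2K) keeps the window away from ρ = 0, and δ/(2(1 + δ)), half of 1 − 1/(1 + δ),
  -- keeps it away from ρ = 1.
  refine ⟨min ε₀ (min (1 / (2 * K)) (δ / (2 * (1 + δ)))), r, by positivity, ?_, min_le_left _ _, hr0,
    hr1, fun x hx hxK => ?_⟩
  · refine lt_of_le_of_lt (mul_le_mul_of_nonneg_right
      ((min_le_right _ _).trans (min_le_left _ _)) hK.le) ?_
    have : 1 / (2 * K) * K = 1 / 2 := by field_simp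
    rw [this]; norm_num
  have m1 := (min_le_right ε₀ (min (1 / (2 * K)) (δ / (2 * (1 + δ))))).trans (min_le_left _ _)
  have m2 := (min_le_right ε₀ (min (1 / (2 * K)) (δ / (2 * (1 + δ))))).trans (min_le_right _ _)
  generalize min ε₀ (min (1 / (2 * K)) (δ / (2 * (1 + δ)))) = ε at *
  have hx0 : 0 < x := by linarith
  have h1 : 1 / K ≤ 1 / x := one_div_le_one_div_of_le hx0 hxK
  have h2 : 1 / x ≤ 1 / (1 + δ) := one_div_le_one_div_of_le (by linarith) hx
  have h3 : 1 / (2 * K) = 1 / K / 2 := by field_simp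
  have h4 : 0 < 1 / K := by positivity
  have h5 : 1 / (1 + δ) = 1 - 2 * (δ / (2 * (1 + δ))) := by field_simp; ring
  have h6 : 0 < δ / (2 * (1 + δ)) := by positivity
  refine ⟨by linarith, by linarith, fun s ρ t h hρ => hr s ρ t h ?_⟩
  have := (abs_le.1 hρ).2
  linarith

theorem continuous_secular (k₁ k₂ s x₁ x₂ : ℝ) (n : ℕ) :
    Continuous fun ρ => (1 - x₁ * ρ) * (1 - x₂ * ρ) -
      decay k₁ k₂ s ρ ^ (2 * n) * ((x₁ - ρ) * (x₂ - ρ)) := by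
  have := continuous_decay k₁ k₂ s
  fun_prop

/-- Edge states at the left end if the two end springs are different. -/
theorem exists_left_edge_root (hk₂ : 0 < k₂) (hk : k₂ < k₁) {K δ : ℝ} (hδ : 0 < δ) (hK : 0 < K) :
    ∃ ε c C r, 0 < ε ∧ ε * K < 1 ∧ 0 < c ∧ 0 < r ∧ r < 1 ∧ ∀ᶠ n : ℕ in atTop, ∀ s x₁ x₂ : ℝ,
      (s = 1 ∨ s = -1) → 1 + δ ≤ x₁ → x₁ ≤ K → |x₂| ≤ K → δ ≤ |x₁ - x₂| →
      (∃ ρ t, IsParam k₁ k₂ s ρ t ∧ t = decay k₁ k₂ s ρ ∧ t ≤ r ∧ |ρ - 1 / x₁| ≤ ε ∧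
        (1 - x₁ * ρ) * (1 - x₂ * ρ) = t ^ (2 * n) * ((x₁ - ρ) * (x₂ - ρ)) ∧
        c ≤ |1 - x₂ * ρ| ∧
        |t - decay k₁ k₂ s (1 / x₁)| ≤ C * decay k₁ k₂ s (1 / x₁) ^ (2 * n)) ∧
      {E | HasState k₁ k₂ (x₁ * k₂) (x₂ * k₂) n E ∧ ∃ ρ ∈ Set.Icc (1 / x₁ - ε) (1 / x₁ + ε),
        E = energy k₁ k₂ s s ρ (decay k₁ k₂ s ρ)}.encard ≤ 1 := by
  obtain ⟨ε, r, hε, hεK, hε1, hr0, hr1, hwin⟩ := exists_window hk₂ hk hδ hK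
    (ε₀ := δ / (2 * K ^ 2)) (by positivity)
  -- At ρ = 1/x₁ the factor |1 − x₂ρ| is |x₁ − x₂|/x₁ ≥ δ/K = 2c, and it varies by at most K·δ/(2K²)
  -- = c over the window.
  set c := δ / (2 * K) with hc
  have hc0 : 0 < c := by positivity
  set M := K * (K + 1) / c with hM
  have hM0 : 0 < M := by positivity
  have hL := decayLip_pos hk₂ hk
  have hk₁ := hk₂.trans hk
  refine ⟨ε, c, decayLip k₁ k₂ * M * Real.exp 1, r, hε, hεK, hc0, hr0, hr1, ?_⟩
  filter_upwards [eventually_pow_mul_lt hr0 hr1 M hε, eventually_pow_mul_lt hr0 hr1 (K + 1) hc0,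
    eventually_pow_le_mul_pow hr0 hr1 (C := decayLip k₁ k₂ * M)
      (b := k₁ / (k₁ + k₂) * (1 / K) ^ 2) (by positivity) (by positivity)]
    with n hn1 hn2 hn3 s x₁ x₂ hs hx₁ hx₁K hx₂K hx
  have hx0 : 0 < x₁ := by linarith
  obtain ⟨hlo, hhi, hwin⟩ := hwin x₁ hx₁ hx₁K
  have hpar : ∀ ρ ∈ Set.Icc (1 / x₁ - ε) (1 / x₁ + ε), IsParam k₁ k₂ s ρ (decay k₁ k₂ s ρ) :=
    fun ρ hρ => isParam_decay hk₂ hk hs (hlo.trans_le hρ.1) (hρ.2.trans hhi)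
  have habs : ∀ ρ ∈ Set.Icc (1 / x₁ - ε) (1 / x₁ + ε), |ρ - 1 / x₁| ≤ ε := fun ρ hρ =>
    abs_le.2 ⟨by linarith [hρ.1], by linarith [hρ.2]⟩
  have hden : ∀ ρ ∈ Set.Icc (1 / x₁ - ε) (1 / x₁ + ε), c ≤ |1 - x₂ * ρ| := by
    intro ρ hρ
    have h1 : 1 - x₂ * ρ = (x₁ - x₂) / x₁ - x₂ * (ρ - 1 / x₁) := by field_simp; ring
    have h2 : 2 * c ≤ |(x₁ - x₂) / x₁| := by
      rw [abs_div, abs_of_pos hx0, le_div_iff₀ hx0, hc]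
      calc 2 * (δ / (2 * K)) * x₁ ≤ 2 * (δ / (2 * K)) * K :=
            mul_le_mul_of_nonneg_left hx₁K (by positivity)
        _ = δ := by field_simp
        _ ≤ _ := hx
    have h3 : |x₂ * (ρ - 1 / x₁)| ≤ c := by
      rw [abs_mul]
      calc _ ≤ K * (δ / (2 * K ^ 2)) :=
            mul_le_mul hx₂K ((habs ρ hρ).trans hε1) (abs_nonneg _) hK.le
        _ = c := by rw [hc]; field_simp
    rw [h1]
    have := abs_sub_abs_le_abs_sub ((x₁ - x₂) / x₁) (x₂ * (ρ - 1 / x₁))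
    linarith
  have hpow : ∀ ρ ∈ Set.Icc (1 / x₁ - ε) (1 / x₁ + ε),
      decay k₁ k₂ s ρ ^ (2 * n) ≤ r ^ (2 * n) := fun ρ hρ =>
    pow_le_pow_left₀ (hpar ρ hρ).t_pos.le (hwin s ρ _ (hpar ρ hρ) (habs ρ hρ)) _
  have hx2ρ : ∀ ρ ∈ Set.Icc (1 / x₁ - ε) (1 / x₁ + ε), |x₂ - ρ| ≤ K + 1 := by
    intro ρ hρ
    refine (abs_sub _ _).trans (add_le_add hx₂K ?_)
    rw [abs_of_nonneg (hpar ρ hρ).ρ_nonneg]; exact (hpar ρ hρ).ρ_le_one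
  have hquot : ∀ ρ ∈ Set.Icc (1 / x₁ - ε) (1 / x₁ + ε),
      |(x₁ - ρ) * (x₂ - ρ) / (1 - x₂ * ρ)| ≤ M := by
    intro ρ hρ
    have h0 := (hpar ρ hρ).ρ_nonneg
    have h1 := (hpar ρ hρ).ρ_le_one
    rw [abs_div, abs_mul]
    refine div_le_div₀ (by positivity) (mul_le_mul ?_ (hx2ρ ρ hρ) (abs_nonneg _) hK.le) hc0
      (hden ρ hρ)
    rw [abs_of_nonneg (by linarith)]; linarith
  constructor
  -- Dividing by 1 − x₂ρ leaves the linear function 1 − x₁ρ, perturbed by an exponentially small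
  -- term; it changes sign across the window.
  · have hcont : ContinuousOn (fun ρ => (1 - x₁ * ρ) -
        decay k₁ k₂ s ρ ^ (2 * n) * ((x₁ - ρ) * (x₂ - ρ) / (1 - x₂ * ρ)))
        (Set.Icc (1 / x₁ - ε) (1 / x₁ + ε)) := by
      have := continuous_decay k₁ k₂ s
      refine ContinuousOn.sub (by fun_prop) (ContinuousOn.mul (by fun_prop)
        (ContinuousOn.div (by fun_prop) (by fun_prop) fun ρ hρ => ?_))
      exact abs_pos.1 (hc0.trans_le (hden ρ hρ))
    have hsmall : ∀ ρ ∈ Set.Icc (1 / x₁ - ε) (1 / x₁ + ε),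
        |decay k₁ k₂ s ρ ^ (2 * n) * ((x₁ - ρ) * (x₂ - ρ) / (1 - x₂ * ρ))| ≤
          decay k₁ k₂ s ρ ^ (2 * n) * M := by
      intro ρ hρ
      rw [abs_mul, abs_of_nonneg (pow_nonneg (hpar ρ hρ).t_pos.le _)]
      exact mul_le_mul_of_nonneg_left (hquot ρ hρ) (pow_nonneg (hpar ρ hρ).t_pos.le _)
    have hsmall' : ∀ ρ ∈ Set.Icc (1 / x₁ - ε) (1 / x₁ + ε),
        |decay k₁ k₂ s ρ ^ (2 * n) * ((x₁ - ρ) * (x₂ - ρ) / (1 - x₂ * ρ))| ≤ ε := fun ρ hρ =>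
      (hsmall ρ hρ).trans ((mul_le_mul_of_nonneg_right (hpow ρ hρ) hM0.le).trans hn1.le)
    have hxε : ε ≤ x₁ * ε := by nlinarith
    have e1 : 1 - x₁ * (1 / x₁ - ε) = x₁ * ε := by field_simp; ring
    have e2 : 1 - x₁ * (1 / x₁ + ε) = -(x₁ * ε) := by field_simp; ring
    have hlohi : 1 / x₁ - ε ≤ 1 / x₁ + ε := by linarith
    obtain ⟨ρ, hρ, hz⟩ := intermediate_value_Icc' hlohi hcont (show (0 : ℝ) ∈ _ from by
      constructor
      · have := (abs_le.1 (hsmall' _ (Set.right_mem_Icc.2 hlohi))).1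
        simp only [e2]; linarith
      · have := (abs_le.1 (hsmall' _ (Set.left_mem_Icc.2 hlohi))).2
        simp only [e1]; linarith)
    simp only at hz
    have hp := hpar ρ hρ
    have hne : 1 - x₂ * ρ ≠ 0 := abs_pos.1 (hc0.trans_le (hden ρ hρ))
    have hdiff : |ρ - 1 / x₁| ≤ M * decay k₁ k₂ s ρ ^ (2 * n) := by
      have h1 : ρ - 1 / x₁ = -(1 - x₁ * ρ) / x₁ := by field_simp; ring
      have h2 := hsmall ρ hρ
      rw [← sub_eq_zero.1 hz] at h2
      rw [h1, abs_div, abs_neg, abs_of_pos hx0, div_le_iff₀ hx0]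
      have h3 : 0 ≤ M * decay k₁ k₂ s ρ ^ (2 * n) := mul_nonneg hM0.le (pow_nonneg hp.t_pos.le _)
      nlinarith
    have hinv1 : 1 / x₁ ≤ 1 := by linarith
    have hp' := isParam_decay hk₂ hk hs (ρ := 1 / x₁) (by positivity) hinv1
    have hdt : |decay k₁ k₂ s ρ - decay k₁ k₂ s (1 / x₁)| ≤
        decayLip k₁ k₂ * M * decay k₁ k₂ s ρ ^ (2 * n) := by
      rw [mul_assoc]
      exact (hp.abs_sub_le hk₂ hk hp').trans (mul_le_mul_of_nonneg_left hdiff hL.le)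
    refine ⟨ρ, decay k₁ k₂ s ρ, hp, rfl, hwin s ρ _ hp (habs ρ hρ), habs ρ hρ, ?_, hden ρ hρ, ?_⟩
    · have := sub_eq_zero.1 hz
      rw [this, mul_assoc, div_mul_cancel₀ _ hne]
    · refine hdt.trans ?_
      rw [mul_assoc (decayLip k₁ k₂ * M)]
      refine mul_le_mul_of_nonneg_left (hn3 _ _ hp.t_pos (hwin s ρ _ hp (habs ρ hρ)) ?_ hdt)
        (by positivity)
      refine le_trans ?_ (hp'.mul_sq_le_t hk₂ hk)
      refine mul_le_mul_of_nonneg_left ?_ (by positivity)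
      exact pow_le_pow_left₀ (by positivity) (one_div_le_one_div_of_le hx0 hx₁K) 2
  -- With the left spring reset to x₁ = 0 the secular equation would make 1 − x₂ρ exponentially
  -- small, against the bound c.
  · refine (encard_hasState_le hk₂ hk hs hlo (by linarith) hhi (κ₁' := 0) (κ₂' := x₂ * k₂)
      fun ρ hρ hst => ?_).trans ?_
    · have hp := hpar ρ hρ
      have hss : s * s = 1 := by rw [← sq, sq_of_sign hs]
      have hst' : HasState k₁ k₂ (s * s * 0 * k₂) (s * s * x₂ * k₂) n
          (energy k₁ k₂ s s ρ (decay k₁ k₂ s ρ)) := by simpa [hss] using hst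
      have hsec := hst'.secular hk₂ hk hp hs ((hwin s ρ _ hp (habs ρ hρ)).trans_lt hr1)
      have h1 : |1 - x₂ * ρ| ≤ r ^ (2 * n) * (K + 1) := by
        have : 1 - x₂ * ρ = decay k₁ k₂ s ρ ^ (2 * n) * (-ρ * (x₂ - ρ)) := by
          linear_combination hsec
        rw [this, abs_mul, abs_of_nonneg (pow_nonneg hp.t_pos.le _), abs_mul, abs_neg,
          abs_of_nonneg hp.ρ_nonneg]
        refine mul_le_mul (hpow ρ hρ) ?_ (mul_nonneg hp.ρ_nonneg (abs_nonneg _)) (by positivity)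
        have := hx2ρ ρ hρ
        nlinarith [hp.ρ_le_one, abs_nonneg (x₂ - ρ)]
      linarith [hden ρ hρ]
    · rw [if_pos rfl]
      split_ifs <;> simp

/-- Pairs of edge states if the two end springs are nearly equal. -/
theorem exists_two_sided_root (hk₂ : 0 < k₂) (hk : k₂ < k₁) {K δ : ℝ} (hδ : 0 < δ) (hK : 0 < K) :
    ∃ ε r, 0 < ε ∧ ε * K < 1 ∧ 0 < r ∧ r < 1 ∧ ∀ᶠ n : ℕ in atTop, ∀ s x₁ x₂ : ℝ,
      (s = 1 ∨ s = -1) → 1 + δ ≤ x₁ → x₁ ≤ K → 1 + δ ≤ x₂ → x₂ ≤ K → |x₁ - x₂| ≤ ε / 2 →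
      (∃ ρ ρ', ρ < ρ' ∧ ∀ p, p = ρ ∨ p = ρ' → IsParam k₁ k₂ s p (decay k₁ k₂ s p) ∧
        decay k₁ k₂ s p ≤ r ∧ |p - 1 / x₁| ≤ ε ∧
        (1 - x₁ * p) * (1 - x₂ * p) = decay k₁ k₂ s p ^ (2 * n) * ((x₁ - p) * (x₂ - p))) ∧
      {E | HasState k₁ k₂ (x₁ * k₂) (x₂ * k₂) n E ∧ ∃ ρ ∈ Set.Icc (1 / x₁ - ε) (1 / x₁ + ε),
        E = energy k₁ k₂ s s ρ (decay k₁ k₂ s ρ)}.encard ≤ 2 := by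
  obtain ⟨ε, r, hε, hεK, -, hr0, hr1, hwin⟩ := exists_window hk₂ hk hδ hK (ε₀ := 1) (by positivity)
  refine ⟨ε, r, hε, hεK, hr0, hr1, ?_⟩
  filter_upwards [eventually_pow_mul_lt hr0 hr1 (K ^ 2) (ε := ε ^ 2 / 2) (by positivity),
    eventually_pow_mul_lt hr0 hr1 1 one_pos]
    with n hn1 hn2 s x₁ x₂ hs hx₁ hx₁K hx₂ hx₂K hx
  have hx0 : 0 < x₁ := by linarith
  obtain ⟨hlo, hhi, hwin⟩ := hwin x₁ hx₁ hx₁K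
  have hpar : ∀ ρ ∈ Set.Icc (1 / x₁ - ε) (1 / x₁ + ε), IsParam k₁ k₂ s ρ (decay k₁ k₂ s ρ) :=
    fun ρ hρ => isParam_decay hk₂ hk hs (hlo.trans_le hρ.1) (hρ.2.trans hhi)
  have habs : ∀ ρ ∈ Set.Icc (1 / x₁ - ε) (1 / x₁ + ε), |ρ - 1 / x₁| ≤ ε := fun ρ hρ =>
    abs_le.2 ⟨by linarith [hρ.1], by linarith [hρ.2]⟩
  have hpow : ∀ ρ ∈ Set.Icc (1 / x₁ - ε) (1 / x₁ + ε),
      decay k₁ k₂ s ρ ^ (2 * n) ≤ r ^ (2 * n) := fun ρ hρ =>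
    pow_le_pow_left₀ (hpar ρ hρ).t_pos.le (hwin s ρ _ (hpar ρ hρ) (habs ρ hρ)) _
  constructor
  · have hQ : ∀ ρ ∈ Set.Icc (1 / x₁ - ε) (1 / x₁ + ε),
        decay k₁ k₂ s ρ ^ (2 * n) * ((x₁ - ρ) * (x₂ - ρ)) < ε ^ 2 / 2 := by
      intro ρ hρ
      have h0 := (hpar ρ hρ).ρ_nonneg
      have h1 := (hpar ρ hρ).ρ_le_one
      refine lt_of_le_of_lt (mul_le_mul (hpow ρ hρ) ?_ ?_ (by positivity)) hn1
      · rw [sq]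
        exact mul_le_mul (by linarith) (by linarith) (by linarith) hK.le
      · exact mul_nonneg (by linarith) (by linarith)
    have hcont := continuous_secular k₁ k₂ s x₁ x₂ n
    have hxε : ε ≤ x₁ * ε := by nlinarith
    have e1 : 1 - x₁ * (1 / x₁ - ε) = x₁ * ε := by field_simp; ring
    have e2 : 1 - x₁ * (1 / x₁ + ε) = -(x₁ * ε) := by field_simp; ring
    have m0 : 1 / x₁ ∈ Set.Icc (1 / x₁ - ε) (1 / x₁ + ε) := ⟨by linarith, by linarith⟩
    have m1 : 1 / x₁ - ε ∈ Set.Icc (1 / x₁ - ε) (1 / x₁ + ε) := ⟨by linarith, by linarith⟩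
    have m2 : 1 / x₁ + ε ∈ Set.Icc (1 / x₁ - ε) (1 / x₁ + ε) := ⟨by linarith, by linarith⟩
    obtain ⟨hx1, hx2⟩ := abs_le.1 hx
    -- At ρ = 1/x₁ the left side vanishes and the right side is positive. At the ends of the window
    -- the left side is at least ε·ε/2 and dominates, so there is a root on each side.
    have hmid : (1 - x₁ * (1 / x₁)) * (1 - x₂ * (1 / x₁)) -
        decay k₁ k₂ s (1 / x₁) ^ (2 * n) * ((x₁ - 1 / x₁) * (x₂ - 1 / x₁)) < 0 := by
      have h1 : 1 - x₁ * (1 / x₁) = 0 := by field_simp; ring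
      rw [h1, zero_mul, zero_sub, neg_lt_zero]
      have h2 : 1 / x₁ ≤ 1 := (hpar _ m0).ρ_le_one
      exact mul_pos (pow_pos (hpar _ m0).t_pos _) (mul_pos (by linarith) (by linarith))
    have hleft : 0 < (1 - x₁ * (1 / x₁ - ε)) * (1 - x₂ * (1 / x₁ - ε)) -
        decay k₁ k₂ s (1 / x₁ - ε) ^ (2 * n) * ((x₁ - (1 / x₁ - ε)) * (x₂ - (1 / x₁ - ε))) := by
      have h1 := hQ _ m1
      have h2 : ε / 2 ≤ 1 - x₂ * (1 / x₁ - ε) := by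
        have : 1 - x₂ * (1 / x₁ - ε) = x₁ * ε + (x₁ - x₂) * (1 / x₁ - ε) := by
          linear_combination e1
        rw [this]
        nlinarith [(hpar _ m1).ρ_le_one]
      rw [e1]
      nlinarith
    have hright : 0 < (1 - x₁ * (1 / x₁ + ε)) * (1 - x₂ * (1 / x₁ + ε)) -
        decay k₁ k₂ s (1 / x₁ + ε) ^ (2 * n) * ((x₁ - (1 / x₁ + ε)) * (x₂ - (1 / x₁ + ε))) := by
      have h1 := hQ _ m2
      have h2 : 1 - x₂ * (1 / x₁ + ε) ≤ -(ε / 2) := by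
        have : 1 - x₂ * (1 / x₁ + ε) = -(x₁ * ε) + (x₁ - x₂) * (1 / x₁ + ε) := by
          linear_combination e2
        rw [this]
        nlinarith [(hpar _ m2).ρ_le_one, (hpar _ m2).ρ_nonneg]
      rw [e2]
      nlinarith
    obtain ⟨ρ, hρ, hz⟩ := intermediate_value_Ioo' (show 1 / x₁ - ε ≤ 1 / x₁ by linarith)
      hcont.continuousOn ⟨hmid, hleft⟩
    obtain ⟨ρ', hρ', hz'⟩ := intermediate_value_Ioo (show 1 / x₁ ≤ 1 / x₁ + ε by linarith)
      hcont.continuousOn ⟨hmid, hright⟩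
    refine ⟨ρ, ρ', hρ.2.trans hρ'.1, fun p hp => ?_⟩
    have hmem : p ∈ Set.Icc (1 / x₁ - ε) (1 / x₁ + ε) := by
      rcases hp with rfl | rfl
      · exact ⟨hρ.1.le, by linarith [hρ.2]⟩
      · exact ⟨by linarith [hρ'.1], hρ'.2.le⟩
    refine ⟨hpar p hmem, hwin s p _ (hpar p hmem) (habs p hmem), habs p hmem, ?_⟩
    rcases hp with rfl | rfl
    · exact sub_eq_zero.1 hz
    · exact sub_eq_zero.1 hz'
  -- With both springs reset to 0 the secular equation reads 1 = t^(2n)ρ², which has no solution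
  -- here.
  · refine (encard_hasState_le hk₂ hk hs hlo (by linarith) hhi (κ₁' := 0) (κ₂' := 0)
      fun ρ hρ hst => ?_).trans ?_
    · have hp := hpar ρ hρ
      have hst' : HasState k₁ k₂ (s * s * 0 * k₂) (s * s * 0 * k₂) n
          (energy k₁ k₂ s s ρ (decay k₁ k₂ s ρ)) := by simpa using hst
      have hsec := hst'.secular hk₂ hk hp hs ((hwin s ρ _ hp (habs ρ hρ)).trans_lt hr1)
      have h1 := hpow ρ hρ
      have h2 : 0 < decay k₁ k₂ s ρ ^ (2 * n) := pow_pos hp.t_pos _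
      have h3 : ρ ^ 2 ≤ 1 := by nlinarith [hp.ρ_nonneg, hp.ρ_le_one]
      nlinarith
    · split_ifs <;> norm_num

end

/-! ### Localisation in terms of the amplitudes -/

section
variable {k₁ k₂ s σ ρ t : ℝ}

theorem abs_mul_zpow_mul {a : ℝ} (ha : a ≠ 0) (c : ℝ) (n : ℕ) :
    |c * a ^ (2 - 2 * (n : ℤ))| * |a| ^ (2 * n) = |c| * |a| ^ 2 := by
  rw [abs_mul, abs_zpow, mul_assoc, ← zpow_natCast, ← zpow_add₀ (abs_ne_zero.2 ha),
    ← zpow_natCast]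
  congr 2; push_cast; ring

/-- After mirroring, both sides carry the same factor |a|^(1−n), which cancels. -/
theorem mirror_bound_iff {a σ : ℝ} (ha : a ≠ 0) (hσ : |σ| = 1) (c₁ c₂ C : ℝ) (n : ℕ) :
    |-σ * c₁ * a ^ ((n : ℤ) - 1) * a ^ (2 - 2 * (n : ℤ))| ≤ C * |-σ * c₂ * a ^ (1 - (n : ℤ))| ↔
      |c₁| ≤ C * |c₂| := by
  have h0 : 0 < |a| ^ (1 - (n : ℤ)) := zpow_pos (abs_pos.2 ha) _
  have h1 : |-σ * c₁ * a ^ ((n : ℤ) - 1) * a ^ (2 - 2 * (n : ℤ))| = |c₁| * |a| ^ (1 - (n : ℤ)) := by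
    rw [mul_assoc, ← zpow_add₀ ha, abs_mul, abs_mul, abs_neg, hσ, one_mul, abs_zpow]
    congr 2; ring
  have h2 : |-σ * c₂ * a ^ (1 - (n : ℤ))| = |c₂| * |a| ^ (1 - (n : ℤ)) := by
    rw [abs_mul, abs_mul, abs_neg, hσ, one_mul, abs_zpow]
  rw [h1, h2, ← mul_assoc]
  exact mul_le_mul_iff_of_pos_right h0

theorem isRightEdge_iff {k₃₁ k₃₂ : ℕ → ℝ} {S : Set ℕ} {d : ℕ → WaveData}
    (hd : IsFamily k₁ k₂ k₃₁ k₃₂ S d) :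
    IsRightEdge S d ↔ IsEdge S d ∧ ∃ C : ℝ, ∀ᶠ n in atTop, n ∈ S → |(d n).c₁| ≤ C * |(d n).c₂| := by
  have key : ∀ᶠ n in atTop, n ∈ S → (d n).a ≠ 0 ∧ |(d n).σ| = 1 := by
    filter_upwards [hd] with n hn hS
    obtain ⟨u, -, ha, -, hσ, -⟩ := hn hS
    exact ⟨abs_pos.1 ha, abs_of_sign hσ⟩
  refine and_congr Iff.rfl (exists_congr fun C => ?_)
  constructor <;> intro h <;> filter_upwards [h, key] with n hn hkey hS
  · exact (mirror_bound_iff (hkey hS).1 (hkey hS).2 _ _ C n).1 (hn hS)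
  · exact (mirror_bound_iff (hkey hS).1 (hkey hS).2 _ _ C n).2 (hn hS)

/-- The matching conditions of an eigenstate at the two ends of the chain. -/
theorem IsEigenstate.exists_scaled (hk₂ : 0 < k₂) (hk : k₂ < k₁) {x₁ x₂ : ℝ} {n : ℕ}
    {d : WaveData} (h : IsEigenstate k₁ k₂ (k₂ + x₁ * k₂) (k₂ + x₂ * k₂) n d) :
    0 ≤ d.ω ∧ (d.σ = 1 ∨ d.σ = -1) ∧ (d.c₁ ≠ 0 ∨ d.c₂ ≠ 0) ∧
    ∃ s ρ t, IsParam k₁ k₂ s ρ t ∧ t < 1 ∧ |d.a| = t ∧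
      d.ω ^ 2 - k₁ - k₂ = energy k₁ k₂ s d.σ ρ t ∧
      HasState k₁ k₂ (x₁ * k₂) (x₂ * k₂) n (energy k₁ k₂ s d.σ ρ t) ∧
      (1 - s * d.σ * x₁ * ρ) * (1 - s * d.σ * x₂ * ρ) =
        t ^ (2 * n) * ((s * d.σ * x₁ - ρ) * (s * d.σ * x₂ - ρ)) ∧
      d.c₁ * (1 - s * d.σ * x₁ * ρ) = d.c₂ * t * (s * d.σ * x₁ - ρ) := by
  obtain ⟨h0, hσ, hc, s, ρ, t, hp, ht, ha, hE, hst, hbc⟩ := h.exists_param hk₂ hk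
  have hst' := hst
  rw [sign_mul_scaled hp.sign hσ x₁, sign_mul_scaled hp.sign hσ x₂] at hst'
  rw [add_sub_cancel_left, add_sub_cancel_left] at hst
  refine ⟨h0, hσ, hc, s, ρ, t, hp, ht, ?_, hE, hst, hst'.secular hk₂ hk hp hσ ht,
    (hbc _ _ (sign_mul_scaled hp.sign hσ x₁) (sign_mul_scaled hp.sign hσ x₂)).1⟩
  rw [ha, abs_mul, abs_of_sign hp.sign, one_mul, abs_of_pos hp.t_pos]

/-- With a soft left spring the amplitude at the left end is controlled by that at the right. -/
theorem IsEigenstate.mul_abs_c₁_le (hk₂ : 0 < k₂) (hk : k₂ < k₁) {x₁ x₂ δ : ℝ} (hδ : 0 < δ)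
    {n : ℕ} {d : WaveData} (h : IsEigenstate k₁ k₂ (k₂ + x₁ * k₂) (k₂ + x₂ * k₂) n d)
    (hx₁ : |x₁| ≤ 1 - δ) :
    δ * |d.c₁| ≤ 2 * (|d.c₂| * |d.a|) ∧ d.c₂ ≠ 0 ∧ d.a ≠ 0 := by
  obtain ⟨-, hσ, hc, s, ρ, t, hp, -, ha, -, -, -, hbc⟩ := h.exists_scaled hk₂ hk
  have hx : |s * d.σ * x₁| ≤ 1 - δ := (abs_sign_mul hp.sign hσ x₁).trans_le hx₁
  generalize s * d.σ * x₁ = θ at *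
  have h0 := hp.ρ_nonneg
  have h1 := hp.ρ_le_one
  obtain ⟨hx1, hx2⟩ := abs_le.1 hx
  have h2 : δ ≤ |1 - θ * ρ| := by
    refine le_trans ?_ (le_abs_self _)
    nlinarith
  have h3 : |θ - ρ| ≤ 2 := abs_le.2 ⟨by linarith, by linarith⟩
  have h4 := congrArg abs hbc
  rw [abs_mul, abs_mul, abs_mul d.c₂, abs_of_pos hp.t_pos] at h4
  have h5 : δ * |d.c₁| ≤ 2 * (|d.c₂| * t) := by
    calc δ * |d.c₁| ≤ |d.c₁| * |1 - θ * ρ| := by nlinarith [abs_nonneg d.c₁]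
      _ = _ := h4
      _ ≤ |d.c₂| * t * 2 :=
        mul_le_mul_of_nonneg_left h3 (mul_nonneg (abs_nonneg _) hp.t_pos.le)
      _ = _ := by ring
  refine ⟨by rw [ha]; exact h5, ?_, abs_pos.1 (ha ▸ hp.t_pos)⟩
  intro hc2
  rw [hc2, abs_zero, zero_mul, mul_zero] at h5
  have : |d.c₁| ≤ 0 := by nlinarith [abs_nonneg d.c₁]
  exact hc.elim (fun h => h (abs_nonpos_iff.1 this)) (fun h => h hc2)

/-- The matching condition at a soft left end gives δ|c₁| ≤ 2|c₂||a|. So every family of edge states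
is a right edge family, hence not two-sided; a left edge bound would in addition force |c₂| ≪ |c₂|.
-/
theorem no_left_edge (hk₂ : 0 < k₂) (hk : k₂ < k₁) {x₁ x₂ : ℕ → ℝ} {δ : ℝ} (hδ : 0 < δ)
    (hx₁ : ∀ᶠ n in atTop, |x₁ n| ≤ 1 - δ) {S : Set ℕ} {d : ℕ → WaveData} (hS : S.Infinite)
    (hd : IsFamily k₁ k₂ (fun n => k₂ + x₁ n * k₂) (fun n => k₂ + x₂ n * k₂) S d) :
    ¬ IsLeftEdge S d ∧ ¬ IsTwoSidedEdge S d := by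
  constructor
  · rintro ⟨⟨r, hr, hedge⟩, C, hC⟩
    -- The given bound may fail to be positive; the maximum is a base in (0, 1).
    have hr0 : (0 : ℝ) < max r (1 / 2) := lt_max_of_lt_right (by norm_num)
    have hr1 : max r (1 / 2) < 1 := max_lt hr (by norm_num)
    have hsmall : ∀ᶠ n : ℕ in atTop, max r (1 / 2) ^ n * (2 * |C|) < δ := by
      have h1 : Tendsto (fun n : ℕ => max r (1 / 2) ^ n * (2 * |C|)) atTop (𝓝 (0 * (2 * |C|))) :=
        (tendsto_pow_atTop_nhds_zero_of_lt_one hr0.le hr1).mul_const _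
      rw [zero_mul] at h1
      exact h1.eventually_lt_const hδ
    have hall := hsmall.and (hx₁.and (hd.and (hedge.and (hC.and (eventually_ge_atTop 1)))))
    obtain ⟨n, hnS, hn1, hn2, hn3, hn4, hn5, hn⟩ :=
      ((Nat.frequently_atTop_iff_infinite.2 hS).and_eventually hall).exists
    obtain ⟨h1, hc2, ha⟩ := (hn3 hnS).mul_abs_c₁_le hk₂ hk hδ hn2
    have h2 := abs_mul_zpow_mul ha (d n).c₂ n
    have h3 := hn5 hnS
    have hapos := abs_pos.2 ha
    have hcpos := abs_pos.2 hc2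
    have har : |(d n).a| ≤ max r (1 / 2) := (hn4 hnS).trans (le_max_left _ _)
    have hc1 := abs_nonneg (d n).c₁
    generalize |(d n).a| = A at *
    generalize |(d n).c₂ * (d n).a ^ (2 - 2 * (n : ℤ))| = B at *
    generalize |(d n).c₁| = c₁ at *
    generalize |(d n).c₂| = c₂ at *
    have hpow : A ^ (2 * n) ≤ A * max r (1 / 2) ^ n := by
      rw [two_mul, pow_add]
      refine mul_le_mul ?_ (pow_le_pow_left₀ hapos.le har n) (by positivity) hapos.le
      exact pow_le_of_le_one hapos.le (har.trans hr1.le) (by omega)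
    have h4 : δ * B ≤ |C| * (2 * (c₂ * A)) := by
      have h5 : B ≤ |C| * c₁ := h3.trans (mul_le_mul_of_nonneg_right (le_abs_self C) hc1)
      calc δ * B ≤ δ * (|C| * c₁) := mul_le_mul_of_nonneg_left h5 hδ.le
        _ = |C| * (δ * c₁) := by ring
        _ ≤ _ := mul_le_mul_of_nonneg_left h1 (abs_nonneg C)
    have h5 : δ * (c₂ * A ^ 2) ≤ max r (1 / 2) ^ n * (2 * |C|) * (c₂ * A ^ 2) := by
      calc δ * (c₂ * A ^ 2) = δ * B * A ^ (2 * n) := by rw [mul_assoc, h2]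
        _ ≤ |C| * (2 * (c₂ * A)) * (A * max r (1 / 2) ^ n) :=
          mul_le_mul h4 hpow (by positivity) (by positivity)
        _ = _ := by ring
    exact hn1.not_ge (le_of_mul_le_mul_right h5 (by positivity))
  · rintro ⟨hE, -, hR⟩
    apply hR
    rw [isRightEdge_iff hd]
    refine ⟨hE, 2 / δ, ?_⟩
    filter_upwards [hx₁, hd] with n hn hdn hnS
    obtain ⟨h1, hc2, ha⟩ := (hdn hnS).mul_abs_c₁_le hk₂ hk hδ hn
    obtain ⟨u, -, -, ha1, -⟩ := hdn hnS
    rw [div_mul_eq_mul_div, le_div_iff₀ hδ]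
    nlinarith [abs_nonneg (d n).c₂]

/-- Solutions of the secular equation with decay concentrate at the semi-infinite edge state. -/
theorem eventually_abs_one_sub_lt {K r e : ℝ} (hr0 : 0 < r) (hr1 : r < 1) (he : 0 < e) :
    ∀ᶠ n : ℕ in atTop, ∀ s σ ρ t x₁ x₂ : ℝ, IsParam k₁ k₂ s ρ t → (σ = 1 ∨ σ = -1) → t ≤ r →
      |x₁| ≤ K → |x₂| ≤ K → |x₁ - x₂| ≤ e / 2 →
      (1 - s * σ * x₁ * ρ) * (1 - s * σ * x₂ * ρ) =
        t ^ (2 * n) * ((s * σ * x₁ - ρ) * (s * σ * x₂ - ρ)) → |1 - s * σ * x₁ * ρ| < e := by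
  filter_upwards [eventually_pow_mul_lt hr0 hr1 ((K + 1) ^ 2) (ε := e ^ 2 / 2) (by positivity)]
    with n hn s σ ρ t x₁ x₂ h hσ ht hx₁ hx₂ hx hsec
  -- If |1 − θ₁ρ| ≥ e, then |1 − θ₂ρ| ≥ e/2 because the springs are close, and the product e²/2
  -- exceeds the exponentially small right side.
  by_contra! hlt
  have h0 := h.ρ_nonneg
  have h1 := h.ρ_le_one
  have hK : ∀ x, |x| ≤ K → |s * σ * x - ρ| ≤ K + 1 := by
    intro x hxK
    refine (abs_sub _ _).trans (add_le_add ((abs_sign_mul h.sign hσ x).trans_le hxK) ?_)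
    rw [abs_of_nonneg h0]; exact h1
  have h2 : e / 2 ≤ |1 - s * σ * x₂ * ρ| := by
    have h3 : 1 - s * σ * x₂ * ρ = 1 - s * σ * x₁ * ρ - -(s * σ * (x₁ - x₂)) * ρ := by ring
    have h4 := abs_sub_abs_le_abs_sub (1 - s * σ * x₁ * ρ) (-(s * σ * (x₁ - x₂)) * ρ)
    have h5 : |-(s * σ * (x₁ - x₂)) * ρ| ≤ e / 2 := by
      rw [abs_mul, abs_neg, abs_sign_mul h.sign hσ, abs_of_nonneg h0]
      nlinarith [abs_nonneg (x₁ - x₂)]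
    rw [h3]; linarith
  have h6 := congrArg abs hsec
  rw [abs_mul, abs_mul, abs_of_nonneg (pow_nonneg h.t_pos.le _), abs_mul] at h6
  have h7 : |1 - s * σ * x₁ * ρ| * |1 - s * σ * x₂ * ρ| ≤ r ^ (2 * n) * (K + 1) ^ 2 := by
    rw [h6, sq (K + 1)]
    have hK1 : 0 ≤ K + 1 := (abs_nonneg _).trans (hK x₁ hx₁)
    exact mul_le_mul (pow_le_pow_left₀ h.t_pos.le ht _)
      (mul_le_mul (hK _ hx₁) (hK _ hx₂) (abs_nonneg _) hK1) (by positivity) (by positivity)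
  have h8 : e * (e / 2) ≤ |1 - s * σ * x₁ * ρ| * |1 - s * σ * x₂ * ρ| :=
    mul_le_mul hlt h2 (by positivity) (abs_nonneg _)
  nlinarith

/-- For σ = −s the quantity would be 1 + xρ ≥ 1. -/
theorem sign_eq_of_abs_one_sub_lt {ε x : ℝ} (hs : s = 1 ∨ s = -1) (hσ : σ = 1 ∨ σ = -1)
    (hx : 1 ≤ x) (hρ : 0 ≤ ρ) (h1 : |1 - s * σ * x * ρ| < 1) (hε : |1 - s * σ * x * ρ| < ε) :
    σ = s ∧ |ρ - 1 / x| ≤ ε := by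
  have hxρ : 0 ≤ x * ρ := by positivity
  have hss : σ = s := by
    have := (abs_lt.1 h1).2
    rcases hs with rfl | rfl <;> rcases hσ with rfl | rfl <;> first | rfl | (exfalso; linarith)
  refine ⟨hss, ?_⟩
  subst hss
  have h2 : 1 - σ * σ * x * ρ = -(x * (ρ - 1 / x)) := by
    have : x ≠ 0 := by linarith
    field_simp
    linear_combination (-(x * ρ)) * sq_of_sign hs
  rw [h2, abs_neg, abs_mul, abs_of_pos (by linarith)] at hε
  nlinarith [abs_nonneg (ρ - 1 / x)]

theorem ω_eq_of_energy_eq {ω ω' E : ℝ} (h : 0 ≤ ω) (h' : 0 ≤ ω') (hE : ω ^ 2 - k₁ - k₂ = E)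
    (hE' : ω' ^ 2 - k₁ - k₂ = E) : ω = ω' :=
  (sq_eq_sq₀ h h').1 (by linarith)

theorem energy_neg_lt_energy_pos (hk₂ : 0 < k₂) (hk : k₂ < k₁) {ρ' t' : ℝ}
    (h : IsParam k₁ k₂ (-1) ρ t) (h' : IsParam k₁ k₂ 1 ρ' t') (hρ' : 0 < ρ') :
    energy k₁ k₂ (-1) (-1) ρ t < energy k₁ k₂ 1 1 ρ' t' := by
  have h1 := h.pos hk₂ hk
  have h2 := h'.pos hk₂ hk
  have h3 := h.t_pos
  have h4 := h'.t_pos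
  have h5 : energy k₁ k₂ (-1) (-1) ρ t = -(ρ * (k₁ + -1 * k₂ * t) / t) := by
    unfold energy; ring
  have h6 : 0 ≤ ρ * (k₁ + -1 * k₂ * t) / t := div_nonneg (mul_nonneg h.ρ_nonneg h1.le) h3.le
  have h7 : 0 < energy k₁ k₂ 1 1 ρ' t' := by unfold energy; positivity
  linarith

end

/-! ### The two left edge states -/

section
variable {k₁ k₂ s σ ρ t : ℝ}

theorem abs_sign_mul_sub_le {x K : ℝ} (h : IsParam k₁ k₂ s ρ t) (hσ : σ = 1 ∨ σ = -1)
    (hx : |x| ≤ K) : |s * σ * x - ρ| ≤ K + 1 := by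
  refine (abs_sub _ _).trans (add_le_add ((abs_sign_mul h.sign hσ x).trans_le hx) ?_)
  rw [abs_of_nonneg h.ρ_nonneg]
  exact h.ρ_le_one

theorem energy_mem_window (hk₂ : 0 < k₂) (hk : k₂ < k₁) (h : IsParam k₁ k₂ s ρ t)
    (hσ : σ = 1 ∨ σ = -1) {x₁ ε K κ₁ κ₂ : ℝ} {n : ℕ} (hx : 1 ≤ x₁) (hxK : x₁ ≤ K)
    (hεK : ε * K < 1) (hst : HasState k₁ k₂ κ₁ κ₂ n (energy k₁ k₂ s σ ρ t))
    (h1 : |1 - s * σ * x₁ * ρ| < min 1 ε) :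
    energy k₁ k₂ s σ ρ t ∈ {E | HasState k₁ k₂ κ₁ κ₂ n E ∧
      ∃ ρ ∈ Set.Icc (1 / x₁ - ε) (1 / x₁ + ε), E = energy k₁ k₂ s s ρ (decay k₁ k₂ s ρ)} := by
  obtain ⟨rfl, hρ⟩ := sign_eq_of_abs_one_sub_lt h.sign hσ hx h.ρ_nonneg
    (h1.trans_le (min_le_left _ _)) (h1.trans_le (min_le_right _ _))
  obtain ⟨ha, hb⟩ := abs_le.1 hρ
  refine ⟨hst, ρ, ⟨by linarith, by linarith⟩, ?_⟩
  have hε : 0 ≤ ε := (abs_nonneg _).trans hρ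
  have hx0 : 0 < x₁ := by linarith
  have h2 : ε < 1 / x₁ := by
    rw [lt_div_iff₀ hx0]
    exact (mul_le_mul_of_nonneg_left hxK hε).trans_lt hεK
  rw [← h.eq_decay hk₂ hk (by linarith)]

theorem IsEigenstate.hasState (hk₂ : 0 < k₂) (hk : k₂ < k₁) {x₁ x₂ : ℝ} {n : ℕ}
    {d : WaveData} (h : IsEigenstate k₁ k₂ (k₂ + x₁ * k₂) (k₂ + x₂ * k₂) n d) :
    HasState k₁ k₂ (x₁ * k₂) (x₂ * k₂) n (d.ω ^ 2 - k₁ - k₂) := by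
  obtain ⟨-, -, -, s, ρ, t, -, -, -, hE, hst, -⟩ := h.exists_scaled hk₂ hk
  rwa [hE]

/-- An arbitrary family has no lower bound on its decay rates; one factor A is split off so that it
can be cancelled later. -/
theorem pow_two_mul_le {A R : ℝ} (hA : 0 ≤ A) (hAR : A ≤ R) (hR : R ≤ 1) {n : ℕ} (hn : 1 ≤ n) :
    A ^ (2 * n) ≤ A * R ^ n := by
  rw [two_mul, pow_add]
  exact mul_le_mul (pow_le_of_le_one hA (hAR.trans hR) (by omega)) (pow_le_pow_left₀ hA hAR n)
    (by positivity) hA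

/-- A left edge state is close to a solution of the boundary equation of the semi-infinite chain. -/
theorem abs_one_sub_le_of_left {a c₁ c₂ θ C M R : ℝ} {n : ℕ} (ha : |a| = t) (ht : 0 < t)
    (htR : t ≤ R) (hR : R ≤ 1) (hn : 1 ≤ n) (hc : c₁ ≠ 0 ∨ c₂ ≠ 0)
    (hbc : c₁ * (1 - θ * ρ) = c₂ * t * (θ - ρ)) (hM : |θ - ρ| ≤ M)
    (hleft : |c₂ * a ^ (2 - 2 * (n : ℤ))| ≤ C * |c₁|) :
    |1 - θ * ρ| ≤ R ^ n * (|C| * M) := by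
  have ha0 : a ≠ 0 := abs_pos.1 (ha ▸ ht)
  have h2 := abs_mul_zpow_mul ha0 c₂ n
  have h4 := congrArg abs hbc
  rw [abs_mul, abs_mul, abs_mul c₂, abs_of_pos ht] at h4
  have hM0 : 0 ≤ M := (abs_nonneg _).trans hM
  have h3 : |c₂ * a ^ (2 - 2 * (n : ℤ))| ≤ |C| * |c₁| :=
    hleft.trans (mul_le_mul_of_nonneg_right (le_abs_self C) (abs_nonneg _))
  rw [ha] at h2
  have hpow := pow_two_mul_le ht.le htR hR hn
  have h5 : |c₂| * t ^ 2 ≤ |C| * |c₁| * (t * R ^ n) := by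
    rw [← h2]
    exact mul_le_mul h3 hpow (by positivity) (by positivity)
  have hc1 : 0 < |c₁| := by
    refine abs_pos.2 fun h0 => ?_
    rw [h0, abs_zero, mul_zero, zero_mul] at h5
    have h6 : |c₂| ≤ 0 := by
      by_contra! h7
      have : 0 < |c₂| * t ^ 2 := by positivity
      linarith
    exact hc.elim (fun h => h h0) fun h => h (abs_nonpos_iff.1 h6)
  have h6 : |1 - θ * ρ| * (|c₁| * t) ≤ R ^ n * (|C| * M) * (|c₁| * t) := by
    calc |1 - θ * ρ| * (|c₁| * t) = |c₁| * |1 - θ * ρ| * t := by ring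
      _ = |c₂| * t ^ 2 * |θ - ρ| := by rw [h4]; ring
      _ ≤ |C| * |c₁| * (t * R ^ n) * M := mul_le_mul h5 hM (abs_nonneg _) (by
          have := ht.le.trans htR; positivity)
      _ = _ := by ring
  exact le_of_mul_le_mul_right h6 (by positivity)

/-- The roots of `exists_left_edge_root` for s = −1 and s = 1 give the two states. Conversely, a
left edge state has 1 − θ₁ρ exponentially small, so it falls into the window of one of the two
signs, and that window holds at most one state. -/
theorem exists_two_left_edge (hk₂ : 0 < k₂) (hk : k₂ < k₁) {x₁ x₂ : ℕ → ℝ} {K δ : ℝ} (hδ : 0 < δ)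
    (hK : 0 < K) (hx : ∀ᶠ n in atTop, 1 + δ ≤ x₁ n) (hK₁ : ∀ n, |x₁ n| ≤ K)
    (hK₂ : ∀ n, |x₂ n| ≤ K) (hap : ∀ᶠ n in atTop, δ ≤ |x₁ n - x₂ n|) :
    ∃ (s : Fin 2 → ℕ → WaveData) (ã : Fin 2 → ℕ → ℝ),
      (∀ᶠ n in atTop, -1 < ã 0 n ∧ ã 0 n < 0 ∧ 0 < ã 1 n ∧ ã 1 n < 1 ∧
        ∀ j, IsSemiInfiniteRoot k₁ k₂ (k₂ + x₁ n * k₂) (ã j n)) ∧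
      (∀ j, IsFamily k₁ k₂ (fun n => k₂ + x₁ n * k₂) (fun n => k₂ + x₂ n * k₂) Set.univ (s j) ∧
        IsLeftEdge Set.univ (s j) ∧
        (fun n => (s j n).a - ã j n) =O[atTop] (fun n => ã j n ^ (2 * n))) ∧
      (∀ᶠ n in atTop, (s 0 n).ω ≠ (s 1 n).ω) ∧
      (∀ (S : Set ℕ) (t : ℕ → WaveData), S.Infinite →
        IsFamily k₁ k₂ (fun n => k₂ + x₁ n * k₂) (fun n => k₂ + x₂ n * k₂) S t →
        IsLeftEdge S t → ∀ᶠ n in atTop, n ∈ S → ∃ j, (t n).ω = (s j n).ω) := by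
  obtain ⟨ε, c, C, r, hε, hεK, hc, hr0, hr1, hroot⟩ := exists_left_edge_root hk₂ hk hδ hK
  have hsg : ∀ j, (![-1, 1] : Fin 2 → ℝ) j = 1 ∨ (![-1, 1] : Fin 2 → ℝ) j = -1 := by
    intro j; fin_cases j <;> simp
  have hroot' := (hroot.and (hx.and hap)).mono fun n hn s hs =>
    hn.1 s (x₁ n) (x₂ n) hs hn.2.1 ((le_abs_self _).trans (hK₁ n)) (hK₂ n) hn.2.2
  have hch : ∀ j : Fin 2, ∃ ρ : ℕ → ℝ, ∀ᶠ n in atTop,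
      IsParam k₁ k₂ (![-1, 1] j) (ρ n) (decay k₁ k₂ (![-1, 1] j) (ρ n)) ∧
      decay k₁ k₂ (![-1, 1] j) (ρ n) ≤ r ∧ |ρ n - 1 / x₁ n| ≤ ε ∧
      (1 - x₁ n * ρ n) * (1 - x₂ n * ρ n) =
        decay k₁ k₂ (![-1, 1] j) (ρ n) ^ (2 * n) * ((x₁ n - ρ n) * (x₂ n - ρ n)) ∧
      c ≤ |1 - x₂ n * ρ n| ∧
      |decay k₁ k₂ (![-1, 1] j) (ρ n) - decay k₁ k₂ (![-1, 1] j) (1 / x₁ n)| ≤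
        C * decay k₁ k₂ (![-1, 1] j) (1 / x₁ n) ^ (2 * n) := by
    intro j
    have h : ∀ᶠ n in atTop, ∃ ρ : ℝ,
        IsParam k₁ k₂ (![-1, 1] j) ρ (decay k₁ k₂ (![-1, 1] j) ρ) ∧
        decay k₁ k₂ (![-1, 1] j) ρ ≤ r ∧ |ρ - 1 / x₁ n| ≤ ε ∧
        (1 - x₁ n * ρ) * (1 - x₂ n * ρ) =
          decay k₁ k₂ (![-1, 1] j) ρ ^ (2 * n) * ((x₁ n - ρ) * (x₂ n - ρ)) ∧
        c ≤ |1 - x₂ n * ρ| ∧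
        |decay k₁ k₂ (![-1, 1] j) ρ - decay k₁ k₂ (![-1, 1] j) (1 / x₁ n)| ≤
          C * decay k₁ k₂ (![-1, 1] j) (1 / x₁ n) ^ (2 * n) := by
      filter_upwards [hroot'] with n hn
      obtain ⟨⟨ρ, t, h1, rfl, h2⟩, -⟩ := hn _ (hsg j)
      exact ⟨ρ, h1, h2⟩
    exact h.choice
  choose ρ hρ using hch
  have hρ0 : ∀ j, ∀ᶠ n in atTop, 0 < ρ j n := by
    intro j
    filter_upwards [hρ j, hx] with n hn hxn
    have hx0 : 0 < x₁ n := by linarith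
    have h2 : ε < 1 / x₁ n := by
      rw [lt_div_iff₀ hx0]
      exact (mul_le_mul_of_nonneg_left ((le_abs_self _).trans (hK₁ n)) hε.le).trans_lt hεK
    linarith [(abs_le.1 hn.2.2.1).1]
  have hfam : ∀ j, IsFamily k₁ k₂ (fun n => k₂ + x₁ n * k₂) (fun n => k₂ + x₂ n * k₂) Set.univ
      fun n => edgeState k₁ k₂ (![-1, 1] j) (ρ j n) (decay k₁ k₂ (![-1, 1] j) (ρ j n)) (x₁ n) := by
    intro j
    filter_upwards [hρ j, hx, eventually_gt_atTop 0] with n hn hxn hn0 _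
    exact isEigenstate_edgeState hk₂ hk hn.1 (hn.2.1.trans_lt hr1) hn0 (by linarith)
      (by ring) (by ring) hn.2.2.2.1
  have hsemi : ∀ᶠ n in atTop, ∀ s : ℝ, (s = 1 ∨ s = -1) → 0 < decay k₁ k₂ s (1 / x₁ n) ∧
      decay k₁ k₂ s (1 / x₁ n) < 1 ∧
      IsSemiInfiniteRoot k₁ k₂ (k₂ + x₁ n * k₂) (s * decay k₁ k₂ s (1 / x₁ n)) := by
    filter_upwards [hx] with n hxn s hs
    have hx1 : 1 < x₁ n := by linarith
    have h1 : 1 / x₁ n < 1 := by rw [div_lt_one (by linarith)]; exact hx1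
    have hp := isParam_decay hk₂ hk hs (ρ := 1 / x₁ n) (by positivity) h1.le
    exact ⟨hp.t_pos, hp.t_lt_one hk₂ hk h1, isSemiInfiniteRoot_decay hk₂ hk hs hx1⟩
  refine ⟨fun j n => edgeState k₁ k₂ (![-1, 1] j) (ρ j n) (decay k₁ k₂ (![-1, 1] j) (ρ j n)) (x₁ n),
    fun j n => ![-1, 1] j * decay k₁ k₂ (![-1, 1] j) (1 / x₁ n), ?_, fun j => ⟨hfam j, ⟨⟨r, hr1, ?_⟩,
      (K + 1) / c, ?_⟩, ?_⟩, ?_, ?_⟩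
  · filter_upwards [hsemi] with n hn
    obtain ⟨a1, a2, -⟩ := hn 1 (Or.inl rfl)
    obtain ⟨b1, b2, -⟩ := hn (-1) (Or.inr rfl)
    refine ⟨?_, ?_, ?_, ?_, fun j => (hn _ (hsg j)).2.2⟩ <;>
      simp only [Matrix.cons_val_zero, Matrix.cons_val_one] <;> linarith
  · filter_upwards [hρ j] with n hn _
    change |_ * _| ≤ r
    rw [abs_mul, abs_of_sign (hsg j), one_mul, abs_of_pos hn.1.t_pos]
    exact hn.2.1
  · filter_upwards [hρ j, hx] with n hn hxn _
    obtain ⟨hp, htr, -, hsec, hcn, -⟩ := hn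
    change |(1 - x₁ n * ρ j n) / (decay k₁ k₂ (![-1, 1] j) (ρ j n) * (x₁ n - ρ j n)) *
      (![-1, 1] j * decay k₁ k₂ (![-1, 1] j) (ρ j n)) ^ (2 - 2 * (n : ℤ))| ≤ (K + 1) / c * |(1 : ℝ)|
    have hsj := hsg j
    generalize (![-1, 1] : Fin 2 → ℝ) j = s at *
    generalize decay k₁ k₂ s (ρ j n) = t at *
    generalize ρ j n = ρ at *
    have ht := hp.t_pos
    have hst : |s * t| = t := by rw [abs_mul, abs_of_sign hsj, one_mul, abs_of_pos ht]
    have hxρ : 0 < x₁ n - ρ := by linarith [hp.ρ_le_one]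
    have hd := abs_mul_zpow_mul (abs_pos.1 (hst.symm ▸ ht))
      ((1 - x₁ n * ρ) / (t * (x₁ n - ρ))) n
    rw [hst] at hd
    refine le_of_mul_le_mul_right (a := t ^ (2 * n)) ?_ (by positivity)
    rw [hd, abs_one, mul_one, abs_div, abs_of_pos (mul_pos ht hxρ)]
    have h1 := congrArg abs hsec
    rw [abs_mul, abs_mul, abs_mul (x₁ n - ρ), abs_of_pos hxρ,
      abs_of_nonneg (pow_nonneg ht.le (2 * n))] at h1
    have h2 : |x₂ n - ρ| ≤ K + 1 :=
      (abs_sub _ _).trans (add_le_add (hK₂ n) (by rw [abs_of_nonneg hp.ρ_nonneg]; exact hp.ρ_le_one))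
    have h3 : |1 - x₁ n * ρ| * c ≤ t ^ (2 * n) * ((x₁ n - ρ) * (K + 1)) :=
      calc |1 - x₁ n * ρ| * c ≤ |1 - x₁ n * ρ| * |1 - x₂ n * ρ| :=
            mul_le_mul_of_nonneg_left hcn (abs_nonneg _)
        _ = _ := h1
        _ ≤ _ := mul_le_mul_of_nonneg_left (mul_le_mul_of_nonneg_left h2 hxρ.le) (by positivity)
    rw [div_mul_eq_mul_div, div_le_iff₀ (by positivity), div_mul_eq_mul_div, div_mul_eq_mul_div,
      le_div_iff₀ hc]
    have h4 : |1 - x₁ n * ρ| * c * t ^ 2 ≤ t ^ (2 * n) * ((x₁ n - ρ) * (K + 1)) * t := by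
      refine mul_le_mul h3 ?_ (by positivity) (by positivity)
      have := hp.t_le_one
      nlinarith
    linarith
  · refine Asymptotics.IsBigO.of_bound C ?_
    filter_upwards [hρ j] with n hn
    change ‖![-1, 1] j * _ - ![-1, 1] j * _‖ ≤ C * ‖(![-1, 1] j * _) ^ (2 * n)‖
    rw [← mul_sub, norm_mul, norm_pow, norm_mul, Real.norm_eq_abs, Real.norm_eq_abs,
      Real.norm_eq_abs, abs_of_sign (hsg j), one_mul, one_mul]
    refine hn.2.2.2.2.2.trans_eq ?_
    rw [pow_mul, pow_mul, sq_abs]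
  -- The energy for s = −1 is nonpositive and that for s = 1 is positive.
  · filter_upwards [hρ 0, hρ 1, hρ0 1] with n h0 h1 h2 heq
    have e0 := sq_edgeState_ω hk₂ hk h0.1 (x₁ n)
    have e1 := sq_edgeState_ω hk₂ hk h1.1 (x₁ n)
    have := energy_neg_lt_energy_pos hk₂ hk h0.1 h1.1 h2
    rw [heq] at e0
    exact this.ne (e0.symm.trans e1)
  · rintro S d hS hd ⟨⟨r', hr', hedge⟩, C', hC'⟩
    have hR0 : (0 : ℝ) < max r' (1 / 2) := lt_max_of_lt_right (by norm_num)
    have hR1 : max r' (1 / 2) < 1 := max_lt hr' (by norm_num)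
    have hsmall : ∀ᶠ n : ℕ in atTop, max r' (1 / 2) ^ n * (|C'| * (K + 1)) < min 1 ε := by
      have h1 : Tendsto (fun n : ℕ => max r' (1 / 2) ^ n * (|C'| * (K + 1))) atTop
          (𝓝 (0 * (|C'| * (K + 1)))) :=
        (tendsto_pow_atTop_nhds_zero_of_lt_one hR0.le hR1).mul_const _
      rw [zero_mul] at h1
      exact h1.eventually_lt_const (lt_min one_pos hε)
    filter_upwards [hsmall, hd, hedge, hC', eventually_ge_atTop 1, hx, hroot', eventually_all.2 hρ,
      eventually_all.2 hρ0, eventually_all.2 hfam] with n h1 h2 h3 h4 h5 h6 h7 h8 h9 h10 hnS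
    obtain ⟨h0, hσ, hc0, s, ρ', t, hp, ht1, hat, hE, hst, -, hbc⟩ := (h2 hnS).exists_scaled hk₂ hk
    have hlt := (abs_one_sub_le_of_left hat hp.t_pos
      ((hat.symm.trans_le (h3 hnS)).trans (le_max_left _ _)) hR1.le h5 hc0 hbc
      (abs_sign_mul_sub_le hp hσ (hK₁ n)) (h4 hnS)).trans_lt h1
    have hmem := energy_mem_window hk₂ hk hp hσ (by linarith) ((le_abs_self _).trans (hK₁ n)) hεK
      hst hlt
    have hfin : ∀ j, s = ![-1, 1] j → (d n).ω = (edgeState k₁ k₂ (![-1, 1] j) (ρ j n)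
        (decay k₁ k₂ (![-1, 1] j) (ρ j n)) (x₁ n)).ω := by
      rintro j rfl
      have hst' := (h10 j (Set.mem_univ n)).hasState hk₂ hk
      have hE' := sq_edgeState_ω hk₂ hk (h8 j).1 (x₁ n)
      rw [hE'] at hst'
      obtain ⟨a1, a2⟩ := abs_le.1 (h8 j).2.2.1
      have hmem' := Set.encard_le_one_iff.1 (h7 _ (hsg j)).2 _ _ hmem
        ⟨hst', ρ j n, ⟨by linarith, by linarith⟩, rfl⟩
      exact ω_eq_of_energy_eq h0 (Real.sqrt_nonneg _) hE (hE'.trans hmem'.symm)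
    rcases hp.sign with h | h
    · exact ⟨1, hfin 1 h⟩
    · exact ⟨0, hfin 0 h⟩

end

/-! ### The four two-sided edge states -/

section
variable {k₁ k₂ s σ ρ t : ℝ}

theorem decay_lower_bound (hk₂ : 0 < k₂) (hk : k₂ < k₁) {x₁ K ε : ℝ} (hx₁ : 0 < x₁) (hxK : x₁ ≤ K)
    (hεK : ε * K < 1) (h : IsParam k₁ k₂ s ρ t) (hρ : |ρ - 1 / x₁| ≤ ε) :
    0 < ρ ∧ 0 < k₁ / (k₁ + k₂) * (1 / K - ε) ^ 2 ∧ k₁ / (k₁ + k₂) * (1 / K - ε) ^ 2 ≤ t := by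
  have hk₁ := hk₂.trans hk
  have hK : 0 < K := hx₁.trans_le hxK
  have h1 : 0 < 1 / K - ε := by rw [sub_pos, lt_div_iff₀ hK]; exact hεK
  have h2 := one_div_le_one_div_of_le hx₁ hxK
  have h3 : 1 / K - ε ≤ ρ := by linarith [(abs_le.1 hρ).1]
  exact ⟨by linarith, by positivity, (mul_le_mul_of_nonneg_left (pow_le_pow_left₀ h1.le h3 2)
    (by positivity)).trans (h.mul_sq_le_t hk₂ hk)⟩

theorem tendsto_one_sub {x₁ x₂ ρ t : ℕ → ℝ} {K r : ℝ} (hr0 : 0 < r) (hr1 : r < 1)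
    (hK₁ : ∀ n, |x₁ n| ≤ K) (hK₂ : ∀ n, |x₂ n| ≤ K)
    (hcl : Tendsto (fun n => x₁ n - x₂ n) atTop (𝓝 0))
    (hp : ∀ᶠ n in atTop, IsParam k₁ k₂ s (ρ n) (t n) ∧ t n ≤ r ∧
      (1 - x₁ n * ρ n) * (1 - x₂ n * ρ n) = t n ^ (2 * n) * ((x₁ n - ρ n) * (x₂ n - ρ n))) :
    Tendsto (fun n => 1 - x₁ n * ρ n) atTop (𝓝 0) := by
  refine Metric.tendsto_nhds.2 fun e he => ?_
  filter_upwards [hp, eventually_abs_one_sub_lt (k₁ := k₁) (k₂ := k₂) (K := K) hr0 hr1 he,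
    Metric.tendsto_nhds.1 hcl (e / 2) (by positivity)] with n h1 h2 h3
  rw [Real.dist_eq, sub_zero] at h3 ⊢
  have hss : s * s = 1 := by rw [← sq]; exact sq_of_sign h1.1.sign
  simpa [hss] using h2 s s (ρ n) (t n) (x₁ n) (x₂ n) h1.1 h1.1.sign h1.2.1 (hK₁ n) (hK₂ n) h3.le
    (by simpa [hss] using h1.2.2)

/-- Both 1 − x₁ρ and 1 − x₂ρ tend to 0. Hence c₂ = (1 − x₁ρ)/(t(x₁ − ρ)) → 0, which excludes right
edge states. By the secular equation c₂t^(−2n) = (x₂ − ρ)/(t(1 − x₂ρ)), which is unbounded and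
excludes left edge states. -/
theorem isTwoSidedEdge_edgeState (hk₂ : 0 < k₂) (hk : k₂ < k₁) {x₁ x₂ ρ : ℕ → ℝ} {K δ ε r : ℝ}
    (hδ : 0 < δ) (hr0 : 0 < r) (hr1 : r < 1) (hεK : ε * K < 1)
    (hx₁ : ∀ᶠ n in atTop, 1 + δ ≤ x₁ n) (hx₂ : ∀ᶠ n in atTop, 1 + δ ≤ x₂ n)
    (hK₁ : ∀ n, |x₁ n| ≤ K) (hK₂ : ∀ n, |x₂ n| ≤ K)
    (hcl : Tendsto (fun n => x₁ n - x₂ n) atTop (𝓝 0))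
    (hp : ∀ᶠ n in atTop, IsParam k₁ k₂ s (ρ n) (decay k₁ k₂ s (ρ n)) ∧
      decay k₁ k₂ s (ρ n) ≤ r ∧ |ρ n - 1 / x₁ n| ≤ ε ∧ (1 - x₁ n * ρ n) * (1 - x₂ n * ρ n) =
        decay k₁ k₂ s (ρ n) ^ (2 * n) * ((x₁ n - ρ n) * (x₂ n - ρ n)))
    {d : ℕ → WaveData}
    (hd : d = fun n => edgeState k₁ k₂ s (ρ n) (decay k₁ k₂ s (ρ n)) (x₁ n)) :
    IsFamily k₁ k₂ (fun n => k₂ + x₁ n * k₂) (fun n => k₂ + x₂ n * k₂) Set.univ d ∧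
      IsTwoSidedEdge Set.univ d ∧ (∀ n, (d n).c₁ = 1) ∧
      Tendsto (fun n => |(d n).c₂ * (d n).a ^ (-(2 * (n : ℤ)))|) atTop atTop ∧
      Tendsto (fun n => |(d n).c₂|) atTop (𝓝 0) := by
  have hb : ∀ᶠ n in atTop, 0 < k₁ / (k₁ + k₂) * (1 / K - ε) ^ 2 ∧
      k₁ / (k₁ + k₂) * (1 / K - ε) ^ 2 ≤ decay k₁ k₂ s (ρ n) := by
    filter_upwards [hp, hx₁] with n hn hxn
    exact (decay_lower_bound hk₂ hk (by linarith) ((le_abs_self _).trans (hK₁ n)) hεK hn.1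
      hn.2.2.1).2
  generalize k₁ / (k₁ + k₂) * (1 / K - ε) ^ 2 = b at hb
  have hb0 : 0 < b := hb.exists.choose_spec.1
  have hlim₁ := tendsto_one_sub hr0 hr1 hK₁ hK₂ hcl (hp.mono fun n hn => ⟨hn.1, hn.2.1, hn.2.2.2⟩)
  have hlim₂ := tendsto_one_sub hr0 hr1 hK₂ hK₁ (by simpa using hcl.neg)
    (hp.mono fun n hn => ⟨hn.1, hn.2.1, by linear_combination hn.2.2.2⟩)
  have hc₁ : ∀ n, (d n).c₁ = 1 := fun n => by rw [hd]; rfl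
  have hc₂ : ∀ n, (d n).c₂ = (1 - x₁ n * ρ n) / (decay k₁ k₂ s (ρ n) * (x₁ n - ρ n)) :=
    fun n => by rw [hd]; rfl
  have ha : ∀ᶠ n in atTop, |(d n).a| = decay k₁ k₂ s (ρ n) := by
    filter_upwards [hp] with n hn
    rw [hd]
    change |s * _| = _
    rw [abs_mul, abs_of_sign hn.1.sign, one_mul, abs_of_pos hn.1.t_pos]
  have hfam : IsFamily k₁ k₂ (fun n => k₂ + x₁ n * k₂) (fun n => k₂ + x₂ n * k₂) Set.univ d := by
    filter_upwards [hp, hx₁, eventually_gt_atTop 0] with n hn hxn hn0 _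
    rw [hd]
    exact isEigenstate_edgeState hk₂ hk hn.1 (hn.2.1.trans_lt hr1) hn0 (by linarith)
      (by ring) (by ring) hn.2.2.2
  have hc₂lim : Tendsto (fun n => |(d n).c₂|) atTop (𝓝 0) := by
    have h0 : Tendsto (fun n => |1 - x₁ n * ρ n| * (b * δ)⁻¹) atTop (𝓝 0) := by
      simpa using hlim₁.abs.mul_const (b * δ)⁻¹
    refine squeeze_zero' (Eventually.of_forall fun n => abs_nonneg _) ?_ h0
    filter_upwards [hp, hx₁, hb] with n hn hxn hbn
    have h1 := hn.1.ρ_le_one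
    rw [hc₂, abs_div, div_eq_mul_inv]
    refine mul_le_mul_of_nonneg_left (inv_anti₀ (by positivity) ?_) (abs_nonneg _)
    refine le_trans ?_ (le_abs_self _)
    exact mul_le_mul hbn.2 (by linarith) hδ.le hn.1.t_pos.le
  have hgrow : Tendsto (fun n => |(d n).c₂ * (d n).a ^ (-(2 * (n : ℤ)))|) atTop atTop := by
    -- The right side of the secular equation is positive, so neither factor on the left can vanish.
    have hne : ∀ᶠ n in atTop, 0 < |1 - x₂ n * ρ n| := by
      filter_upwards [hp, hx₁, hx₂] with n hn h1 h2
      have h3 := hn.1.ρ_le_one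
      have h4 := hn.1.t_pos
      have h5 : 0 < (1 - x₁ n * ρ n) * (1 - x₂ n * ρ n) := by
        rw [hn.2.2.2]
        exact mul_pos (by positivity) (mul_pos (by linarith) (by linarith))
      exact abs_pos.2 (right_ne_zero_of_mul h5.ne')
    have h0 : Tendsto (fun n => |1 - x₂ n * ρ n|) atTop (𝓝[>] 0) :=
      tendsto_nhdsWithin_iff.2 ⟨by simpa using hlim₂.abs, hne⟩
    refine tendsto_atTop_mono' atTop ?_ (h0.inv_tendsto_nhdsGT_zero.const_mul_atTop hδ)
    filter_upwards [hp, hx₁, hx₂, hne, ha] with n hn h1 h2 h3 h4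
    obtain ⟨hpar, -, -, hsec⟩ := hn
    have h5 := hpar.ρ_le_one
    have ht := hpar.t_pos
    have ht1 := hpar.t_le_one
    have hx1 : 0 < x₁ n - ρ n := by linarith
    have hx2 : δ ≤ x₂ n - ρ n := by linarith
    have hsec' := congrArg abs hsec
    rw [abs_mul, abs_mul, abs_mul (x₁ n - ρ n), abs_of_pos hx1, abs_of_nonneg (hδ.le.trans hx2),
      abs_of_nonneg (pow_nonneg ht.le (2 * n))] at hsec'
    rw [Pi.inv_apply, abs_mul, abs_zpow, h4, hc₂, abs_div, abs_of_pos (mul_pos ht hx1), zpow_neg,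
      ← div_eq_mul_inv, ← div_eq_mul_inv, div_le_iff₀ h3, div_mul_eq_mul_div, div_mul_eq_mul_div,
      div_div, hsec', le_div_iff₀ (by positivity)]
    have h6 : (decay k₁ k₂ s (ρ n)) ^ (2 * (n : ℤ)) = decay k₁ k₂ s (ρ n) ^ (2 * n) := by
      rw [← zpow_natCast]; norm_cast
    have hx20 : 0 ≤ x₂ n - ρ n := hδ.le.trans hx2
    rw [h6]
    calc δ * (decay k₁ k₂ s (ρ n) * (x₁ n - ρ n) * decay k₁ k₂ s (ρ n) ^ (2 * n))
        ≤ (x₂ n - ρ n) * (1 * (x₁ n - ρ n) * decay k₁ k₂ s (ρ n) ^ (2 * n)) := by gcongr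
      _ = _ := by ring
  have hedge : IsEdge Set.univ d := by
    refine ⟨r, hr1, ?_⟩
    filter_upwards [hp, ha] with n hn han _
    rw [han]; exact hn.2.1
  refine ⟨hfam, ⟨hedge, ?_, ?_⟩, hc₁, hgrow, hc₂lim⟩
  · rintro ⟨-, C, hC⟩
    obtain ⟨n, h1, h2, h3, h4⟩ :=
      ((hgrow.eventually_gt_atTop (C / b ^ 2)).and (hC.and (ha.and hb))).exists
    have h5 := h2 (Set.mem_univ n)
    have ha0 : (d n).a ≠ 0 := abs_pos.1 (h3 ▸ hb0.trans_le h4.2)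
    rw [hc₁, abs_one, mul_one, show (2 : ℤ) - 2 * n = -(2 * n) + 2 by ring, zpow_add₀ ha0,
      ← mul_assoc, abs_mul, abs_zpow _ 2, h3] at h5
    rw [div_lt_iff₀ (by positivity)] at h1
    have h6 : b ^ 2 ≤ decay k₁ k₂ s (ρ n) ^ (2 : ℤ) := by
      norm_cast
      exact pow_le_pow_left₀ hb0.le h4.2 2
    have := mul_le_mul_of_nonneg_left h6 (abs_nonneg ((d n).c₂ * (d n).a ^ (-(2 * (n : ℤ)))))
    linarith
  · rw [isRightEdge_iff hfam]
    rintro ⟨-, C, hC⟩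
    have h0 : Tendsto (fun n => C * |(d n).c₂|) atTop (𝓝 0) := by simpa using hc₂lim.const_mul C
    obtain ⟨n, h1, h2⟩ := ((h0.eventually_lt_const one_pos).and hC).exists
    have := h2 (Set.mem_univ n)
    rw [hc₁, abs_one] at this
    linarith

theorem eq_or_eq_of_encard_le_two {α : Type*} {A : Set α} (h : A.encard ≤ 2) {a b c : α}
    (ha : a ∈ A) (hb : b ∈ A) (hc : c ∈ A) (hab : a ≠ b) : c = a ∨ c = b := by
  by_contra! hne
  have h1 : ({c, a, b} : Set α).encard ≤ 2 :=
    (Set.encard_le_encard (by rintro x (rfl | rfl | rfl) <;> assumption)).trans h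
  rw [Set.encard_insert_of_notMem (by simp [hne.1, hne.2]), Set.encard_pair hab] at h1
  norm_num at h1

theorem exists_four_two_sided_edge (hk₂ : 0 < k₂) (hk : k₂ < k₁) {x₁ x₂ : ℕ → ℝ} {K δ : ℝ}
    (hδ : 0 < δ) (hK : 0 < K) (hx₁ : ∀ᶠ n in atTop, 1 + δ ≤ x₁ n)
    (hx₂ : ∀ᶠ n in atTop, 1 + δ ≤ x₂ n) (hK₁ : ∀ n, |x₁ n| ≤ K)
    (hK₂ : ∀ n, |x₂ n| ≤ K) (hcl : Tendsto (fun n => x₁ n - x₂ n) atTop (𝓝 0)) :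
    ∃ s : Fin 4 → ℕ → WaveData,
      (∀ j, IsFamily k₁ k₂ (fun n => k₂ + x₁ n * k₂) (fun n => k₂ + x₂ n * k₂) Set.univ (s j) ∧
        IsTwoSidedEdge Set.univ (s j) ∧ (∀ n, (s j n).c₁ = 1) ∧
        Tendsto (fun n => |(s j n).c₂ * (s j n).a ^ (-(2 * (n : ℤ)))|) atTop atTop ∧
        Tendsto (fun n => |(s j n).c₂|) atTop (𝓝 0)) ∧
      (∀ᶠ n in atTop, Function.Injective fun j => (s j n).ω) ∧
      (∀ (S : Set ℕ) (t : ℕ → WaveData), S.Infinite →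
        IsFamily k₁ k₂ (fun n => k₂ + x₁ n * k₂) (fun n => k₂ + x₂ n * k₂) S t →
        IsTwoSidedEdge S t → ∀ᶠ n in atTop, n ∈ S → ∃ j, (t n).ω = (s j n).ω) := by
  obtain ⟨ε, r, hε, hεK, hr0, hr1, hroot⟩ := exists_two_sided_root hk₂ hk hδ hK
  have hsg : ∀ j, (![-1, 1] : Fin 2 → ℝ) j = 1 ∨ (![-1, 1] : Fin 2 → ℝ) j = -1 := by
    intro j; fin_cases j <;> simp
  have hclose : ∀ e : ℝ, 0 < e → ∀ᶠ n in atTop, |x₁ n - x₂ n| ≤ e := fun e he => by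
    filter_upwards [Metric.tendsto_nhds.1 hcl e he] with n hn
    rw [Real.dist_eq, sub_zero] at hn
    exact hn.le
  have hroot' := (hroot.and (hx₁.and (hx₂.and (hclose (ε / 2) (by positivity))))).mono
    fun n hn s hs => hn.1 s (x₁ n) (x₂ n) hs hn.2.1 ((le_abs_self _).trans (hK₁ n)) hn.2.2.1
      ((le_abs_self _).trans (hK₂ n)) hn.2.2.2
  have hch : ∀ i : Fin 2, ∃ q : ℕ → Fin 2 → ℝ, ∀ᶠ n in atTop, q n 0 < q n 1 ∧
      ∀ l, IsParam k₁ k₂ (![-1, 1] i) (q n l) (decay k₁ k₂ (![-1, 1] i) (q n l)) ∧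
        decay k₁ k₂ (![-1, 1] i) (q n l) ≤ r ∧ |q n l - 1 / x₁ n| ≤ ε ∧
        (1 - x₁ n * q n l) * (1 - x₂ n * q n l) =
          decay k₁ k₂ (![-1, 1] i) (q n l) ^ (2 * n) * ((x₁ n - q n l) * (x₂ n - q n l)) := by
    intro i
    have h : ∀ᶠ n in atTop, ∃ q : Fin 2 → ℝ, q 0 < q 1 ∧
        ∀ l, IsParam k₁ k₂ (![-1, 1] i) (q l) (decay k₁ k₂ (![-1, 1] i) (q l)) ∧
          decay k₁ k₂ (![-1, 1] i) (q l) ≤ r ∧ |q l - 1 / x₁ n| ≤ ε ∧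
          (1 - x₁ n * q l) * (1 - x₂ n * q l) =
            decay k₁ k₂ (![-1, 1] i) (q l) ^ (2 * n) * ((x₁ n - q l) * (x₂ n - q l)) := by
      filter_upwards [hroot'] with n hn
      obtain ⟨⟨ρ, ρ', h1, h2⟩, -⟩ := hn _ (hsg i)
      exact ⟨![ρ, ρ'], h1, Fin.forall_fin_two.2 ⟨h2 ρ (Or.inl rfl), h2 ρ' (Or.inr rfl)⟩⟩
    exact h.choice
  choose q hq using hch
  have hmain := fun i l => isTwoSidedEdge_edgeState hk₂ hk hδ hr0 hr1 hεK hx₁ hx₂ hK₁ hK₂ hcl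
    ((hq i).mono fun n hn => hn.2 l) rfl
  have hpos : ∀ᶠ n in atTop, ∀ i l, 0 < q i n l := by
    filter_upwards [hx₁, eventually_all.2 hq] with n hxn hn i l
    exact (decay_lower_bound hk₂ hk (by linarith) ((le_abs_self _).trans (hK₁ n)) hεK
      ((hn i).2 l).1 ((hn i).2 l).2.2.1).1
  have hEne : ∀ᶠ n in atTop, ∀ i,
      energy k₁ k₂ (![-1, 1] i) (![-1, 1] i) (q i n 0) (decay k₁ k₂ (![-1, 1] i) (q i n 0)) ≠
      energy k₁ k₂ (![-1, 1] i) (![-1, 1] i) (q i n 1) (decay k₁ k₂ (![-1, 1] i) (q i n 1)) := by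
    filter_upwards [eventually_all.2 hq] with n hn i heq
    exact (hn i).1.ne (((hn i).2 0).1.energy_inj hk₂ hk ((hn i).2 1).1
      (((hn i).2 0).2.1.trans_lt hr1) (hsg i) heq).2
  -- A state is labelled by the sign s and by one of the two roots in the window of s.
  let e : Fin 4 ≃ Fin 2 × Fin 2 := (finProdFinEquiv (m := 2) (n := 2)).symm
  refine ⟨fun j n => edgeState k₁ k₂ (![-1, 1] (e j).1) (q (e j).1 n (e j).2)
    (decay k₁ k₂ (![-1, 1] (e j).1) (q (e j).1 n (e j).2)) (x₁ n),
    fun j => hmain (e j).1 (e j).2, ?_, ?_⟩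
  · filter_upwards [eventually_all.2 hq, hEne, hpos] with n hn hne hpn
    have hω := fun i l => sq_edgeState_ω hk₂ hk ((hn i).2 l).1 (x₁ n)
    have hinj : Function.Injective fun p : Fin 2 × Fin 2 => (edgeState k₁ k₂ (![-1, 1] p.1)
        (q p.1 n p.2) (decay k₁ k₂ (![-1, 1] p.1) (q p.1 n p.2)) (x₁ n)).ω := by
      rintro ⟨i, l⟩ ⟨i', l'⟩ heq
      have hE := hω i l
      dsimp only at heq
      rw [heq, hω i' l'] at hE
      have hcross := fun l l' => energy_neg_lt_energy_pos hk₂ hk ((hn 0).2 l).1 ((hn 1).2 l').1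
        (hpn 1 l')
      have hi : i = i' := by
        fin_cases i <;> fin_cases i'
        · rfl
        · exact absurd hE (hcross l l').ne'
        · exact absurd hE (hcross l' l).ne
        · rfl
      subst hi
      have hl : l = l' := by
        fin_cases l <;> fin_cases l'
        · rfl
        · exact absurd hE.symm (hne i)
        · exact absurd hE (hne i)
        · rfl
      rw [hl]
    exact hinj.comp e.injective
  · rintro S d hS hd ⟨⟨r', hr', hedge⟩, -⟩
    have hR0 : (0 : ℝ) < max r' (1 / 2) := lt_max_of_lt_right (by norm_num)
    have hR1 : max r' (1 / 2) < 1 := max_lt hr' (by norm_num)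
    have hmin : 0 < min 1 ε := lt_min one_pos hε
    filter_upwards [eventually_abs_one_sub_lt (k₁ := k₁) (k₂ := k₂) (K := K) hR0 hR1 hmin,
      hclose (min 1 ε / 2) (by positivity), hd, hedge, hx₁, hroot', eventually_all.2 hq, hEne,
      eventually_all.2 fun i => eventually_all.2 fun l => (hmain i l).1]
      with n h1 h2 h3 h4 h5 h6 h7 h8 h9 hnS
    obtain ⟨h0, hσ, hc0, s, ρ, t, hp, ht1, hat, hE, hst, hsec, -⟩ :=
      (h3 hnS).exists_scaled hk₂ hk
    have hlt := h1 _ _ _ _ _ _ hp hσ ((hat.symm.trans_le (h4 hnS)).trans (le_max_left _ _))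
      (hK₁ n) (hK₂ n) h2 hsec
    have hmem := energy_mem_window hk₂ hk hp hσ (by linarith) ((le_abs_self _).trans (hK₁ n)) hεK
      hst hlt
    have hfin : ∀ i, s = ![-1, 1] i → ∃ l, (d n).ω = (edgeState k₁ k₂ (![-1, 1] i) (q i n l)
        (decay k₁ k₂ (![-1, 1] i) (q i n l)) (x₁ n)).ω := by
      rintro i rfl
      have hE' := fun l => sq_edgeState_ω hk₂ hk ((h7 i).2 l).1 (x₁ n)
      have hwin : ∀ l, energy k₁ k₂ (![-1, 1] i) (![-1, 1] i) (q i n l)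
          (decay k₁ k₂ (![-1, 1] i) (q i n l)) ∈ {E | HasState k₁ k₂ (x₁ n * k₂) (x₂ n * k₂) n E ∧
          ∃ ρ ∈ Set.Icc (1 / x₁ n - ε) (1 / x₁ n + ε),
            E = energy k₁ k₂ (![-1, 1] i) (![-1, 1] i) ρ (decay k₁ k₂ (![-1, 1] i) ρ)} := by
        intro l
        have hst' := (h9 i l (Set.mem_univ n)).hasState hk₂ hk
        rw [hE' l] at hst'
        obtain ⟨a1, a2⟩ := abs_le.1 ((h7 i).2 l).2.2.1
        exact ⟨hst', q i n l, ⟨by linarith, by linarith⟩, rfl⟩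
      rcases eq_or_eq_of_encard_le_two (h6 _ (hsg i)).2 (hwin 0) (hwin 1) hmem (h8 i) with h | h
      · exact ⟨0, ω_eq_of_energy_eq h0 (Real.sqrt_nonneg _) hE ((hE' 0).trans h.symm)⟩
      · exact ⟨1, ω_eq_of_energy_eq h0 (Real.sqrt_nonneg _) hE ((hE' 1).trans h.symm)⟩
    have hfin' : ∃ i l, (d n).ω = (edgeState k₁ k₂ (![-1, 1] i) (q i n l)
        (decay k₁ k₂ (![-1, 1] i) (q i n l)) (x₁ n)).ω := by
      rcases hp.sign with h | h
      · exact ⟨1, hfin 1 h⟩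
      · exact ⟨0, hfin 0 h⟩
    obtain ⟨i, l, h⟩ := hfin'
    refine ⟨e.symm (i, l), ?_⟩
    simpa using h

end

/-! ### Asymptotic hypotheses in scaled variables -/

section
variable {k₁ k₂ : ℝ} {x x₁ x₂ : ℕ → ℝ}

theorem Apart.exists_abs (hk₂ : 0 < k₂)
    (h : Apart (fun n => |k₂ + x n * k₂ - k₂|) (fun _ => k₂)) :
    ∃ δ, 0 < δ ∧ δ ≤ 1 ∧ ∀ᶠ n in atTop, δ ≤ |(|x n| - 1)| := by
  obtain ⟨δ, hδ, h⟩ := h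
  refine ⟨min (δ / k₂) 1, by positivity, min_le_right _ _, h.mono fun n hn => ?_⟩
  have h1 : |k₂ + x n * k₂ - k₂| - k₂ = (|x n| - 1) * k₂ := by
    rw [add_sub_cancel_left, abs_mul, abs_of_pos hk₂]; ring
  rw [h1, abs_mul, abs_of_pos hk₂] at hn
  exact (min_le_left _ _).trans ((div_le_iff₀ hk₂).2 hn)

theorem Apart.exists_sub (hk₂ : 0 < k₂)
    (h : Apart (fun n => k₂ + x₁ n * k₂) (fun n => k₂ + x₂ n * k₂)) :
    ∃ δ, 0 < δ ∧ ∀ᶠ n in atTop, δ ≤ |x₁ n - x₂ n| := by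
  obtain ⟨δ, hδ, h⟩ := h
  refine ⟨δ / k₂, by positivity, h.mono fun n hn => ?_⟩
  rw [show k₂ + x₁ n * k₂ - (k₂ + x₂ n * k₂) = (x₁ n - x₂ n) * k₂ by ring, abs_mul,
    abs_of_pos hk₂] at hn
  exact (div_le_iff₀ hk₂).2 hn

theorem Close.tendsto_sub (hk₂ : 0 < k₂)
    (h : Close (fun n => k₂ + x₁ n * k₂) (fun n => k₂ + x₂ n * k₂)) :
    Tendsto (fun n => x₁ n - x₂ n) atTop (𝓝 0) := by
  have h1 := Tendsto.div_const h k₂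
  rw [zero_div] at h1
  refine h1.congr fun n => ?_
  field_simp
  ring

theorem Close.tendsto_sub_const (hk₂ : 0 < k₂) {c : ℝ}
    (h : Close (fun n => k₂ + x n * k₂ - k₂) (fun _ => c * k₂)) :
    Tendsto (fun n => x n - c) atTop (𝓝 0) := by
  have h1 := Tendsto.div_const h k₂
  rw [zero_div] at h1
  refine h1.congr fun n => ?_
  field_simp
  ring

theorem atMostModesNear (hk₂ : 0 < k₂) (hk : k₂ < k₁) {s₀ : ℝ} (hs₀ : s₀ = 1 ∨ s₀ = -1) {K δ : ℝ}
    (hδ : 0 < δ) (hδ1 : δ ≤ 1) (hK₁ : ∀ n, |x₁ n| ≤ K) (hK₂ : ∀ n, |x₂ n| ≤ K) {N : ℕ}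
    (h : ∀ᶠ n in atTop, (if |(|x₁ n| - 1)| < δ then 1 else 0) +
      (if |(|x₂ n| - 1)| < δ then 1 else 0) ≤ N) :
    AtMostModesNear k₁ k₂ (fun n => k₂ + x₁ n * k₂) (fun n => k₂ + x₂ n * k₂) s₀ N := by
  obtain ⟨η, hη, M, hM⟩ := encard_modes_near (K := K) hk₂ hk hs₀ hδ hδ1
  refine ⟨η, hη, ?_⟩
  filter_upwards [h, eventually_ge_atTop M] with n hn hnM
  exact (hM n hnM _ _ (hK₁ n) (hK₂ n)).trans (by exact_mod_cast hn)

theorem AtMostModesNear.noModeNear {k₃₁ k₃₂ : ℕ → ℝ} {a₀ : ℝ}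
    (h : AtMostModesNear k₁ k₂ k₃₁ k₃₂ a₀ 0) : NoModeNear k₁ k₂ k₃₁ k₃₂ a₀ := by
  obtain ⟨η, hη, h⟩ := h
  refine ⟨η, hη, h.mono fun n hn ω a ha => ?_⟩
  by_contra! hlt
  have h0 := Set.encard_eq_zero.1 (nonpos_iff_eq_zero.1 hn)
  exact Set.eq_empty_iff_forall_notMem.1 h0 ω ⟨a, ha, hlt⟩

theorem modesNearHaveFreq (hk₂ : 0 < k₂) (hk : k₂ < k₁) {s₀ σ : ℝ} (hs₀ : s₀ = 1 ∨ s₀ = -1)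
    (hσ : σ = 1 ∨ σ = -1) {K δ : ℝ} (hδ : 0 < δ) (hK₁ : ∀ n, |x₁ n| ≤ K) (hK₂ : ∀ n, |x₂ n| ≤ K)
    (h₁ : ∀ᶠ n in atTop, δ ≤ |s₀ * σ * x₁ n - 1|) (h₂ : ∀ᶠ n in atTop, δ ≤ |s₀ * σ * x₂ n - 1|) :
    ModesNearHaveFreq k₁ k₂ (fun n => k₂ + x₁ n * k₂) (fun n => k₂ + x₂ n * k₂) s₀
      (k₁ + k₂ - σ * (k₁ + s₀ * k₂)) := by
  intro ε hε
  obtain ⟨η, hη, M, hM⟩ := freq_near (K := K) hk₂ hk hs₀ hδ hε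
  refine ⟨η, hη, ?_⟩
  filter_upwards [h₁, h₂, eventually_ge_atTop M] with n h1 h2 hnM
  exact hM n hnM σ _ _ hσ (hK₁ n) (hK₂ n) h1 h2

theorem le_abs_sign_mul_sub_one {s₀ σ δ y : ℝ} (hs₀ : s₀ = 1 ∨ s₀ = -1) (hσ : σ = 1 ∨ σ = -1)
    (h : δ ≤ |(|y| - 1)|) : δ ≤ |s₀ * σ * y - 1| := by
  have h1 := abs_abs_sub_abs_le (s₀ * σ * y) 1
  rw [abs_sign_mul hs₀ hσ, abs_one] at h1
  exact h.trans h1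

/-- For x ≈ −s₀σ one has s₀σx ≈ −1, so on the branch σ the spring is far from its special value 1.
-/
theorem eventually_le_abs_of_tendsto {s₀ σ δ : ℝ} (hs₀ : s₀ = 1 ∨ s₀ = -1) (hσ : σ = 1 ∨ σ = -1)
    (hδ1 : δ ≤ 1) (h : Tendsto (fun n => x n - -(s₀ * σ)) atTop (𝓝 0)) :
    ∀ᶠ n in atTop, δ ≤ |s₀ * σ * x n - 1| := by
  filter_upwards [Metric.tendsto_nhds.1 h 1 one_pos] with n hn
  rw [Real.dist_eq, sub_zero] at hn
  have h1 := abs_lt.1 hn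
  refine hδ1.trans (le_abs.2 (Or.inr ?_))
  rcases hs₀ with rfl | rfl <;> rcases hσ with rfl | rfl <;> linarith

end

end DiatomicChain

/-! ### Assembly of the theorem -/

open DiatomicChain in
theorem theorem2 (k₁ k₂ : ℝ) (hk₂ : 0 < k₂) (hk : k₂ < k₁) (k₃₁ k₃₂ : ℕ → ℝ)
    (h₃₁ : ∀ n, 0 ≤ k₃₁ n) (h₃₂ : ∀ n, 0 ≤ k₃₂ n)
    (hbd : ∃ K : ℝ, ∀ n, k₃₁ n ≤ K ∧ k₃₂ n ≤ K) :
    (Apart (fun n => |k₃₁ n - k₂|) (fun _ => k₂) →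
      -- no left and no two-sided edge states, along any infinite set of chain lengths
      ((∀ᶠ n in atTop, k₃₁ n < 2 * k₂) →
        ∀ (S : Set ℕ) (s : ℕ → WaveData), S.Infinite → IsFamily k₁ k₂ k₃₁ k₃₂ S s →
          ¬ IsLeftEdge S s ∧ ¬ IsTwoSidedEdge S s) ∧
      -- exactly two left edge states
      ((∀ᶠ n in atTop, 2 * k₂ < k₃₁ n) → Apart k₃₁ k₃₂ →
        ∃ (s : Fin 2 → ℕ → WaveData) (ã : Fin 2 → ℕ → ℝ),
          (∀ᶠ n in atTop, -1 < ã 0 n ∧ ã 0 n < 0 ∧ 0 < ã 1 n ∧ ã 1 n < 1 ∧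
            ∀ j, IsSemiInfiniteRoot k₁ k₂ (k₃₁ n) (ã j n)) ∧
          (∀ j, IsFamily k₁ k₂ k₃₁ k₃₂ Set.univ (s j) ∧ IsLeftEdge Set.univ (s j) ∧
            (fun n => (s j n).a - ã j n) =O[atTop] (fun n => ã j n ^ (2 * n))) ∧
          (∀ᶠ n in atTop, (s 0 n).ω ≠ (s 1 n).ω) ∧
          (∀ (S : Set ℕ) (t : ℕ → WaveData), S.Infinite → IsFamily k₁ k₂ k₃₁ k₃₂ S t →
            IsLeftEdge S t → ∀ᶠ n in atTop, n ∈ S → ∃ j, (t n).ω = (s j n).ω)) ∧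
      -- exactly four two-sided edge states
      ((∀ᶠ n in atTop, 2 * k₂ < k₃₁ n) → Close k₃₁ k₃₂ →
        ∃ s : Fin 4 → ℕ → WaveData,
          (∀ j, IsFamily k₁ k₂ k₃₁ k₃₂ Set.univ (s j) ∧ IsTwoSidedEdge Set.univ (s j) ∧
            (∀ n, (s j n).c₁ = 1) ∧
            Tendsto (fun n => |(s j n).c₂ * (s j n).a ^ (-(2 * (n : ℤ)))|) atTop atTop ∧
            Tendsto (fun n => |(s j n).c₂|) atTop (𝓝 0)) ∧
          (∀ᶠ n in atTop, Function.Injective fun j => (s j n).ω) ∧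
          (∀ (S : Set ℕ) (t : ℕ → WaveData), S.Infinite → IsFamily k₁ k₂ k₃₁ k₃₂ S t →
            IsTwoSidedEdge S t → ∀ᶠ n in atTop, n ∈ S → ∃ j, (t n).ω = (s j n).ω)) ∧
      -- no slow-decaying or non-localized states
      (Apart (fun n => |k₃₂ n - k₂|) (fun _ => k₂) →
        NoModeNear k₁ k₂ k₃₁ k₃₂ 1 ∧ NoModeNear k₁ k₂ k₃₁ k₃₂ (-1)) ∧
      -- right end spring near a special value
      (Close (fun n => |k₃₂ n - k₂|) (fun _ => k₂) →
        AtMostModesNear k₁ k₂ k₃₁ k₃₂ 1 1 ∧ AtMostModesNear k₁ k₂ k₃₁ k₃₂ (-1) 1 ∧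
        ∀ σ : ℝ, σ = 1 ∨ σ = -1 →
          (Close (fun n => k₃₂ n - k₂) (fun _ => -σ * k₂) →
            ModesNearHaveFreq k₁ k₂ k₃₁ k₃₂ 1 (k₁ + k₂ - σ * (k₁ + k₂))) ∧
          (Close (fun n => k₃₂ n - k₂) (fun _ => σ * k₂) →
            ModesNearHaveFreq k₁ k₂ k₃₁ k₃₂ (-1) (k₁ + k₂ - σ * (k₁ - k₂))))) ∧
    -- both end springs near special values
    (Close (fun n => |k₃₁ n - k₂|) (fun _ => k₂) →
      Close (fun n => |k₃₂ n - k₂|) (fun _ => k₂) →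
        AtMostModesNear k₁ k₂ k₃₁ k₃₂ 1 2 ∧ AtMostModesNear k₁ k₂ k₃₁ k₃₂ (-1) 2 ∧
        ∀ σ : ℝ, σ = 1 ∨ σ = -1 →
          (Close (fun n => k₃₁ n - k₂) (fun _ => -σ * k₂) →
            Close (fun n => k₃₂ n - k₂) (fun _ => -σ * k₂) →
            ModesNearHaveFreq k₁ k₂ k₃₁ k₃₂ 1 (k₁ + k₂ - σ * (k₁ + k₂))) ∧
          (Close (fun n => k₃₁ n - k₂) (fun _ => σ * k₂) →
            Close (fun n => k₃₂ n - k₂) (fun _ => σ * k₂) →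
            ModesNearHaveFreq k₁ k₂ k₃₁ k₃₂ (-1) (k₁ + k₂ - σ * (k₁ - k₂)))) := by
  -- In the scaled variables k₃ = k₂ + xk₂ the threshold 2k₂ becomes x = 1, and nonnegativity of the
  -- stiffness becomes x ≥ −1.
  obtain ⟨x₁, rfl⟩ : ∃ x : ℕ → ℝ, k₃₁ = fun n => k₂ + x n * k₂ :=
    ⟨fun n => (k₃₁ n - k₂) / k₂, by ext n; field_simp; ring⟩
  obtain ⟨x₂, rfl⟩ : ∃ x : ℕ → ℝ, k₃₂ = fun n => k₂ + x n * k₂ :=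
    ⟨fun n => (k₃₂ n - k₂) / k₂, by ext n; field_simp; ring⟩
  obtain ⟨K, hK, hK₁, hK₂⟩ : ∃ K : ℝ, 0 < K ∧ (∀ n, |x₁ n| ≤ K) ∧ ∀ n, |x₂ n| ≤ K := by
    obtain ⟨K, hbd⟩ := hbd
    have hb : ∀ y : ℝ, 0 ≤ k₂ + y * k₂ → k₂ + y * k₂ ≤ K → |y| ≤ |K| / k₂ + 1 := by
      intro y h1 h2
      have h3 : 0 ≤ |K| / k₂ := by positivity
      refine abs_le.2 ⟨?_, ?_⟩
      · have : 0 ≤ 1 + y := nonneg_of_mul_nonneg_left (by linarith) hk₂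
        linarith
      · have : y ≤ |K| / k₂ := by
          rw [le_div_iff₀ hk₂]
          linarith [le_abs_self K]
        linarith
    exact ⟨|K| / k₂ + 1, by positivity, fun n => hb _ (h₃₁ n) (hbd n).1,
      fun n => hb _ (h₃₂ n) (hbd n).2⟩
  have one_sign : (1 : ℝ) = 1 ∨ (1 : ℝ) = -1 := Or.inl rfl
  have neg_one_sign : (-1 : ℝ) = 1 ∨ (-1 : ℝ) = -1 := Or.inr rfl
  refine ⟨fun hA₁ => ?_, fun hC₁ hC₂ => ?_⟩
  · obtain ⟨δ, hδ, hδ1, hx⟩ := hA₁.exists_abs hk₂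
    have hge : (∀ᶠ n in atTop, 2 * k₂ < k₂ + x₁ n * k₂) → ∀ᶠ n in atTop, 1 + δ ≤ x₁ n := by
      intro h
      filter_upwards [h, hx] with n h1 h2
      have h3 : 1 < x₁ n := lt_of_mul_lt_mul_right (by linarith) hk₂.le
      rw [abs_of_pos (by linarith : 0 < x₁ n), abs_of_pos (by linarith)] at h2
      linarith
    refine ⟨fun hlt S s hS hs => no_left_edge hk₂ hk hδ ?_ hS hs, fun hgt hap => ?_,
      fun hgt hcl => ?_, fun hA₂ => ?_, fun hC₂ => ?_⟩
    -- Since −1 ≤ x₁ < 1, staying δ away from |x₁| = 1 means |x₁| ≤ 1 − δ.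
    · filter_upwards [hlt, hx] with n h1 h2
      have h3 : x₁ n < 1 := lt_of_mul_lt_mul_right (by linarith) hk₂.le
      have h4 : -1 ≤ x₁ n := le_of_mul_le_mul_right (by linarith [h₃₁ n]) hk₂
      rw [abs_of_nonpos (by linarith [abs_le.2 ⟨h4, h3.le⟩])] at h2
      linarith
    · obtain ⟨δ', hδ', hap⟩ := hap.exists_sub hk₂
      exact exists_two_left_edge hk₂ hk (lt_min hδ hδ') hK
        ((hge hgt).mono fun n hn => by linarith [min_le_left δ δ']) hK₁ hK₂
        (hap.mono fun n hn => (min_le_right δ δ').trans hn)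
    · have hlim := hcl.tendsto_sub hk₂
      -- The margin is halved so that x₂, which is only asymptotically equal to x₁, satisfies it
      -- too.
      refine exists_four_two_sided_edge hk₂ hk (half_pos hδ) hK
        ((hge hgt).mono fun n hn => by linarith) ?_ hK₁ hK₂ hlim
      filter_upwards [hge hgt, hlim.eventually_lt_const (half_pos hδ)] with n h1 h2
      linarith
    · obtain ⟨δ', hδ', -, hx'⟩ := hA₂.exists_abs hk₂
      have h : ∀ s₀ : ℝ, (s₀ = 1 ∨ s₀ = -1) →
          NoModeNear k₁ k₂ (fun n => k₂ + x₁ n * k₂) (fun n => k₂ + x₂ n * k₂) s₀ := by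
        intro s₀ hs₀
        refine AtMostModesNear.noModeNear ?_
        have := atMostModesNear (N := 0) hk₂ hk hs₀ (lt_min hδ hδ') ((min_le_left _ _).trans hδ1)
          hK₁ hK₂ (by
            filter_upwards [hx, hx'] with n h1 h2
            rw [if_neg ((min_le_left _ _).trans h1).not_gt,
              if_neg ((min_le_right _ _).trans h2).not_gt])
        exact_mod_cast this
      exact ⟨h 1 one_sign, h (-1) neg_one_sign⟩
    · have h : ∀ s₀ : ℝ, (s₀ = 1 ∨ s₀ = -1) →
          AtMostModesNear k₁ k₂ (fun n => k₂ + x₁ n * k₂) (fun n => k₂ + x₂ n * k₂) s₀ 1 := by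
        intro s₀ hs₀
        have := atMostModesNear (N := 1) hk₂ hk hs₀ hδ hδ1 hK₁ hK₂ (by
            filter_upwards [hx] with n h1
            rw [if_neg h1.not_gt, zero_add]
            split_ifs <;> norm_num)
        exact_mod_cast this
      refine ⟨h 1 one_sign, h (-1) neg_one_sign, fun σ hσ => ⟨fun hc => ?_, fun hc => ?_⟩⟩
      · have := modesNearHaveFreq hk₂ hk one_sign hσ hδ hK₁ hK₂
          (hx.mono fun n hn => le_abs_sign_mul_sub_one one_sign hσ hn)
          (eventually_le_abs_of_tendsto one_sign hσ hδ1 (by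
            simpa using hc.tendsto_sub_const hk₂))
        simpa using this
      · have := modesNearHaveFreq hk₂ hk neg_one_sign hσ hδ hK₁ hK₂
          (hx.mono fun n hn => le_abs_sign_mul_sub_one neg_one_sign hσ hn)
          (eventually_le_abs_of_tendsto neg_one_sign hσ hδ1 (by
            simpa using hc.tendsto_sub_const hk₂))
        simpa [← sub_eq_add_neg] using this
  · have h : ∀ s₀ : ℝ, (s₀ = 1 ∨ s₀ = -1) →
        AtMostModesNear k₁ k₂ (fun n => k₂ + x₁ n * k₂) (fun n => k₂ + x₂ n * k₂) s₀ 2 := by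
      intro s₀ hs₀
      -- Each of the two ends accounts for at most one mode.
      have := atMostModesNear (N := 2) hk₂ hk hs₀ one_pos le_rfl hK₁ hK₂ (Eventually.of_forall
        fun n => by split_ifs <;> norm_num)
      exact_mod_cast this
    refine ⟨h 1 one_sign, h (-1) neg_one_sign, fun σ hσ => ⟨fun hc₁ hc₂ => ?_, fun hc₁ hc₂ => ?_⟩⟩
    · have := modesNearHaveFreq hk₂ hk one_sign hσ one_pos hK₁ hK₂
        (eventually_le_abs_of_tendsto one_sign hσ le_rfl (by
          simpa using hc₁.tendsto_sub_const hk₂))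
        (eventually_le_abs_of_tendsto one_sign hσ le_rfl (by
          simpa using hc₂.tendsto_sub_const hk₂))
      simpa using this
    · have := modesNearHaveFreq hk₂ hk neg_one_sign hσ one_pos hK₁ hK₂
        (eventually_le_abs_of_tendsto neg_one_sign hσ le_rfl (by
          simpa using hc₁.tendsto_sub_const hk₂))
        (eventually_le_abs_of_tendsto neg_one_sign hσ le_rfl (by
          simpa using hc₂.tendsto_sub_const hk₂))
      simpa [← sub_eq_add_neg] using this
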